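/- Let $0<\gamma\le 2$. Let $V\in C^1(\mathbb R)$ satisfy: $V(\varphi)\to-\infty$ as $\varphi\to-\infty$ and $V(\varphi)\to 0$ as $\varphi\to+\infty$; $V$ has exactly one critical point $\varphi_m$, with $\varphi_m>0$, $V(\varphi_m)>0$, and $V''(\varphi_m)$ exists and is negative; there are $\Lambda>0$ and $M<0$ with $V'(\varphi)\le-\Lambda V(\varphi)$ for all $\varphi<M$. Let $Q:\mathbb R\to[0,\infty)$ be continuous, and suppose that $\alpha(\varphi):=\frac{4-3\gamma}{2}Q(\varphi)$ is bounded. Consider, for unknown functions $(\varphi,y,\rho,H)$ of $t\ge t_0$, the flat Friedmann--Robertson--Walker system of a scalar field coupled to a perfect fluid, $$\dot\varphi=y,\qquad \dot y=-3Hy-V'(\varphi)+\alpha(\varphi)\rho,\qquad \dot\rho=-\rho\,(3\gamma H+\alpha(\varphi)y),\qquad \dot H=-\tfrac12y^2-\tfrac{\gamma}{2}\rho,$$ with the constraint $$3H^2=\tfrac12y^2+V(\varphi)+\rho .$$ For $\varphi_0<\varphi_m$ and $\rho_0>0$ let the critical velocity $\dot\varphi_{\rm crit}(\varphi_0,\rho_0)\in[-\infty,\infty]$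 be the infimum of the velocities $y_0$ for which some solution with $\varphi(t_0)=\varphi_0$, $y(t_0)=y_0$, $\rho(t_0)=\rho_0$, $H(t_0)>0$ satisfies $\varphi(t)\ge\varphi_m$ at some time $t\ge t_0$; thus a solution that starts below the critical velocity stays to the left of $\varphi_m$. Consider initial data with $\varphi(t_0)<\varphi_m$, $\rho(t_0)>0$, $H(t_0)>0$. Because of the constraint these are described by $(\varphi(t_0),y(t_0),\rho(t_0))\in\mathbb R^3$, and "almost every" refers to Lebesgue measure on $\mathbb R^3$. 1. For almost every such initial datum with $y(t_0)<\dot\varphi_{\rm crit}(\varphi(t_0),\rho(t_0))$, every solution with this initial datum that is maximally extended to the right exists exactly on an interval $[t_0,t_*)$ with $t_*<\infty$, and $\lim_{t\to t_*^-}H(t)=-\infty$. 2. More generally, outside a Lebesgue null set of such initial data, every solution that is maximally extended to the right and satisfies $\varphi(t)<\varphi_m$ on its whole interval of existence $[t_0,t_*)$ has $t_*<\infty$ and $\lim_{t\to t_*^-}H(t)=-\infty$. -/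

import Mathlib

open Set Filter Topology MeasureTheory

/-- The class of potentials: `C¹`, tending to `-∞` at `-∞` and to `0` at `+∞`, with a unique
critical point `φm > 0`, where the potential is positive and has a (strictly) negative second
derivative, and with the growth bound `V' ≤ -Λ V` to the left of some `M < 0`. -/
structure IsCollapsePotential (V : ℝ → ℝ) (φm : ℝ) : Prop where
  contDiff : ContDiff ℝ 1 V
  tendsto_atBot : Tendsto V atBot atBot
  tendsto_atTop : Tendsto V atTop (𝓝 0)
  critical_iff : ∀ x, deriv V x = 0 ↔ x = φm
  pos_critical : 0 < φm
  pos_value : 0 < V φm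
  nondegenerate : ∃ v < 0, HasDerivAt (deriv V) v φm
  growth : ∃ Λ > 0, ∃ M < 0, ∀ x < M, deriv V x ≤ -Λ * V x

/-- The coefficient `α(φ) = (4 - 3γ)/2 · Q(φ)` of the interaction terms. -/
noncomputable def couplingCoeff (γ : ℝ) (Q : ℝ → ℝ) (x : ℝ) : ℝ := (4 - 3 * γ) / 2 * Q x

/-- The half-open time interval `[t₀, T)`, where `T` may be `+∞`. -/
def timeInterval (t₀ : ℝ) (T : EReal) : Set ℝ := {t | t₀ ≤ t ∧ (t : EReal) < T}

/-- `(φ, y, ρ, H)` is a classical solution on `[t₀, T)` of the flat FRW system with a perfect fluid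
of index `γ` coupled to a scalar field, subject to the Friedmann constraint
(the derivative at the endpoint `t₀` is the one-sided one). -/
structure IsSolution (γ : ℝ) (V Q : ℝ → ℝ) (t₀ : ℝ) (T : EReal) (φ y ρ H : ℝ → ℝ) : Prop where
  lt_end : (t₀ : EReal) < T
  deriv_field : ∀ t ∈ timeInterval t₀ T, HasDerivWithinAt φ (y t) (timeInterval t₀ T) t
  deriv_velocity : ∀ t ∈ timeInterval t₀ T,
    HasDerivWithinAt y (-3 * H t * y t - deriv V (φ t) + couplingCoeff γ Q (φ t) * ρ t)
      (timeInterval t₀ T) t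
  deriv_density : ∀ t ∈ timeInterval t₀ T,
    HasDerivWithinAt ρ (-ρ t * (3 * γ * H t + couplingCoeff γ Q (φ t) * y t))
      (timeInterval t₀ T) t
  deriv_hubble : ∀ t ∈ timeInterval t₀ T,
    HasDerivWithinAt H (-(1 / 2) * y t ^ 2 - γ / 2 * ρ t) (timeInterval t₀ T) t
  friedmann : ∀ t ∈ timeInterval t₀ T, 3 * H t ^ 2 = 1 / 2 * y t ^ 2 + V (φ t) + ρ t

/-- A solution on `[t₀, T)` that cannot be extended to a solution on `[t₀, T')` with `T' > T`. -/
structure IsMaximalSolution (γ : ℝ) (V Q : ℝ → ℝ) (t₀ : ℝ) (T : EReal) (φ y ρ H : ℝ → ℝ) :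
    Prop where
  isSolution : IsSolution γ V Q t₀ T φ y ρ H
  maximal : ∀ (T' : EReal) (φ' y' ρ' H' : ℝ → ℝ), IsSolution γ V Q t₀ T' φ' y' ρ' H' →
    EqOn φ' φ (timeInterval t₀ T) → EqOn y' y (timeInterval t₀ T) →
    EqOn ρ' ρ (timeInterval t₀ T) → EqOn H' H (timeInterval t₀ T) → T' ≤ T

/-- The critical velocity for the initial values `φ₀` of the field and `ρ₀` of the density: the
infimum, in `[-∞, ∞]`, of the initial velocities for which some initially expanding solution with
these initial values reaches `φm`. -/
noncomputable def criticalVelocity (γ : ℝ) (V Q : ℝ → ℝ) (φm t₀ φ₀ ρ₀ : ℝ) : EReal :=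
  sInf {v : EReal | ∃ (y₀ : ℝ) (T : EReal) (φ y ρ H : ℝ → ℝ), v = (y₀ : EReal) ∧
    IsSolution γ V Q t₀ T φ y ρ H ∧ φ t₀ = φ₀ ∧ y t₀ = y₀ ∧ ρ t₀ = ρ₀ ∧ 0 < H t₀ ∧
    ∃ t ∈ timeInterval t₀ T, φm ≤ φ t}

/-- The solution defined on `[t₀, T)` ends at a finite time, where the Hubble function tends to
`-∞`. -/
def CollapsesInFiniteTime (t₀ : ℝ) (T : EReal) (H : ℝ → ℝ) : Prop :=
  ∃ ts : ℝ, t₀ < ts ∧ T = (ts : EReal) ∧ Tendsto H (𝓝[<] ts) atBot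

/-!
Eliminating the density by means of the constraint, `ρ = 3H² - y²/2 - V(φ)`, turns the system into
an autonomous one for `(φ, y, H)`, with the continuous vector field `cosmoField`.

*Non-collapsing solutions converge to a saddle.* Let a maximal solution stay to the left of `φm`. The
Hubble function `H` decreases. If it is bounded below on a finite interval of existence, then the
solution stays in a compact set (`exists_box_of_hubble_ge`) and can be continued
(`IsMaximalSolution.ne_coe`), so that a solution with a finite end collapses. If the solution is
global, then `H` cannot drop below `-Hs`, where `3 Hs² = V(φm)`, because of a Riccati inequality;
hence `H` converges, Barbalat's lemma gives `y, ρ → 0`, and the field converges to a critical point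
of `V`, that is to `φm`. So the solution converges to the equilibrium `(φm, 0, Hs)`
(`mem_saddleSet_of_global`), and it remains to be shown that `saddleSet`, the set of data with
this behaviour, is a null set. Below the critical velocity a solution never reaches `φm`, so that the
first assertion follows from the second one.

*Lack of a smooth flow.* As `V'` and `α` are only continuous, solutions need not be unique. However,
a trajectory which moves to the right, or is about to do so, can be parametrized by `φ`, and in this
parametrization the system is locally Lipschitz up to a singularity which is integrable because the
kinetic energy grows at least linearly. So uniqueness holds as long as `y` and `y'` do not vanish
simultaneously (`IsTraj.eqOn`). Volume estimates of Liouville's type for sets of data with unique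
trajectories follow from a split Euler scheme, each step of which is a composition of shears in one
coordinate and has a volume contraction controlled by one-sided Lipschitz constants
(`volume_le_of_forall_traj`). Finally, almost every trajectory avoids the degenerate turning points
`y = y' = 0` on the left of `φm`, because these form a null curve in the plane `y = 0`, and a
trajectory approaches this plane no faster than linearly in time (`volume_hitSet`).

*Nullity of the saddle set.* The sign of `α` is constant.

If `α ≤ 0`, then `y > 0` along every trajectory converging to the saddle, and these trajectories
approach the saddle so fast that, after time `t`, they occupy a volume of order
`exp(-(6 + 3γ) Hs t)`. The flow contracts volumes by no more than `exp(-(3 + 3γ + ε) Hs t)`, and so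
the volume was zero to begin with (`volume_settlingSet`).

If `α ≥ 0`, then an energy argument shows that trajectories without degenerate turning points
eventually move to the right (`eventually_velocity_pos`). Near the saddle these are described by
`x = y/H` and `w = ρ/H²` as functions of `φ`. Two of them cannot satisfy `x₁ < x₂` and `w₁ < w₂` at
the same `φ`: the ratios `x₂/x₁` and `w₂/w₁` would then diverge, which is incompatible with both
trajectories coming to rest at `φm` (`IsClimbing.not_lt`). A set without two points differing by a
positive multiple of `(0, 1, 1)`, even after taking closures, is null by Steinhaus' theorem
(`volume_climbingData`).
-/

/-! ### Trajectories and Euler schemes -/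

/-- `X` is a trajectory of the vector field `v` on `[0, s]`: it is continuous there and solves
`X' = v(X)` in the interior. -/
def IsTraj {E : Type*} [NormedAddCommGroup E] [NormedSpace ℝ E] (v : E → E) (s : ℝ) (X : ℝ → E) :
    Prop :=
  ContinuousOn X (Icc 0 s) ∧ ∀ t ∈ Ioo 0 s, HasDerivAt X (v (X t)) t

theorem le_of_deriv_le {f g f' g' : ℝ → ℝ} {a b : ℝ} (hf : ContinuousOn f (Icc a b))
    (hg : ContinuousOn g (Icc a b)) (hf' : ∀ t ∈ Ioo a b, HasDerivAt f (f' t) t)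
    (hg' : ∀ t ∈ Ioo a b, HasDerivAt g (g' t) t) (hle : ∀ t ∈ Ioo a b, f' t ≤ g' t)
    (h0 : f a ≤ g a) : ∀ t ∈ Icc a b, f t ≤ g t := by
  intro t ht
  have hmono : MonotoneOn (fun t => g t - f t) (Icc a b) := by
    apply monotoneOn_of_deriv_nonneg (convex_Icc a b) (hg.sub hf)
    · intro x hx
      rw [interior_Icc] at hx
      exact ((hg' x hx).sub (hf' x hx)).differentiableAt.differentiableWithinAt
    · intro x hx
      rw [interior_Icc] at hx
      have h2 := hle x hx
      rw [((hg' x hx).sub (hf' x hx)).deriv]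
      linarith
  have h1 := hmono (left_mem_Icc.2 (ht.1.trans ht.2)) ht ht.1
  simp only at h1
  linarith

theorem abs_le_of_abs_deriv_le {f g f' g' : ℝ → ℝ} {a b : ℝ} (hf : ContinuousOn f (Icc a b))
    (hg : ContinuousOn g (Icc a b)) (hf' : ∀ t ∈ Ioo a b, HasDerivAt f (f' t) t)
    (hg' : ∀ t ∈ Ioo a b, HasDerivAt g (g' t) t) (hle : ∀ t ∈ Ioo a b, |f' t| ≤ g' t)
    (h0 : f a = 0) (h1 : g a = 0) : ∀ t ∈ Icc a b, |f t| ≤ g t := by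
  intro t ht
  rw [abs_le]
  constructor
  · have := le_of_deriv_le (f := fun t => - g t) (g := f) (f' := fun t => - g' t) (g' := f') hg.neg hf
      (fun t ht => (hg' t ht).neg) hf' (fun t ht => by have := abs_le.1 (hle t ht); linarith)
      (by simp [h0, h1]) t ht
    exact this
  · exact le_of_deriv_le hf hg hf' hg' (fun t ht => (le_abs_self _).trans (hle t ht))
      (by simp [h0, h1]) t ht

section Euler

variable {E : Type*} [NormedAddCommGroup E] [NormedSpace ℝ E]

/-- The increment of an Euler scheme over the steps from `j` to `k` is close to `(k - j) ε v₀`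
when the increments of the single steps are close to `ε v₀`. -/
theorem norm_euler_increment_sub_le {S : ℕ → E} {w : ℕ → E} {ε η : ℝ} (hε : 0 ≤ ε) {v₀ : E}
    (hS : ∀ k, S (k + 1) = S k + ε • w k) {j k : ℕ} (hjk : j ≤ k)
    (hw : ∀ i, j ≤ i → i < k → ‖w i - v₀‖ ≤ η) :
    ‖S k - S j - (((k : ℝ) - j) * ε) • v₀‖ ≤ η * (((k : ℝ) - j) * ε) := by
  induction k, hjk using Nat.le_induction with
  | base => simp
  | succ k hk ih =>
    have h1 := ih (fun i hi hik => hw i hi (by omega))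
    have h2 := hw k hk (by omega)
    have h3 : S (k + 1) - S j - ((((k + 1 : ℕ) : ℝ) - j) * ε) • v₀
        = (S k - S j - (((k : ℝ) - j) * ε) • v₀) + ε • (w k - v₀) := by
      rw [hS k]; push_cast; module
    rw [h3]
    refine (norm_add_le _ _).trans ?_
    rw [norm_smul, Real.norm_of_nonneg hε]
    push_cast
    nlinarith [mul_le_mul_of_nonneg_left h2 hε]

variable [ProperSpace E]

/-- **Limits of Euler schemes.** Along an ultrafilter, the schemes of step `s / n` for a vector
field `vv (0, ·)`, with increments perturbed continuously in the step size, converge to a trajectory.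
No uniqueness of trajectories is assumed: the limit may depend on the ultrafilter. -/
theorem exists_traj_of_euler {vv : ℝ × E → E} (hv : Continuous vv) {s : ℝ} (hs : 0 < s) {p : E}
    {S : ℕ → ℕ → E} (hS0 : ∀ n, S n 0 = p)
    (hS : ∀ n k, S n (k + 1) = S n k + (s / n) • vv (s / n, S n k)) {M : ℝ}
    (hM : ∀ n k : ℕ, k ≤ n → ‖vv (s / n, S n k)‖ ≤ M) (U : Ultrafilter ℕ)
    (hU : (U : Filter ℕ) ≤ atTop) :
    ∃ X : ℝ → E, IsTraj (fun z => vv (0, z)) s X ∧ X 0 = p ∧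
      Tendsto (fun n => S n n) U (𝓝 (X s)) := by
  have hM0 : 0 ≤ M := (norm_nonneg _).trans (hM 0 0 le_rfl)
  set κ : ℝ → ℕ → ℕ := fun t n => ⌊t * n / s⌋₊ with hκ
  have hεpos : ∀ n : ℕ, 0 ≤ s / (n : ℝ) := fun n => by positivity
  have hκn : ∀ t ∈ Icc 0 s, ∀ n, κ t n ≤ n := by
    intro t ht n
    apply Nat.floor_le_of_le
    rw [div_le_iff₀ hs]
    nlinarith [ht.2, (Nat.cast_nonneg n : (0:ℝ) ≤ n)]
  have hinc : ∀ n j k, j ≤ k → k ≤ n → ‖S n k - S n j‖ ≤ M * (((k : ℝ) - j) * (s / n)) := by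
    intro n j k hjk hkn
    have := norm_euler_increment_sub_le (hεpos n) (v₀ := (0 : E)) (η := M) (hS n) hjk
      (fun i _ hik => by rw [sub_zero]; exact hM n i (by omega))
    simpa using this
  -- discretized times converge
  have hε0 : Tendsto (fun n : ℕ => s / (n : ℝ)) U (𝓝 0) :=
    (tendsto_const_div_atTop_nhds_zero_nat s).mono_left hU
  have hκ1 : ∀ t, 0 ≤ t → ∀ n : ℕ, 0 < n →
      (κ t n : ℝ) * (s / n) ≤ t ∧ t < (κ t n : ℝ) * (s / n) + s / n := by
    intro t ht n hn
    have hn' : (0 : ℝ) < n := by exact_mod_cast hn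
    have h1 : (κ t n : ℝ) ≤ t * n / s := Nat.floor_le (by positivity)
    have h2 : t * n / s < κ t n + 1 := Nat.lt_floor_add_one _
    rw [le_div_iff₀ hs] at h1
    rw [div_lt_iff₀ hs] at h2
    constructor
    · rw [← mul_div_assoc, div_le_iff₀ hn']; exact h1
    · rw [← mul_div_assoc, ← add_div, lt_div_iff₀ hn']; nlinarith
  have hnpos : ∀ᶠ n : ℕ in U, 0 < n := hU (eventually_gt_atTop 0)
  have hκt : ∀ t, 0 ≤ t → Tendsto (fun n => (κ t n : ℝ) * (s / n)) U (𝓝 t) := by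
    intro t ht
    have h1 : Tendsto (fun n : ℕ => t - s / (n : ℝ)) U (𝓝 t) := by
      simpa using tendsto_const_nhds.sub hε0
    refine tendsto_of_tendsto_of_tendsto_of_le_of_le' h1 tendsto_const_nhds ?_ ?_
    · filter_upwards [hnpos] with n hn
      have := (hκ1 t ht n hn).2
      linarith
    · filter_upwards [hnpos] with n hn using (hκ1 t ht n hn).1
  have hκmono : ∀ t t', t ≤ t' → ∀ n, κ t n ≤ κ t' n := by
    intro t t' htt n
    apply Nat.floor_mono
    gcongr
  -- pointwise limits
  have hlim : ∀ t, ∃ x, t ∈ Icc 0 s → Tendsto (fun n => S n (κ t n)) U (𝓝 x) := by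
    intro t
    by_cases ht : t ∈ Icc 0 s
    · have hball : ∀ n : ℕ, S n (κ t n) ∈ Metric.closedBall p (M * s) := by
        intro n
        rw [mem_closedBall_iff_norm, ← hS0 n]
        refine (hinc n 0 (κ t n) (Nat.zero_le _) (hκn t ht n)).trans ?_
        apply mul_le_mul_of_nonneg_left _ hM0
        rcases Nat.eq_zero_or_pos n with rfl | hn
        · simp [hs.le]
        · have := (hκ1 t ht.1 n hn).1
          simp only [Nat.cast_zero, sub_zero]
          linarith [ht.2]
      obtain ⟨x, -, hx⟩ := (isCompact_closedBall p (M * s)).ultrafilter_le_nhds'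
        (U.map fun n => S n (κ t n)) (Filter.mem_map.2 (Filter.univ_mem' hball))
      exact ⟨x, fun _ => hx⟩
    · exact ⟨0, fun h => absurd h ht⟩
  choose X hX using hlim
  have hLip : ∀ t ∈ Icc 0 s, ∀ t' ∈ Icc 0 s, t ≤ t' → ‖X t' - X t‖ ≤ M * (t' - t) := by
    intro t ht t' ht' htt
    have h1 := ((hX t' ht').sub (hX t ht)).norm
    have h2 : Tendsto (fun n => M * (((κ t' n : ℝ) - κ t n) * (s / n))) U (𝓝 (M * (t' - t))) := by
      have := ((hκt t' ht'.1).sub (hκt t ht.1)).const_mul M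
      simpa [sub_mul] using this
    refine le_of_tendsto_of_tendsto h1 h2 (Eventually.of_forall fun n => ?_)
    exact hinc n _ _ (hκmono t t' htt n) (hκn t' ht' n)
  have hX0 : X 0 = p := by
    have h1 := hX 0 ⟨le_rfl, hs.le⟩
    have h2 : (fun n => S n (κ 0 n)) = fun _ => p := by
      funext n; simp [hκ, hS0]
    rw [h2] at h1
    exact tendsto_nhds_unique h1 tendsto_const_nhds
  have hkey : ∀ t₀ ∈ Icc 0 s, ∀ η > 0, ∃ δ > 0, ∀ t ∈ Icc 0 s, ∀ t' ∈ Icc 0 s, t ≤ t' →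
      |t - t₀| < δ → |t' - t₀| < δ →
      ‖X t' - X t - (t' - t) • vv (0, X t₀)‖ ≤ η * (t' - t) := by
    intro t₀ ht₀ η hη
    have hc := Metric.continuous_iff.1 hv (0, X t₀) η hη
    obtain ⟨r, hr, hrv⟩ := hc
    refine ⟨r / (4 * (M + 1)), by positivity, fun t ht t' ht' htt h1 h2 => ?_⟩
    have hδ : M * (r / (4 * (M + 1))) ≤ r / 4 := by
      rw [← mul_div_assoc, div_le_div_iff₀ (by positivity) (by norm_num)]
      nlinarith
    have g1 : ∀ᶠ n : ℕ in U, s / (n : ℝ) < r := hε0.eventually (gt_mem_nhds hr)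
    have g2 : ∀ᶠ n : ℕ in U, M * (s / (n : ℝ)) < r / 4 := by
      have := hε0.const_mul M
      rw [mul_zero] at this
      exact this.eventually (gt_mem_nhds (by positivity))
    have g3 : ∀ᶠ n : ℕ in U, ‖S n (κ t₀ n) - X t₀‖ < r / 4 := by
      have := (hX t₀ ht₀).eventually (Metric.ball_mem_nhds _ (show 0 < r / 4 by positivity))
      filter_upwards [this] with n hn
      rwa [dist_eq_norm] at hn
    have l1 := (((hX t' ht').sub (hX t ht)).sub
      (((hκt t' ht'.1).sub (hκt t ht.1)).smul_const (vv (0, X t₀)))).norm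
    have l2 := ((hκt t' ht'.1).sub (hκt t ht.1)).const_mul η
    refine le_of_tendsto_of_tendsto l1 l2 ?_
    filter_upwards [g1, g2, g3, hnpos] with n hn1 hn2 hn3 hn
    have := norm_euler_increment_sub_le (hεpos n) (v₀ := vv (0, X t₀)) (η := η) (hS n)
      (hκmono t t' htt n) ?_
    · simpa [sub_mul] using this
    · intro i hi1 hi2
      have hin : i ≤ n := (hi2.le).trans (hκn t' ht' n)
      have hdist : ‖S n i - S n (κ t₀ n)‖ ≤ r / 2 := by
        have ha := hκ1 t ht.1 n hn
        have hb := hκ1 t' ht'.1 n hn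
        have hc := hκ1 t₀ ht₀.1 n hn
        have hi1' : (κ t n : ℝ) ≤ i := by exact_mod_cast hi1
        have hi2' : (i : ℝ) ≤ κ t' n := by exact_mod_cast hi2.le
        have he := hεpos n
        have hi1'' := mul_le_mul_of_nonneg_right hi1' he
        have hi2'' := mul_le_mul_of_nonneg_right hi2' he
        rw [abs_lt] at h1 h2
        rcases le_total i (κ t₀ n) with hle | hle
        · rw [norm_sub_rev]
          refine (hinc n _ _ hle (hκn t₀ ht₀ n)).trans ?_
          have : ((κ t₀ n : ℝ) - i) * (s / n) ≤ r / (4 * (M + 1)) + s / n := by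
            rw [sub_mul]; linarith
          have := mul_le_mul_of_nonneg_left this hM0
          rw [mul_add] at this
          linarith
        · refine (hinc n _ _ hle hin).trans ?_
          have : ((i : ℝ) - κ t₀ n) * (s / n) ≤ r / (4 * (M + 1)) + s / n := by
            rw [sub_mul]; linarith
          have := mul_le_mul_of_nonneg_left this hM0
          rw [mul_add] at this
          linarith
      have hd : dist (s / (n : ℝ), S n i) ((0 : ℝ), X t₀) < r := by
        rw [Prod.dist_eq, max_lt_iff]
        constructor
        · rw [Real.dist_eq, sub_zero, abs_of_nonneg (hεpos n)]; exact hn1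
        · rw [dist_eq_norm]
          have h4 : S n i - X t₀ = (S n i - S n (κ t₀ n)) + (S n (κ t₀ n) - X t₀) := by abel
          rw [h4]
          refine (norm_add_le _ _).trans_lt ?_
          linarith
      have := hrv _ hd
      rw [dist_eq_norm] at this
      exact this.le
  refine ⟨X, ⟨?_, ?_⟩, hX0, ?_⟩
  · have : LipschitzOnWith ⟨M, hM0⟩ X (Icc 0 s) := by
      apply LipschitzOnWith.of_dist_le_mul
      intro t ht t' ht'
      rcases le_total t t' with h | h
      · rw [dist_comm, dist_eq_norm, dist_comm, Real.dist_eq, abs_of_nonneg (sub_nonneg.2 h)]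
        exact hLip t ht t' ht' h
      · rw [dist_eq_norm, Real.dist_eq, abs_of_nonneg (sub_nonneg.2 h)]
        exact hLip t' ht' t ht h
    exact this.continuousOn
  · intro t₀ ht₀
    rw [hasDerivAt_iff_isLittleO, Asymptotics.isLittleO_iff]
    intro η hη
    obtain ⟨δ, hδ, hest⟩ := hkey t₀ ⟨ht₀.1.le, ht₀.2.le⟩ η hη
    have hn : ∀ᶠ t in 𝓝 t₀, t ∈ Ioo 0 s := Ioo_mem_nhds ht₀.1 ht₀.2
    have hn2 : ∀ᶠ t in 𝓝 t₀, |t - t₀| < δ := by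
      filter_upwards [Metric.ball_mem_nhds t₀ hδ] with t ht
      rwa [← Real.dist_eq]
    filter_upwards [hn, hn2] with t ht htd
    have hI : t ∈ Icc 0 s := ⟨ht.1.le, ht.2.le⟩
    have hI₀ : t₀ ∈ Icc 0 s := ⟨ht₀.1.le, ht₀.2.le⟩
    rcases le_total t₀ t with h | h
    · have := hest t₀ hI₀ t hI h (by simpa using hδ) htd
      rwa [Real.norm_of_nonneg (sub_nonneg.2 h)]
    · have := hest t hI t₀ hI₀ h htd (by simpa using hδ)
      rw [norm_sub_rev (t) t₀, Real.norm_of_nonneg (sub_nonneg.2 h)]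
      have h3 : X t - X t₀ - (t - t₀) • vv (0, X t₀)
          = -(X t₀ - X t - (t₀ - t) • vv (0, X t₀)) := by module
      rw [h3, norm_neg]
      exact this
  · have h1 := hX s ⟨hs.le, le_rfl⟩
    refine h1.congr' ?_
    filter_upwards [hnpos] with n hn
    have : κ s n = n := by
      simp only [hκ]
      rw [mul_div_assoc, mul_comm, div_mul_cancel₀ _ hs.ne']
      exact Nat.floor_natCast n
    rw [this]

/-- **Peano's theorem** for a bounded continuous vector field. -/
theorem exists_traj_of_bounded {v : E → E} (hv : Continuous v) {M : ℝ} (hM : ∀ z, ‖v z‖ ≤ M)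
    {s : ℝ} (hs : 0 < s) (p : E) : ∃ X : ℝ → E, IsTraj v s X ∧ X 0 = p := by
  obtain ⟨X, h1, h2, -⟩ := exists_traj_of_euler (vv := fun z => v z.2) (hv.comp continuous_snd) hs
    (p := p) (S := fun n k => Nat.rec p (fun _ z => z + (s / n) • v z) k) (fun n => rfl)
    (fun n k => rfl) (fun n k _ => hM _) (hyperfilter ℕ) (by
      rw [← Nat.cofinite_eq_atTop]; exact hyperfilter_le_cofinite)
  exact ⟨X, h1, h2⟩

end Euler

/-! ### Using the field as the independent variable -/

theorem continuousOn_invFunOn {f : ℝ → ℝ} {D : Set ℝ} (hD : D.OrdConnected)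
    (hmono : StrictMonoOn f D) : ContinuousOn (Function.invFunOn f D) (f '' D) := by
  intro σ hσ
  have hmem : ∀ τ ∈ f '' D, Function.invFunOn f D τ ∈ D := fun τ h => Function.invFunOn_mem h
  have heq : ∀ τ ∈ f '' D, f (Function.invFunOn f D τ) = τ := fun τ h => Function.invFunOn_eq h
  set g := Function.invFunOn f D
  have hg0 := hmem σ hσ
  refine tendsto_order.2 ⟨fun u hu => ?_, fun u hu => ?_⟩
  · by_cases h : ∃ t ∈ D, t < g σ
    · obtain ⟨t, ht, htσ⟩ := h
      have h1 : max t u ∈ D := hD.out ht hg0 ⟨le_max_left _ _, (max_lt htσ hu).le⟩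
      have h2 : f (max t u) < σ := by
        rw [← heq σ hσ]; exact hmono h1 hg0 (max_lt htσ hu)
      filter_upwards [mem_nhdsWithin_of_mem_nhds (lt_mem_nhds h2), self_mem_nhdsWithin] with τ hτ hτD
      rw [← heq τ hτD] at hτ
      exact (le_max_right _ _).trans_lt ((hmono.lt_iff_lt h1 (hmem τ hτD)).1 hτ)
    · push Not at h
      filter_upwards [self_mem_nhdsWithin] with τ hτD
      exact hu.trans_le (h _ (hmem τ hτD))
  · by_cases h : ∃ t ∈ D, g σ < t
    · obtain ⟨t, ht, htσ⟩ := h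
      have h1 : min t u ∈ D := hD.out hg0 ht ⟨(lt_min htσ hu).le, min_le_left _ _⟩
      have h2 : σ < f (min t u) := by
        rw [← heq σ hσ]; exact hmono hg0 h1 (lt_min htσ hu)
      filter_upwards [mem_nhdsWithin_of_mem_nhds (gt_mem_nhds h2), self_mem_nhdsWithin] with τ hτ hτD
      rw [← heq τ hτD] at hτ
      exact ((hmono.lt_iff_lt (hmem τ hτD) h1).1 hτ).trans_le (min_le_right _ _)
    · push Not at h
      filter_upwards [self_mem_nhdsWithin] with τ hτD
      exact (h _ (hmem τ hτD)).trans_lt hu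

theorem image_mem_nhds_of_strictMonoOn {f : ℝ → ℝ} {D : Set ℝ} (hf : ContinuousOn f D)
    (hmono : StrictMonoOn f D) {t : ℝ} (hD : D ∈ 𝓝 t) : f '' D ∈ 𝓝 (f t) := by
  obtain ⟨ε, hε, hball⟩ := Metric.nhds_basis_closedBall.mem_iff.1 hD
  rw [Real.closedBall_eq_Icc] at hball
  have h1 : t - ε ∈ D := hball ⟨le_rfl, by linarith⟩
  have h2 : t + ε ∈ D := hball ⟨by linarith, le_rfl⟩
  have h0 : t ∈ D := hball ⟨by linarith, by linarith⟩
  have hivt := intermediate_value_Icc (by linarith : t - ε ≤ t + ε) (hf.mono hball)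
  exact mem_of_superset (Icc_mem_nhds (hmono h1 h0 (by linarith)) (hmono h0 h2 (by linarith)))
    (hivt.trans (image_mono hball))

theorem hasDerivAt_invFunOn {f : ℝ → ℝ} {D : Set ℝ} (hD : D.OrdConnected)
    (hf : ContinuousOn f D) (hmono : StrictMonoOn f D) {t f' : ℝ} (ht : D ∈ 𝓝 t)
    (hf' : HasDerivAt f f' t) (h0 : f' ≠ 0) :
    HasDerivAt (Function.invFunOn f D) f'⁻¹ (f t) := by
  have him := image_mem_nhds_of_strictMonoOn hf hmono ht
  have hc := (continuousOn_invFunOn hD hmono).continuousAt him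
  have hinv : Function.invFunOn f D (f t) = t :=
    hmono.injOn.leftInvOn_invFunOn (mem_of_mem_nhds ht)
  refine HasDerivAt.of_local_left_inverse hc (by rwa [hinv]) h0 ?_
  filter_upwards [him] with σ hσ using Function.invFunOn_eq hσ

/-! ### Uniqueness away from degenerate turning points -/

/-- The vector field of the second-order equation `φ'' = F(φ, φ', h)` coupled to `h' = G(φ, φ', h)`,
in the coordinates `(φ, y, h)` with `y = φ'`. -/
def secondOrderField (F G : ℝ × ℝ × ℝ → ℝ) (z : ℝ × ℝ × ℝ) : ℝ × ℝ × ℝ := (z.2.1, F z, G z)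

theorem hasDerivAt_triple_iff {X : ℝ → ℝ × ℝ × ℝ} {a b c t : ℝ} :
    HasDerivAt X (a, b, c) t ↔ HasDerivAt (fun t => (X t).1) a t ∧
      HasDerivAt (fun t => (X t).2.1) b t ∧ HasDerivAt (fun t => (X t).2.2) c t := by
  constructor
  · intro h
    have h1 : HasDerivAt (fun t => (X t).1) a t :=
      (hasFDerivAt_fst (𝕜 := ℝ) (E := ℝ) (F := ℝ × ℝ)).comp_hasDerivAt t h
    have h2 : HasDerivAt (fun t => (X t).2) (b, c) t :=
      (hasFDerivAt_snd (𝕜 := ℝ) (E := ℝ) (F := ℝ × ℝ)).comp_hasDerivAt t h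
    exact ⟨h1, (hasFDerivAt_fst (𝕜 := ℝ) (E := ℝ) (F := ℝ)).comp_hasDerivAt t h2,
      (hasFDerivAt_snd (𝕜 := ℝ) (E := ℝ) (F := ℝ)).comp_hasDerivAt t h2⟩
  · rintro ⟨h1, h2, h3⟩
    exact h1.prodMk (h2.prodMk h3)

theorem IsTraj.shift {E : Type*} [NormedAddCommGroup E] [NormedSpace ℝ E] {v : E → E} {s : ℝ}
    {X : ℝ → E} (h : IsTraj v s X) {a : ℝ} (ha : 0 ≤ a) :
    IsTraj v (s - a) (fun t => X (a + t)) := by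
  constructor
  · refine h.1.comp (by fun_prop) ?_
    intro t ht
    exact ⟨by linarith [ht.1], by linarith [ht.2]⟩
  · intro t ht
    have := h.2 (a + t) ⟨by linarith [ht.1], by linarith [ht.2]⟩
    exact this.comp_const_add a t

theorem IsTraj.mono {E : Type*} [NormedAddCommGroup E] [NormedSpace ℝ E] {v : E → E} {s s' : ℝ}
    {X : ℝ → E} (h : IsTraj v s X) (hs : s' ≤ s) : IsTraj v s' X :=
  ⟨h.1.mono (Icc_subset_Icc_right hs), fun t ht => h.2 t ⟨ht.1, ht.2.trans_le hs⟩⟩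

section Uniqueness

variable {F G : ℝ × ℝ × ℝ → ℝ} {s : ℝ} {X X₁ X₂ : ℝ → ℝ × ℝ × ℝ}

/-- A trajectory starting with `φ' > 0`, or with `φ' = 0` and `φ'' > 0`, moves to the right for a
short time, with kinetic energy at least proportional to the distance. -/
theorem exists_energy_lower_bound (hF : Continuous F) (hs : 0 < s)
    (hX : IsTraj (secondOrderField F G) s X)
    (h0 : 0 < (X 0).2.1 ∨ (X 0).2.1 = 0 ∧ 0 < F (X 0)) :
    ∃ η, 0 < η ∧ η ≤ s ∧ ∃ c > 0, ∀ t ∈ Ioc 0 η, 0 < (X t).2.1 ∧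
      c * ((X t).1 - (X 0).1) ≤ (X t).2.1 ^ 2 / 2 := by
  have hmem0 : (0 : ℝ) ∈ Icc 0 s := ⟨le_rfl, hs.le⟩
  have hd : ∀ t ∈ Ioo 0 s, HasDerivAt (fun t => (X t).1) (X t).2.1 t ∧
      HasDerivAt (fun t => (X t).2.1) (F (X t)) t := fun t ht =>
    ⟨(hasDerivAt_triple_iff.1 (hX.2 t ht)).1, (hasDerivAt_triple_iff.1 (hX.2 t ht)).2.1⟩
  have hXc := hX.1
  -- an open condition at time zero persists on an interval
  have hpersist : ∀ {f : ℝ × ℝ × ℝ → ℝ}, Continuous f → ∀ a, a < f (X 0) →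
      ∃ η, 0 < η ∧ η ≤ s ∧ ∀ t ∈ Icc 0 η, a < f (X t) := by
    intro f hf a ha
    have h1 : ContinuousWithinAt (fun t => f (X t)) (Icc 0 s) 0 :=
      (hf.comp_continuousOn hXc) 0 hmem0
    have h2 := h1.eventually (lt_mem_nhds ha)
    rw [nhdsWithin_Icc_eq_nhdsGE hs] at h2
    obtain ⟨u, hu, hsub⟩ := mem_nhdsGE_iff_exists_Icc_subset.1 h2
    refine ⟨min u s, lt_min hu hs, min_le_right _ _, fun t ht => ?_⟩
    exact hsub ⟨ht.1, ht.2.trans (min_le_left _ _)⟩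
  rcases h0 with h0 | ⟨h0, hF0⟩
  · obtain ⟨η₁, h1, h1s, hη₁⟩ := hpersist (f := fun z => z.2.1) (by fun_prop) ((X 0).2.1 / 2)
      (by linarith)
    obtain ⟨η₂, h2, h2s, hη₂⟩ := hpersist (f := fun z => - z.1) (by fun_prop) (-(X 0).1 - 1)
      (by linarith)
    refine ⟨min η₁ η₂, lt_min h1 h2, (min_le_left _ _).trans h1s, (X 0).2.1 ^ 2 / 8, by positivity,
      fun t ht => ?_⟩
    have g1 := hη₁ t ⟨ht.1.le, ht.2.trans (min_le_left _ _)⟩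
    have g2 := hη₂ t ⟨ht.1.le, ht.2.trans (min_le_right _ _)⟩
    refine ⟨by linarith, ?_⟩
    have g3 : (X t).1 - (X 0).1 ≤ 1 := by linarith
    have g4 : (X 0).2.1 ^ 2 / 4 ≤ (X t).2.1 ^ 2 := by nlinarith
    nlinarith [sq_nonneg (X 0).2.1]
  · obtain ⟨η, hη, hηs, hFη⟩ := hpersist hF (F (X 0) / 2) (by linarith)
    have hy : ∀ t ∈ Icc 0 η, F (X 0) / 2 * t ≤ (X t).2.1 := by
      apply le_of_deriv_le (f' := fun _ => F (X 0) / 2) (g' := fun t => F (X t))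
      · fun_prop
      · exact (continuous_fst.comp continuous_snd).comp_continuousOn
          (hXc.mono (Icc_subset_Icc_right hηs))
      · intro t _; simpa using (hasDerivAt_id t).const_mul (F (X 0) / 2)
      · intro t ht; exact (hd t ⟨ht.1, ht.2.trans_le hηs⟩).2
      · intro t ht; exact (hFη t ⟨ht.1.le, ht.2.le⟩).le
      · rw [h0]; simp
    have hen : ∀ t ∈ Icc 0 η, F (X 0) / 2 * ((X t).1 - (X 0).1) ≤ (X t).2.1 ^ 2 / 2 := by
      apply le_of_deriv_le (f' := fun t => F (X 0) / 2 * (X t).2.1)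
        (g' := fun t => (X t).2.1 * F (X t))
      · exact continuousOn_const.mul ((continuous_fst.comp_continuousOn
          (hXc.mono (Icc_subset_Icc_right hηs))).sub continuousOn_const)
      · have := (continuous_fst.comp continuous_snd).comp_continuousOn
          (hXc.mono (Icc_subset_Icc_right hηs))
        exact (this.pow 2).div_const 2
      · intro t ht
        exact ((hd t ⟨ht.1, ht.2.trans_le hηs⟩).1.sub_const _).const_mul _
      · intro t ht
        have := (((hd t ⟨ht.1, ht.2.trans_le hηs⟩).2.pow 2).div_const 2)
        exact this.congr_deriv (by norm_num; ring)
      · intro t ht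
        have g1 := hFη t ⟨ht.1.le, ht.2.le⟩
        have g2 := hy t ⟨ht.1.le, ht.2.le⟩
        have g3 : 0 ≤ F (X 0) / 2 * t := by have := ht.1; positivity
        nlinarith
      · rw [h0]; simp
    refine ⟨η, hη, hηs, F (X 0) / 2, by positivity, fun t ht => ⟨?_, hen t ⟨ht.1.le, ht.2⟩⟩⟩
    have := hy t ⟨ht.1.le, ht.2⟩
    have g3 : 0 < F (X 0) / 2 * t := by have := ht.1; positivity
    linarith

/-- A right-moving piece of trajectory, parametrized by `φ ∈ [a, b]`: velocity `Y`, third coordinate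
`h`, and time `τ`. -/
structure IsFieldParam (F G : ℝ × ℝ × ℝ → ℝ) (X : ℝ → ℝ × ℝ × ℝ) (a b : ℝ) (Y h τ : ℝ → ℝ) :
    Prop where
  contY : ContinuousOn Y (Icc a b)
  conth : ContinuousOn h (Icc a b)
  contτ : ContinuousOn τ (Icc a b)
  start : τ a = 0
  pos : ∀ σ ∈ Ioc a b, 0 < Y σ
  derivY : ∀ σ ∈ Ioo a b, HasDerivAt Y (F (σ, Y σ, h σ) / Y σ) σ
  derivh : ∀ σ ∈ Ioo a b, HasDerivAt h (G (σ, Y σ, h σ) / Y σ) σ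
  derivτ : ∀ σ ∈ Ioo a b, HasDerivAt τ (1 / Y σ) σ
  eq : ∀ σ ∈ Icc a b, X (τ σ) = (σ, Y σ, h σ)
  inv : ∀ t ∈ Icc 0 (τ b), (X t).1 ∈ Icc a b ∧ τ (X t).1 = t
  pos_time : 0 < τ b

theorem strictMonoOn_field {η : ℝ} (hX : IsTraj (secondOrderField F G) s X) (hη : η ≤ s)
    (hpos : ∀ t ∈ Ioo 0 η, 0 < (X t).2.1) : StrictMonoOn (fun t => (X t).1) (Icc 0 η) := by
  apply strictMonoOn_of_deriv_pos (convex_Icc 0 η)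
  · exact continuous_fst.comp_continuousOn (hX.1.mono (Icc_subset_Icc_right hη))
  · intro t ht
    rw [interior_Icc] at ht
    have := (hasDerivAt_triple_iff.1 (hX.2 t ⟨ht.1, ht.2.trans_le hη⟩)).1
    rw [this.deriv]
    exact hpos t ht

theorem exists_fieldParam {η : ℝ} (hX : IsTraj (secondOrderField F G) s X)
    (hη : 0 < η) (hηs : η ≤ s) (hpos : ∀ t ∈ Ioc 0 η, 0 < (X t).2.1) {b : ℝ}
    (hb : (X 0).1 < b) (hbη : b ≤ (X η).1) :
    ∃ Y h τ : ℝ → ℝ, IsFieldParam F G X (X 0).1 b Y h τ ∧ ∀ σ ∈ Icc (X 0).1 b, τ σ ∈ Icc 0 η := by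
  have hmono := strictMonoOn_field hX hηs (fun t ht => hpos t ⟨ht.1, ht.2.le⟩)
  have hc : ContinuousOn (fun t => (X t).1) (Icc 0 η) :=
    continuous_fst.comp_continuousOn (hX.1.mono (Icc_subset_Icc_right hηs))
  have h0m : (0 : ℝ) ∈ Icc 0 η := ⟨le_rfl, hη.le⟩
  have hηm : η ∈ Icc 0 η := ⟨hη.le, le_rfl⟩
  set f : ℝ → ℝ := fun t => (X t).1 with hf
  set τ := Function.invFunOn f (Icc 0 η) with hτ
  have him : Icc (X 0).1 b ⊆ f '' Icc 0 η := fun σ hσ =>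
    intermediate_value_Icc hη.le hc ⟨hσ.1, hσ.2.trans hbη⟩
  have hτmem : ∀ σ ∈ Icc (X 0).1 b, τ σ ∈ Icc 0 η := fun σ hσ => Function.invFunOn_mem (him hσ)
  have hτeq : ∀ σ ∈ Icc (X 0).1 b, (X (τ σ)).1 = σ := fun σ hσ => Function.invFunOn_eq (him hσ)
  have hτinv : ∀ t ∈ Icc 0 η, τ (X t).1 = t := fun t ht => hmono.injOn.leftInvOn_invFunOn ht
  have hτc : ContinuousOn τ (Icc (X 0).1 b) :=
    (continuousOn_invFunOn ordConnected_Icc hmono).mono him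
  have hXτ : ContinuousOn (fun σ => X (τ σ)) (Icc (X 0).1 b) :=
    (hX.1.mono (Icc_subset_Icc_right hηs)).comp hτc hτmem
  have hτ0 : τ (X 0).1 = 0 := hτinv 0 h0m
  have hτpos : ∀ σ ∈ Ioc (X 0).1 b, 0 < τ σ := by
    intro σ hσ
    refine lt_of_le_of_ne (hτmem σ ⟨hσ.1.le, hσ.2⟩).1 ?_
    intro h
    have h1 := hτeq σ ⟨hσ.1.le, hσ.2⟩
    rw [← h] at h1
    exact hσ.1.ne h1
  have hYpos : ∀ σ ∈ Ioc (X 0).1 b, 0 < (X (τ σ)).2.1 := fun σ hσ =>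
    hpos _ ⟨hτpos σ hσ, (hτmem σ ⟨hσ.1.le, hσ.2⟩).2⟩
  have hτint : ∀ σ ∈ Ioo (X 0).1 b, τ σ ∈ Ioo 0 η := by
    intro σ hσ
    refine ⟨hτpos σ ⟨hσ.1, hσ.2.le⟩, lt_of_le_of_ne (hτmem σ ⟨hσ.1.le, hσ.2.le⟩).2 ?_⟩
    intro h
    have h1 := hτeq σ ⟨hσ.1.le, hσ.2.le⟩
    rw [h] at h1
    linarith [hσ.2]
  have hdτ : ∀ σ ∈ Ioo (X 0).1 b, HasDerivAt τ (1 / (X (τ σ)).2.1) σ := by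
    intro σ hσ
    have h1 := hτint σ hσ
    have h2 := (hasDerivAt_triple_iff.1 (hX.2 (τ σ) ⟨h1.1, h1.2.trans_le hηs⟩)).1
    have h3 := hasDerivAt_invFunOn ordConnected_Icc hc hmono (Icc_mem_nhds h1.1 h1.2) h2
      (hYpos σ ⟨hσ.1, hσ.2.le⟩).ne'
    have h4 : f (τ σ) = σ := hτeq σ ⟨hσ.1.le, hσ.2.le⟩
    rw [h4] at h3
    rw [one_div]
    exact h3
  have hXeq : ∀ σ ∈ Icc (X 0).1 b, X (τ σ) = (σ, (X (τ σ)).2.1, (X (τ σ)).2.2) := by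
    intro σ hσ
    ext <;> simp [hτeq σ hσ]
  refine ⟨fun σ => (X (τ σ)).2.1, fun σ => (X (τ σ)).2.2, τ, ⟨?_, ?_, hτc, hτ0, hYpos, ?_, ?_, hdτ,
    hXeq, ?_, hτpos b ⟨hb, le_rfl⟩⟩, hτmem⟩
  · exact (continuous_fst.comp continuous_snd).comp_continuousOn hXτ
  · exact (continuous_snd.comp continuous_snd).comp_continuousOn hXτ
  · intro σ hσ
    have h1 := hτint σ hσ
    have h2 := (hasDerivAt_triple_iff.1 (hX.2 (τ σ) ⟨h1.1, h1.2.trans_le hηs⟩)).2.1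
    have h3 := h2.comp σ (hdτ σ hσ)
    rw [← hXeq σ ⟨hσ.1.le, hσ.2.le⟩, div_eq_mul_one_div]
    exact h3
  · intro σ hσ
    have h1 := hτint σ hσ
    have h2 := (hasDerivAt_triple_iff.1 (hX.2 (τ σ) ⟨h1.1, h1.2.trans_le hηs⟩)).2.2
    have h3 := h2.comp σ (hdτ σ hσ)
    rw [← hXeq σ ⟨hσ.1.le, hσ.2.le⟩, div_eq_mul_one_div]
    exact h3
  · intro t ht
    have hbm : b ∈ Icc (X 0).1 b := ⟨hb.le, le_rfl⟩
    have ht' : t ∈ Icc 0 η := ⟨ht.1, ht.2.trans (hτmem b hbm).2⟩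
    refine ⟨⟨hmono.monotoneOn h0m ht' ht.1, ?_⟩, hτinv t ht'⟩
    have := hmono.monotoneOn ht' (hτmem b hbm) ht.2
    simp only [hf] at this
    rwa [hτeq b hbm] at this

end Uniqueness

section Uniqueness

variable {F G : ℝ × ℝ × ℝ → ℝ} {s : ℝ} {X X₁ X₂ : ℝ → ℝ × ℝ × ℝ}

/-- One step of the contraction argument for uniqueness at a turning point: with energies bounded
below by a multiple of `σ - a`, a bound on the differences of the energies and of the third
coordinates improves by the factor two on short intervals. -/
theorem fieldParam_contraction {a b : ℝ} {Y₁ h₁ τ₁ Y₂ h₂ τ₂ : ℝ → ℝ} {K M r q : ℝ} (hK : 0 ≤ K)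
    (hM : 0 ≤ M)
    (hFL : ∀ σ y h y' h', |F (σ, y, h) - F (σ, y', h')| ≤ K * (|y - y'| + |h - h'|))
    (hGL : ∀ σ y h y' h', |G (σ, y, h) - G (σ, y', h')| ≤ K * (|y - y'| + |h - h'|))
    (hGM : ∀ z, |G z| ≤ M)
    (P₁ : IsFieldParam F G X₁ a b Y₁ h₁ τ₁) (P₂ : IsFieldParam F G X₂ a b Y₂ h₂ τ₂)
    (hY0 : Y₁ a = Y₂ a) (hh0 : h₁ a = h₂ a)
    (hr : 0 < r) (hr₁ : ∀ σ ∈ Ioo a b, r * √(σ - a) ≤ Y₁ σ)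
    (hr₂ : ∀ σ ∈ Ioo a b, r * √(σ - a) ≤ Y₂ σ)
    (hδ₁ : 2 * K * (K + 1) * √(b - a) / r ≤ 1)
    (hδ₂ : 4 * ((K + 1) / r + 2 * M * (K + 1) / r ^ 3) * √(b - a) ≤ 1)
    (hq : 0 ≤ q)
    (hU : ∀ σ ∈ Icc a b, |Y₁ σ ^ 2 / 2 - Y₂ σ ^ 2 / 2| ≤ 2 * (K + 1) * q * (σ - a))
    (hh : ∀ σ ∈ Icc a b, |h₁ σ - h₂ σ| ≤ q) :
    (∀ σ ∈ Icc a b, |Y₁ σ ^ 2 / 2 - Y₂ σ ^ 2 / 2| ≤ 2 * (K + 1) * (q / 2) * (σ - a)) ∧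
      ∀ σ ∈ Icc a b, |h₁ σ - h₂ σ| ≤ q / 2 := by
  have hsq : ∀ σ ∈ Ioo a b, 0 < √(σ - a) ∧ √(σ - a) ≤ √(b - a) ∧ √(σ - a) ^ 2 = σ - a := by
    intro σ hσ
    refine ⟨Real.sqrt_pos.2 (by linarith [hσ.1]), Real.sqrt_le_sqrt (by linarith [hσ.2]),
      Real.sq_sqrt (by linarith [hσ.1])⟩
  have hΔY : ∀ σ ∈ Ioo a b, |Y₁ σ - Y₂ σ| ≤ 2 * (K + 1) * q / r * √(σ - a) := by
    intro σ hσ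
    obtain ⟨s1, s2, s3⟩ := hsq σ hσ
    have h1 := hU σ ⟨hσ.1.le, hσ.2.le⟩
    have e1 := hr₁ σ hσ
    have e2 := hr₂ σ hσ
    have h3 : Y₁ σ ^ 2 / 2 - Y₂ σ ^ 2 / 2 = (Y₁ σ - Y₂ σ) * ((Y₁ σ + Y₂ σ) / 2) := by ring
    have hp : 0 < (Y₁ σ + Y₂ σ) / 2 := by
      have := mul_pos hr s1
      linarith
    rw [h3, abs_mul, abs_of_pos hp] at h1
    have h4 : |Y₁ σ - Y₂ σ| * (r * √(σ - a)) ≤ 2 * (K + 1) * q * (σ - a) :=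
      (mul_le_mul_of_nonneg_left (by linarith) (abs_nonneg _)).trans h1
    have h5 : |Y₁ σ - Y₂ σ| * r ≤ 2 * (K + 1) * q * √(σ - a) := by
      by_contra hcon
      push Not at hcon
      have h6 := mul_lt_mul_of_pos_right hcon s1
      have h7 : 2 * (K + 1) * q * √(σ - a) * √(σ - a) = 2 * (K + 1) * q * (σ - a) := by
        rw [mul_assoc, ← sq, s3]
      linarith
    rw [div_mul_eq_mul_div, le_div_iff₀ hr]
    exact h5
  have hsum : ∀ σ ∈ Ioo a b, K * (|Y₁ σ - Y₂ σ| + |h₁ σ - h₂ σ|) ≤ (K + 1) * q := by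
    intro σ hσ
    obtain ⟨s1, s2, s3⟩ := hsq σ hσ
    have h1 := hΔY σ hσ
    have h2 := hh σ ⟨hσ.1.le, hσ.2.le⟩
    have h3 : K * (2 * (K + 1) * q / r * √(σ - a)) ≤ q := by
      calc K * (2 * (K + 1) * q / r * √(σ - a)) = (2 * K * (K + 1) * √(σ - a) / r) * q := by ring
        _ ≤ (2 * K * (K + 1) * √(b - a) / r) * q := by gcongr
        _ ≤ 1 * q := by gcongr
        _ = q := one_mul q
    have h4 := mul_le_mul_of_nonneg_left h1 hK
    have h5 := mul_le_mul_of_nonneg_left h2 hK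
    linarith
  constructor
  · apply abs_le_of_abs_deriv_le (f' := fun σ => F (σ, Y₁ σ, h₁ σ) - F (σ, Y₂ σ, h₂ σ))
      (g' := fun _ => 2 * (K + 1) * (q / 2))
    · exact ((P₁.contY.pow 2).div_const 2).sub ((P₂.contY.pow 2).div_const 2)
    · fun_prop
    · intro σ hσ
      have p1 := P₁.pos σ ⟨hσ.1, hσ.2.le⟩
      have p2 := P₂.pos σ ⟨hσ.1, hσ.2.le⟩
      have d1 := (((P₁.derivY σ hσ).pow 2).div_const 2).sub (((P₂.derivY σ hσ).pow 2).div_const 2)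
      exact d1.congr_deriv (by norm_num; field_simp)
    · intro σ _
      simpa using ((hasDerivAt_id σ).sub_const a).const_mul (2 * (K + 1) * (q / 2))
    · intro σ hσ
      have := (hFL σ (Y₁ σ) (h₁ σ) (Y₂ σ) (h₂ σ)).trans (hsum σ hσ)
      linarith
    · simp [hY0]
    · simp
  · set C := (K + 1) / r + 2 * M * (K + 1) / r ^ 3 with hC
    have hmain : ∀ σ ∈ Icc a b, |h₁ σ - h₂ σ| ≤ 2 * C * q * √(σ - a) := by
      apply abs_le_of_abs_deriv_le
        (f' := fun σ => G (σ, Y₁ σ, h₁ σ) / Y₁ σ - G (σ, Y₂ σ, h₂ σ) / Y₂ σ)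
        (g' := fun σ => 2 * C * q * (1 / (2 * √(σ - a))))
      · exact P₁.conth.sub P₂.conth
      · fun_prop
      · intro σ hσ
        exact (P₁.derivh σ hσ).sub (P₂.derivh σ hσ)
      · intro σ hσ
        have := (((hasDerivAt_id σ).sub_const a).sqrt (by simp only [id]; linarith [hσ.1])).const_mul
          (2 * C * q)
        exact this
      · intro σ hσ
        obtain ⟨s1, s2, s3⟩ := hsq σ hσ
        have e1 := hr₁ σ hσ
        have e2 := hr₂ σ hσ
        have rs := mul_pos hr s1
        have p1 : 0 < Y₁ σ := by linarith
        have p2 : 0 < Y₂ σ := by linarith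
        have hsplit : G (σ, Y₁ σ, h₁ σ) / Y₁ σ - G (σ, Y₂ σ, h₂ σ) / Y₂ σ
            = (G (σ, Y₁ σ, h₁ σ) - G (σ, Y₂ σ, h₂ σ)) / Y₁ σ
              + G (σ, Y₂ σ, h₂ σ) * (Y₂ σ - Y₁ σ) / (Y₁ σ * Y₂ σ) := by
          field_simp; ring
        rw [hsplit]
        refine (abs_add_le _ _).trans ?_
        have t1 : |(G (σ, Y₁ σ, h₁ σ) - G (σ, Y₂ σ, h₂ σ)) / Y₁ σ|
            ≤ (K + 1) * q / (r * √(σ - a)) := by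
          rw [abs_div, abs_of_pos p1]
          have := (hGL σ (Y₁ σ) (h₁ σ) (Y₂ σ) (h₂ σ)).trans (hsum σ hσ)
          gcongr
        have t2 : |G (σ, Y₂ σ, h₂ σ) * (Y₂ σ - Y₁ σ) / (Y₁ σ * Y₂ σ)|
            ≤ M * (2 * (K + 1) * q / r * √(σ - a)) / ((r * √(σ - a)) * (r * √(σ - a))) := by
          rw [abs_div, abs_mul, abs_of_pos (mul_pos p1 p2), abs_sub_comm]
          have := hΔY σ hσ
          have := hGM (σ, Y₂ σ, h₂ σ)
          gcongr
        refine (add_le_add t1 t2).trans (le_of_eq ?_)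
        rw [hC]
        field_simp
        try ring
      · simp [hh0]
      · simp
    intro σ hσ
    refine (hmain σ hσ).trans ?_
    have s2 : √(σ - a) ≤ √(b - a) := Real.sqrt_le_sqrt (by linarith [hσ.2])
    have hC0 : 0 ≤ C := by positivity
    calc 2 * C * q * √(σ - a) ≤ 2 * C * q * √(b - a) := by gcongr
      _ = (4 * C * √(b - a)) * (q / 2) := by ring
      _ ≤ 1 * (q / 2) := by gcongr
      _ = q / 2 := one_mul _

theorem eq_near_zero_of_pos {K M : ℝ} (hF : Continuous F)
    (hFL : ∀ σ y h y' h', |F (σ, y, h) - F (σ, y', h')| ≤ K * (|y - y'| + |h - h'|))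
    (hGL : ∀ σ y h y' h', |G (σ, y, h) - G (σ, y', h')| ≤ K * (|y - y'| + |h - h'|))
    (hFM : ∀ z, |F z| ≤ M) (hGM : ∀ z, |G z| ≤ M) (hs : 0 < s)
    (hX₁ : IsTraj (secondOrderField F G) s X₁) (hX₂ : IsTraj (secondOrderField F G) s X₂)
    (heq : X₁ 0 = X₂ 0) (h0 : 0 < (X₁ 0).2.1 ∨ (X₁ 0).2.1 = 0 ∧ 0 < F (X₁ 0)) :
    ∃ η, 0 < η ∧ η ≤ s ∧ ∀ t ∈ Icc 0 η, X₁ t = X₂ t := by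
  have hM : 0 ≤ M := (abs_nonneg _).trans (hFM 0)
  have hK : 0 ≤ K := by
    have := (abs_nonneg _).trans (hFL 0 1 0 0 0)
    simpa using this
  obtain ⟨η₁, hη₁, hη₁s, c₁, hc₁, hb₁⟩ := exists_energy_lower_bound hF hs hX₁ h0
  obtain ⟨η₂, hη₂, hη₂s, c₂, hc₂, hb₂⟩ := exists_energy_lower_bound hF hs hX₂ (heq ▸ h0)
  set a := (X₁ 0).1 with ha
  have ha₂ : (X₂ 0).1 = a := by rw [← heq]
  have m₁ := strictMonoOn_field hX₁ hη₁s (fun t ht => (hb₁ t ⟨ht.1, ht.2.le⟩).1)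
  have m₂ := strictMonoOn_field hX₂ hη₂s (fun t ht => (hb₂ t ⟨ht.1, ht.2.le⟩).1)
  have k₁ : a < (X₁ η₁).1 := m₁ ⟨le_rfl, hη₁.le⟩ ⟨hη₁.le, le_rfl⟩ hη₁
  have k₂ : a < (X₂ η₂).1 := by
    rw [← ha₂]; exact m₂ ⟨le_rfl, hη₂.le⟩ ⟨hη₂.le, le_rfl⟩ hη₂
  set r := √(2 * min c₁ c₂) with hr
  have hcpos : 0 < min c₁ c₂ := lt_min hc₁ hc₂
  have hrpos : 0 < r := Real.sqrt_pos.2 (by positivity)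
  -- choose the right end of the interval
  have hsm : ∃ δ > 0, 2 * K * (K + 1) * √δ / r ≤ 1 ∧
      4 * ((K + 1) / r + 2 * M * (K + 1) / r ^ 3) * √δ ≤ 1 := by
    have l1 : Tendsto (fun δ : ℝ => 2 * K * (K + 1) * √δ / r) (𝓝[>] 0) (𝓝 0) := by
      have : Continuous (fun δ : ℝ => 2 * K * (K + 1) * √δ / r) := by fun_prop
      have h := this.tendsto 0
      simp only [Real.sqrt_zero, mul_zero, zero_div] at h
      exact h.mono_left nhdsWithin_le_nhds
    have l2 : Tendsto (fun δ : ℝ => 4 * ((K + 1) / r + 2 * M * (K + 1) / r ^ 3) * √δ) (𝓝[>] 0)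
        (𝓝 0) := by
      have : Continuous (fun δ : ℝ => 4 * ((K + 1) / r + 2 * M * (K + 1) / r ^ 3) * √δ) := by
        fun_prop
      have h := this.tendsto 0
      simp only [Real.sqrt_zero, mul_zero] at h
      exact h.mono_left nhdsWithin_le_nhds
    obtain ⟨δ, h1, h2, h3⟩ := ((l1.eventually (gt_mem_nhds one_pos)).and
      ((l2.eventually (gt_mem_nhds one_pos)).and self_mem_nhdsWithin)).exists
    exact ⟨δ, h3, h1.le, h2.le⟩
  obtain ⟨δ, hδ, hδ₁, hδ₂⟩ := hsm
  set b := min (a + δ) (min (X₁ η₁).1 (X₂ η₂).1) with hb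
  have hab : a < b := lt_min (by linarith) (lt_min k₁ k₂)
  have hbδ : √(b - a) ≤ √δ := Real.sqrt_le_sqrt (by linarith [min_le_left (a + δ) (min (X₁ η₁).1 (X₂ η₂).1)])
  obtain ⟨Y₁, h₁, τ₁, P₁, hτ₁⟩ := exists_fieldParam hX₁ hη₁ hη₁s (fun t ht => (hb₁ t ht).1) hab
    ((min_le_right _ _).trans (min_le_left _ _))
  obtain ⟨Y₂, h₂, τ₂, P₂, hτ₂⟩ := exists_fieldParam hX₂ hη₂ hη₂s (fun t ht => (hb₂ t ht).1)
    (b := b) (by rw [ha₂]; exact hab) ((min_le_right _ _).trans (min_le_right _ _))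
  rw [ha₂] at P₂ hτ₂
  rw [← ha] at P₁ hτ₁
  have ham : a ∈ Icc a b := ⟨le_rfl, hab.le⟩
  have hlow : ∀ {X : ℝ → ℝ × ℝ × ℝ} {Y h τ : ℝ → ℝ} {η c : ℝ}, IsFieldParam F G X a b Y h τ →
      (∀ σ ∈ Icc a b, τ σ ∈ Icc 0 η) → (X 0).1 = a → min c₁ c₂ ≤ c →
      (∀ t ∈ Ioc 0 η, 0 < (X t).2.1 ∧ c * ((X t).1 - (X 0).1) ≤ (X t).2.1 ^ 2 / 2) →
      ∀ σ ∈ Ioo a b, r * √(σ - a) ≤ Y σ := by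
    intro X Y h τ η c P hτ hX0 hc hb σ hσ
    have hσI : σ ∈ Icc a b := ⟨hσ.1.le, hσ.2.le⟩
    have hpos := P.pos σ ⟨hσ.1, hσ.2.le⟩
    have hτpos : 0 < τ σ := by
      refine lt_of_le_of_ne (hτ σ hσI).1 fun h0 => ?_
      have h1 := P.eq σ hσI
      rw [← h0] at h1
      rw [h1] at hX0
      exact hσ.1.ne' hX0
    have h2 := (hb (τ σ) ⟨hτpos, (hτ σ hσI).2⟩).2
    rw [P.eq σ hσI, hX0] at h2
    simp only at h2
    rw [hr, ← Real.sqrt_mul (by positivity)]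
    apply Real.sqrt_le_iff.2
    refine ⟨hpos.le, ?_⟩
    have : min c₁ c₂ * (σ - a) ≤ c * (σ - a) :=
      mul_le_mul_of_nonneg_right hc (by linarith [hσ.1])
    linarith
  have hr₁ := hlow P₁ hτ₁ ha.symm (min_le_left _ _) hb₁
  have hr₂ := hlow P₂ hτ₂ ha₂ (min_le_right _ _) hb₂
  have e0 : (a, Y₁ a, h₁ a) = (a, Y₂ a, h₂ a) := by
    rw [← P₁.eq a ham, ← P₂.eq a ham, P₁.start, P₂.start, heq]
  have hY0 : Y₁ a = Y₂ a := congrArg (fun z => z.2.1) e0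
  have hh0 : h₁ a = h₂ a := congrArg (fun z => z.2.2) e0
  -- an initial bound
  obtain ⟨q₀, hq₀, hU₀, hh₀⟩ : ∃ q₀, 0 ≤ q₀ ∧
      (∀ σ ∈ Icc a b, |Y₁ σ ^ 2 / 2 - Y₂ σ ^ 2 / 2| ≤ 2 * (K + 1) * q₀ * (σ - a)) ∧
      ∀ σ ∈ Icc a b, |h₁ σ - h₂ σ| ≤ q₀ := by
    obtain ⟨B, hB⟩ := isCompact_Icc.exists_bound_of_continuousOn (P₁.conth.sub P₂.conth)
    refine ⟨max B M, le_max_of_le_right hM, ?_, fun σ hσ => (hB σ hσ).trans (le_max_left _ _)⟩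
    apply abs_le_of_abs_deriv_le (f' := fun σ => F (σ, Y₁ σ, h₁ σ) - F (σ, Y₂ σ, h₂ σ))
      (g' := fun _ => 2 * (K + 1) * max B M)
    · exact ((P₁.contY.pow 2).div_const 2).sub ((P₂.contY.pow 2).div_const 2)
    · fun_prop
    · intro σ hσ
      have p1 := P₁.pos σ ⟨hσ.1, hσ.2.le⟩
      have p2 := P₂.pos σ ⟨hσ.1, hσ.2.le⟩
      have d1 := (((P₁.derivY σ hσ).pow 2).div_const 2).sub (((P₂.derivY σ hσ).pow 2).div_const 2)
      exact d1.congr_deriv (by norm_num; field_simp)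
    · intro σ _
      simpa using ((hasDerivAt_id σ).sub_const a).const_mul (2 * (K + 1) * max B M)
    · intro σ _
      refine (abs_sub _ _).trans ?_
      have := hFM (σ, Y₁ σ, h₁ σ)
      have := hFM (σ, Y₂ σ, h₂ σ)
      have h3 := le_max_right B M
      nlinarith
    · simp [hY0]
    · simp
  have hiter : ∀ n : ℕ, (∀ σ ∈ Icc a b,
      |Y₁ σ ^ 2 / 2 - Y₂ σ ^ 2 / 2| ≤ 2 * (K + 1) * (q₀ / 2 ^ n) * (σ - a)) ∧
      ∀ σ ∈ Icc a b, |h₁ σ - h₂ σ| ≤ q₀ / 2 ^ n := by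
    intro n
    induction n with
    | zero => simpa only [pow_zero, div_one] using ⟨hU₀, hh₀⟩
    | succ n ih =>
      have := fieldParam_contraction hK hM hFL hGL hGM P₁ P₂ hY0 hh0 hrpos hr₁ hr₂
        ((div_le_div_of_nonneg_right (mul_le_mul_of_nonneg_left hbδ (by positivity)) hrpos.le).trans
          hδ₁)
        ((mul_le_mul_of_nonneg_left hbδ (by positivity)).trans hδ₂)
        (by positivity : 0 ≤ q₀ / 2 ^ n) ih.1 ih.2
      rw [pow_succ, ← div_div]
      exact this
  have hlim : Tendsto (fun n : ℕ => q₀ / 2 ^ n) atTop (𝓝 0) := by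
    have := (tendsto_pow_atTop_nhds_zero_of_lt_one (r := (1 / 2 : ℝ)) (by norm_num)
      (by norm_num)).const_mul q₀
    simpa [div_eq_mul_inv] using this
  have hhe : ∀ σ ∈ Icc a b, h₁ σ = h₂ σ := by
    intro σ hσ
    have := ge_of_tendsto' hlim (fun n => (hiter n).2 σ hσ)
    exact sub_eq_zero.1 (abs_nonpos_iff.1 this)
  have hYe : ∀ σ ∈ Icc a b, Y₁ σ = Y₂ σ := by
    intro σ hσ
    have hl2 : Tendsto (fun n : ℕ => 2 * (K + 1) * (q₀ / 2 ^ n) * (σ - a)) atTop (𝓝 0) := by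
      simpa using (hlim.const_mul (2 * (K + 1))).mul_const (σ - a)
    have h1 := ge_of_tendsto' hl2 (fun n => (hiter n).1 σ hσ)
    have h2 := sub_eq_zero.1 (abs_nonpos_iff.1 h1)
    rcases hσ.1.eq_or_lt with h | h
    · rw [← h, hY0]
    · have p1 := P₁.pos σ ⟨h, hσ.2⟩
      have p2 := P₂.pos σ ⟨h, hσ.2⟩
      exact (pow_left_inj₀ p1.le p2.le two_ne_zero).1 (by linarith)
  have hτe : ∀ σ ∈ Icc a b, τ₁ σ = τ₂ σ := by
    have := abs_le_of_abs_deriv_le (f := fun σ => τ₁ σ - τ₂ σ) (g := fun _ => 0)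
      (f' := fun σ => 1 / Y₁ σ - 1 / Y₂ σ) (g' := fun _ => 0) (P₁.contτ.sub P₂.contτ)
      continuousOn_const (fun σ hσ => (P₁.derivτ σ hσ).sub (P₂.derivτ σ hσ))
      (fun σ _ => hasDerivAt_const _ _)
      (fun σ hσ => by simp [hYe σ ⟨hσ.1.le, hσ.2.le⟩]) (by simp [P₁.start, P₂.start]) rfl
    intro σ hσ
    exact sub_eq_zero.1 (abs_nonpos_iff.1 (this σ hσ))
  refine ⟨τ₁ b, P₁.pos_time, (hτ₁ b ⟨hab.le, le_rfl⟩).2.trans hη₁s, fun t ht => ?_⟩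
  obtain ⟨hσ, hinv⟩ := P₁.inv t ht
  have e1 := P₁.eq _ hσ
  have e2 := P₂.eq _ hσ
  rw [← hτe _ hσ, ← hYe _ hσ, ← hhe _ hσ, hinv] at e2
  rw [hinv] at e1
  rw [e1, e2]

/-- Reflection `(φ, y, h) ↦ (-φ, -y, h)` of the phase space. -/
def reflect (z : ℝ × ℝ × ℝ) : ℝ × ℝ × ℝ := (-z.1, -z.2.1, z.2.2)

theorem reflect_reflect (z : ℝ × ℝ × ℝ) : reflect (reflect z) = z := by simp [reflect]

theorem continuous_reflect : Continuous reflect := by unfold reflect; fun_prop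

theorem IsTraj.comp_reflect (hX : IsTraj (secondOrderField F G) s X) :
    IsTraj (secondOrderField (fun z => -F (reflect z)) (fun z => G (reflect z))) s
      (fun t => reflect (X t)) := by
  refine ⟨continuous_reflect.comp_continuousOn hX.1, fun t ht => ?_⟩
  obtain ⟨h1, h2, h3⟩ := hasDerivAt_triple_iff.1 (hX.2 t ht)
  simp only [secondOrderField, reflect_reflect]
  exact hasDerivAt_triple_iff.2 ⟨h1.neg, h2.neg, h3⟩

/-- **Uniqueness of trajectories.** The right-hand side is merely continuous in `φ`, but a
trajectory is determined by its starting point as long as it meets no degenerate turning point, that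
is, no point with `φ' = φ'' = 0`. -/
theorem IsTraj.eqOn {K M : ℝ} (hF : Continuous F)
    (hFL : ∀ σ y h y' h', |F (σ, y, h) - F (σ, y', h')| ≤ K * (|y - y'| + |h - h'|))
    (hGL : ∀ σ y h y' h', |G (σ, y, h) - G (σ, y', h')| ≤ K * (|y - y'| + |h - h'|))
    (hFM : ∀ z, |F z| ≤ M) (hGM : ∀ z, |G z| ≤ M)
    (hX₁ : IsTraj (secondOrderField F G) s X₁) (hX₂ : IsTraj (secondOrderField F G) s X₂)
    (heq : X₁ 0 = X₂ 0) (hnd : ∀ t ∈ Ico 0 s, ¬ ((X₁ t).2.1 = 0 ∧ F (X₁ t) = 0)) :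
    EqOn X₁ X₂ (Icc 0 s) := by
  rcases lt_or_ge s 0 with hs | hs
  · rw [Icc_eq_empty (by linarith)]; exact eqOn_empty _ _
  have hcl : IsClosed ({t | X₁ t = X₂ t} ∩ Icc 0 s) := by
    have := (hX₁.1.sub hX₂.1).preimage_isClosed_of_isClosed isClosed_Icc
      (isClosed_singleton (x := (0 : ℝ × ℝ × ℝ)))
    convert this using 1
    ext t
    simp [and_comm, sub_eq_zero]
  refine hcl.Icc_subset_of_forall_exists_gt heq ?_
  rintro x ⟨hx, hx0, hxs⟩ y hy
  have t₁ := hX₁.shift hx0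
  have t₂ := hX₂.shift hx0
  have hsx : 0 < s - x := by linarith
  have e0 : X₁ (x + 0) = X₂ (x + 0) := by simpa using hx
  have hloc : ∃ η, 0 < η ∧ η ≤ s - x ∧ ∀ t ∈ Icc 0 η, X₁ (x + t) = X₂ (x + t) := by
    have hnx := hnd x ⟨hx0, hxs⟩
    by_cases hp : 0 < (X₁ x).2.1 ∨ (X₁ x).2.1 = 0 ∧ 0 < F (X₁ x)
    · exact eq_near_zero_of_pos hF hFL hGL hFM hGM hsx t₁ t₂ e0 (by simpa using hp)
    · have hn : 0 < (reflect (X₁ x)).2.1 ∨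
          (reflect (X₁ x)).2.1 = 0 ∧ 0 < -F (reflect (reflect (X₁ x))) := by
        rw [reflect_reflect]
        simp only [reflect, Left.neg_pos_iff, neg_eq_zero]
        push Not at hp hnx
        rcases hp.1.lt_or_eq with h | h
        · exact Or.inl h
        · exact Or.inr ⟨h, lt_of_le_of_ne (hp.2 h) (hnx h)⟩
      obtain ⟨η, h1, h2, h3⟩ := eq_near_zero_of_pos
        (F := fun z => -F (reflect z)) (G := fun z => G (reflect z)) (K := K) (M := M)
        (hF.comp continuous_reflect).neg
        (fun σ y h y' h' => by
          have := hFL (-σ) (-y) h (-y') h'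
          rw [← abs_neg (-y - -y')] at this
          simp only [reflect]
          rw [neg_sub_neg, abs_sub_comm]
          convert this using 4
          ring)
        (fun σ y h y' h' => by
          have := hGL (-σ) (-y) h (-y') h'
          rw [← abs_neg (-y - -y')] at this
          simp only [reflect]
          convert this using 4
          ring)
        (fun z => by rw [abs_neg]; exact hFM _) (fun z => hGM _) hsx t₁.comp_reflect t₂.comp_reflect
        (congrArg reflect e0) (by simpa using hn)
      refine ⟨η, h1, h2, fun t ht => ?_⟩
      have := congrArg reflect (h3 t ht)
      simpa only [reflect_reflect] using this
  obtain ⟨η, h1, h2, h3⟩ := hloc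
  have hxy : 0 < y - x := sub_pos.2 hy
  refine ⟨x + min η (y - x), ?_, ?_⟩
  · exact h3 _ ⟨(lt_min h1 hxy).le, min_le_left _ _⟩
  · have := lt_min h1 hxy
    have := min_le_right η (y - x)
    constructor <;> linarith

end Uniqueness

/-! ### Volume estimates for Euler steps -/

open scoped ENNReal NNReal

theorem volume_preimage_le_of_expanding {g : ℝ → ℝ} {c : ℝ} (hc : 0 < c)
    (hg : ∀ r₁ r₂, r₁ ≤ r₂ → c * (r₂ - r₁) ≤ g r₂ - g r₁) (B : Set ℝ) :
    volume (g ⁻¹' B) ≤ ENNReal.ofReal c⁻¹ * volume B := by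
  have hanti : AntilipschitzWith c⁻¹.toNNReal g := by
    apply AntilipschitzWith.of_le_mul_dist
    intro x y
    rw [Real.coe_toNNReal _ (inv_nonneg.2 hc.le), ← div_eq_inv_mul, le_div_iff₀ hc]
    rcases le_total x y with h | h
    · rw [dist_comm, dist_comm (g x), Real.dist_eq, Real.dist_eq, abs_of_nonneg (sub_nonneg.2 h)]
      have := hg x y h
      linarith [le_abs_self (g y - g x)]
    · rw [Real.dist_eq, Real.dist_eq, abs_of_nonneg (sub_nonneg.2 h)]
      have := hg y x h
      linarith [le_abs_self (g x - g y)]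
  have := hanti.hausdorffMeasure_preimage_le (d := 1) zero_le_one B
  rwa [hausdorffMeasure_real, ENNReal.rpow_one] at this

theorem prod_volume_preimage_skew_le {α : Type*} [MeasurableSpace α] (μ : Measure α) [SFinite μ]
    {g : α → ℝ → ℝ} (hgm : Measurable (fun p : α × ℝ => g p.1 p.2)) {c : ℝ} (hc : 0 < c)
    (hg : ∀ x r₁ r₂, r₁ ≤ r₂ → c * (r₂ - r₁) ≤ g x r₂ - g x r₁) {A : Set (α × ℝ)}
    (hA : MeasurableSet A) :
    (μ.prod volume) ((fun p : α × ℝ => (p.1, g p.1 p.2)) ⁻¹' A)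
      ≤ ENNReal.ofReal c⁻¹ * (μ.prod volume) A := by
  have hT : Measurable (fun p : α × ℝ => (p.1, g p.1 p.2)) := measurable_fst.prodMk hgm
  rw [Measure.prod_apply (hT hA), Measure.prod_apply hA,
    ← lintegral_const_mul _ (measurable_measure_prodMk_left hA)]
  apply lintegral_mono
  intro x
  exact volume_preimage_le_of_expanding hc (hg x) _

theorem volume_preimage_le_of_skew {e : (ℝ × ℝ) × ℝ → ℝ × ℝ × ℝ} (he : MeasurePreserving e)
    {T : ℝ × ℝ × ℝ → ℝ × ℝ × ℝ} (hTm : Measurable T) {g : ℝ × ℝ → ℝ → ℝ}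
    (hgm : Measurable (fun p : (ℝ × ℝ) × ℝ => g p.1 p.2))
    (hT : ∀ p, T (e p) = e (p.1, g p.1 p.2)) {c : ℝ} (hc : 0 < c)
    (hg : ∀ x r₁ r₂, r₁ ≤ r₂ → c * (r₂ - r₁) ≤ g x r₂ - g x r₁) {A : Set (ℝ × ℝ × ℝ)}
    (hA : MeasurableSet A) : volume (T ⁻¹' A) ≤ ENNReal.ofReal c⁻¹ * volume A := by
  rw [← he.measure_preimage (hTm hA).nullMeasurableSet, ← he.measure_preimage hA.nullMeasurableSet]
  have h1 : e ⁻¹' (T ⁻¹' A) = (fun p : (ℝ × ℝ) × ℝ => (p.1, g p.1 p.2)) ⁻¹' (e ⁻¹' A) := by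
    ext p
    simp only [mem_preimage, hT]
  rw [h1]
  exact prod_volume_preimage_skew_le volume hgm hc hg (he.measurable hA)

theorem measurePreserving_insert_first :
    MeasurePreserving (fun p : (ℝ × ℝ) × ℝ => ((p.2, p.1) : ℝ × ℝ × ℝ)) :=
  Measure.measurePreserving_swap (μ := (volume : Measure (ℝ × ℝ))) (ν := (volume : Measure ℝ))

theorem measurePreserving_insert_last :
    MeasurePreserving (fun p : (ℝ × ℝ) × ℝ => ((p.1.1, p.1.2, p.2) : ℝ × ℝ × ℝ)) :=
  measurePreserving_prodAssoc (volume : Measure ℝ) (volume : Measure ℝ) (volume : Measure ℝ)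

theorem measurePreserving_insert_middle :
    MeasurePreserving (fun p : (ℝ × ℝ) × ℝ => ((p.1.1, p.2, p.1.2) : ℝ × ℝ × ℝ)) :=
  ((MeasurePreserving.id (volume : Measure ℝ)).prod
    (Measure.measurePreserving_swap (μ := (volume : Measure ℝ)) (ν := (volume : Measure ℝ)))).comp
    measurePreserving_insert_last

/-- The increment of a split Euler step of size `z.1` starting at `z.2`: the coordinates `φ`, `y`,
`h` are updated one after the other, each with the current values of the others. -/
def splitField (F G : ℝ × ℝ × ℝ → ℝ) (z : ℝ × ℝ × ℝ × ℝ) : ℝ × ℝ × ℝ :=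
  (z.2.2.1, F (z.2.1 + z.1 * z.2.2.1, z.2.2),
    G (z.2.1 + z.1 * z.2.2.1, z.2.2.1 + z.1 * F (z.2.1 + z.1 * z.2.2.1, z.2.2), z.2.2.2))

/-- A split Euler step of size `ε`. -/
def splitStep (F G : ℝ × ℝ × ℝ → ℝ) (ε : ℝ) (z : ℝ × ℝ × ℝ) : ℝ × ℝ × ℝ :=
  z + ε • splitField F G (ε, z)

section Liouville

variable {F G : ℝ × ℝ × ℝ → ℝ}

theorem continuous_splitField (hF : Continuous F) (hG : Continuous G) :
    Continuous (splitField F G) := by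
  unfold splitField
  fun_prop

theorem continuous_splitStep (hF : Continuous F) (hG : Continuous G) (ε : ℝ) :
    Continuous (splitStep F G ε) := by
  have := continuous_splitField hF hG
  unfold splitStep
  fun_prop

/-- Since a split Euler step is a composition of three maps that change one coordinate each, its
effect on volume is controlled by one-sided Lipschitz constants `κ₁` of `F` in `y` and `κ₂` of `G`
in `h`. -/
theorem volume_preimage_splitStep_le (hF : Continuous F) (hG : Continuous G) {κ₁ κ₂ ε : ℝ}
    (hε : 0 ≤ ε) (hκ₁ : ε * κ₁ < 1) (hκ₂ : ε * κ₂ < 1)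
    (hF₁ : ∀ φ h y₁ y₂, y₁ ≤ y₂ → -κ₁ * (y₂ - y₁) ≤ F (φ, y₂, h) - F (φ, y₁, h))
    (hG₁ : ∀ φ y h₁ h₂, h₁ ≤ h₂ → -κ₂ * (h₂ - h₁) ≤ G (φ, y, h₂) - G (φ, y, h₁))
    {A : Set (ℝ × ℝ × ℝ)} (hA : MeasurableSet A) :
    volume (splitStep F G ε ⁻¹' A)
      ≤ ENNReal.ofReal ((1 - ε * κ₁) * (1 - ε * κ₂))⁻¹ * volume A := by
  set T₁ : ℝ × ℝ × ℝ → ℝ × ℝ × ℝ := fun z => (z.1 + ε * z.2.1, z.2) with hT₁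
  set T₂ : ℝ × ℝ × ℝ → ℝ × ℝ × ℝ := fun z => (z.1, z.2.1 + ε * F z, z.2.2) with hT₂
  set T₃ : ℝ × ℝ × ℝ → ℝ × ℝ × ℝ := fun z => (z.1, z.2.1, z.2.2 + ε * G z) with hT₃
  have c₁ : Continuous T₁ := by fun_prop
  have c₂ : Continuous T₂ := by fun_prop
  have c₃ : Continuous T₃ := by fun_prop
  have hcomp : splitStep F G ε = T₃ ∘ T₂ ∘ T₁ := by
    funext z
    simp [splitStep, splitField, hT₁, hT₂, hT₃, Prod.ext_iff]
  have h₁ : ∀ {B : Set (ℝ × ℝ × ℝ)}, MeasurableSet B → volume (T₁ ⁻¹' B) ≤ volume B := by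
    intro B hB
    have := volume_preimage_le_of_skew measurePreserving_insert_first c₁.measurable
      (g := fun x r => r + ε * x.1) (by fun_prop) (fun p => rfl) one_pos
      (fun x r₁ r₂ h => by linarith) hB
    simpa using this
  have h₂ : ∀ {B : Set (ℝ × ℝ × ℝ)}, MeasurableSet B →
      volume (T₂ ⁻¹' B) ≤ ENNReal.ofReal (1 - ε * κ₁)⁻¹ * volume B := by
    intro B hB
    refine volume_preimage_le_of_skew measurePreserving_insert_middle c₂.measurable
      (g := fun x r => r + ε * F (x.1, r, x.2)) ?_ (fun p => rfl) (by linarith)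
      (fun x r₁ r₂ h => ?_) hB
    · exact (by fun_prop : Continuous _).measurable
    · have := mul_le_mul_of_nonneg_left (hF₁ x.1 x.2 r₁ r₂ h) hε
      linarith
  have h₃ : ∀ {B : Set (ℝ × ℝ × ℝ)}, MeasurableSet B →
      volume (T₃ ⁻¹' B) ≤ ENNReal.ofReal (1 - ε * κ₂)⁻¹ * volume B := by
    intro B hB
    refine volume_preimage_le_of_skew measurePreserving_insert_last c₃.measurable
      (g := fun x r => r + ε * G (x.1, x.2, r)) ?_ (fun p => rfl) (by linarith)
      (fun x r₁ r₂ h => ?_) hB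
    · exact (by fun_prop : Continuous _).measurable
    · have := mul_le_mul_of_nonneg_left (hG₁ x.1 x.2 r₁ r₂ h) hε
      linarith
  rw [hcomp, preimage_comp, preimage_comp]
  refine (h₁ (c₂.measurable (c₃.measurable hA))).trans ((h₂ (c₃.measurable hA)).trans ?_)
  rw [mul_inv, ENNReal.ofReal_mul (inv_nonneg.2 (by linarith)), mul_assoc]
  gcongr
  exact h₃ hA

theorem volume_preimage_iterate_le {T : ℝ × ℝ × ℝ → ℝ × ℝ × ℝ} (hT : Continuous T) {c : ℝ≥0∞}
    (h : ∀ A : Set (ℝ × ℝ × ℝ), MeasurableSet A → volume (T ⁻¹' A) ≤ c * volume A) (n : ℕ)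
    {A : Set (ℝ × ℝ × ℝ)} (hA : MeasurableSet A) :
    volume (T^[n] ⁻¹' A) ≤ c ^ n * volume A := by
  induction n generalizing A with
  | zero => simp
  | succ n ih =>
    rw [Function.iterate_succ', preimage_comp]
    refine (ih (hT.measurable hA)).trans ?_
    rw [pow_succ, mul_assoc]
    gcongr
    exact h A hA

/-- For a trajectory without degenerate turning points, the split Euler scheme converges to it. -/
theorem tendsto_iterate_splitStep {K M s : ℝ} (hF : Continuous F) (hG : Continuous G)
    (hFL : ∀ σ y h y' h', |F (σ, y, h) - F (σ, y', h')| ≤ K * (|y - y'| + |h - h'|))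
    (hGL : ∀ σ y h y' h', |G (σ, y, h) - G (σ, y', h')| ≤ K * (|y - y'| + |h - h'|))
    (hFM : ∀ z, |F z| ≤ M) (hGM : ∀ z, |G z| ≤ M) (hs : 0 < s) {X : ℝ → ℝ × ℝ × ℝ}
    (hX : IsTraj (secondOrderField F G) s X)
    (hnd : ∀ t ∈ Ico 0 s, ¬ ((X t).2.1 = 0 ∧ F (X t) = 0)) :
    Tendsto (fun n : ℕ => (splitStep F G (s / n))^[n] (X 0)) atTop (𝓝 (X s)) := by
  rw [tendsto_iff_ultrafilter]
  intro U hU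
  set S : ℕ → ℕ → ℝ × ℝ × ℝ := fun n k => (splitStep F G (s / n))^[k] (X 0) with hS
  have hSs : ∀ n k, S n (k + 1) = S n k + (s / n) • splitField F G (s / n, S n k) := by
    intro n k
    simp only [hS, Function.iterate_succ_apply']
    rfl
  have hM0 : 0 ≤ M := (abs_nonneg _).trans (hFM 0)
  have hy : ∀ n k : ℕ, |(S n k).2.1| ≤ |(X 0).2.1| + k * (s / n) * M := by
    intro n k
    induction k with
    | zero => simp [hS]
    | succ k ih =>
      have h1 : (S n (k + 1)).2.1 = (S n k).2.1 + (s / n) * (splitField F G (s / n, S n k)).2.1 := by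
        rw [hSs]; simp
      rw [h1]
      have h2 : |(splitField F G (s / n, S n k)).2.1| ≤ M := hFM _
      have h3 : 0 ≤ s / (n : ℝ) := by positivity
      refine (abs_add_le _ _).trans ?_
      rw [abs_mul, abs_of_nonneg h3]
      push_cast
      nlinarith [mul_le_mul_of_nonneg_left h2 h3]
  have hbound : ∀ n k : ℕ, k ≤ n →
      ‖splitField F G (s / n, S n k)‖ ≤ max (|(X 0).2.1| + s * M) M := by
    intro n k hk
    rw [Prod.norm_def, Prod.norm_def]
    refine max_le ?_ (max_le ((hFM _).trans (le_max_right _ _)) ((hGM _).trans (le_max_right _ _)))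
    refine ((hy n k).trans ?_).trans (le_max_left _ _)
    have : (k : ℝ) * (s / n) ≤ s := by
      rcases Nat.eq_zero_or_pos n with rfl | hn
      · simp [hs.le]
      · have hn' : (0 : ℝ) < n := by exact_mod_cast hn
        have hk' : (k : ℝ) ≤ n := by exact_mod_cast hk
        rw [← mul_div_assoc, div_le_iff₀ hn']
        nlinarith
    gcongr
  obtain ⟨Y, hY, hY0, hYs⟩ := exists_traj_of_euler (continuous_splitField hF hG) hs
    (fun n => rfl) hSs hbound U hU
  have hvf : (fun z => splitField F G (0, z)) = secondOrderField F G := by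
    funext z
    simp [splitField, secondOrderField]
  rw [hvf] at hY
  have := IsTraj.eqOn hF hFL hGL hFM hGM hX hY (by rw [hY0]) hnd
  rw [this ⟨hs.le, le_rfl⟩]
  exact hYs

/-- **Liouville estimate.** If all points of `A` are carried into `N` in time `s` by trajectories
without degenerate turning points, the volume of `A` is at most `exp ((κ₁ + κ₂) s)` times that of
`N`. Neither set needs to be measurable. -/
theorem volume_le_of_forall_traj {K M s κ₁ κ₂ : ℝ} (hF : Continuous F) (hG : Continuous G)
    (hFL : ∀ σ y h y' h', |F (σ, y, h) - F (σ, y', h')| ≤ K * (|y - y'| + |h - h'|))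
    (hGL : ∀ σ y h y' h', |G (σ, y, h) - G (σ, y', h')| ≤ K * (|y - y'| + |h - h'|))
    (hFM : ∀ z, |F z| ≤ M) (hGM : ∀ z, |G z| ≤ M) (hs : 0 < s)
    (hF₁ : ∀ φ h y₁ y₂, y₁ ≤ y₂ → -κ₁ * (y₂ - y₁) ≤ F (φ, y₂, h) - F (φ, y₁, h))
    (hG₁ : ∀ φ y h₁ h₂, h₁ ≤ h₂ → -κ₂ * (h₂ - h₁) ≤ G (φ, y, h₂) - G (φ, y, h₁))
    {A N : Set (ℝ × ℝ × ℝ)}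
    (hA : ∀ p ∈ A, ∃ X : ℝ → ℝ × ℝ × ℝ, IsTraj (secondOrderField F G) s X ∧ X 0 = p ∧
      (∀ t ∈ Ico 0 s, ¬ ((X t).2.1 = 0 ∧ F (X t) = 0)) ∧ X s ∈ N) :
    volume A ≤ ENNReal.ofReal (Real.exp ((κ₁ + κ₂) * s)) * volume N := by
  have hopen : ∀ O : Set (ℝ × ℝ × ℝ), IsOpen O → N ⊆ O →
      volume A ≤ ENNReal.ofReal (Real.exp ((κ₁ + κ₂) * s)) * volume O := by
    intro O hO hNO
    set B : ℕ → Set (ℝ × ℝ × ℝ) := fun m =>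
      ⋂ n ≥ m, (splitStep F G (s / (n : ℕ)))^[n] ⁻¹' O with hB
    have hAB : A ⊆ ⋃ m, B m := by
      intro p hp
      obtain ⟨X, hX, hX0, hnd, hXs⟩ := hA p hp
      have h1 := tendsto_iterate_splitStep hF hG hFL hGL hFM hGM hs hX hnd
      have h2 := h1.eventually (hO.mem_nhds (hNO hXs))
      obtain ⟨m, hm⟩ := eventually_atTop.1 h2
      refine mem_iUnion.2 ⟨m, mem_iInter₂.2 fun n hn => ?_⟩
      have := hm n hn
      rwa [hX0] at this
    have hBmono : Monotone B := by
      intro m m' hmm p hp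
      exact mem_iInter₂.2 fun n hn => mem_iInter₂.1 hp n (hmm.trans hn)
    have hc : Tendsto (fun n : ℕ => ENNReal.ofReal
        (((1 - s / n * κ₁) * (1 - s / n * κ₂))⁻¹ ^ n)) atTop
        (𝓝 (ENNReal.ofReal (Real.exp ((κ₁ + κ₂) * s)))) := by
      apply ENNReal.tendsto_ofReal
      have t₁ := Real.tendsto_one_add_div_pow_exp (-(s * κ₁))
      have t₂ := Real.tendsto_one_add_div_pow_exp (-(s * κ₂))
      have t₃ := (t₁.mul t₂).inv₀ (by positivity)
      have e1 : (Real.exp (-(s * κ₁)) * Real.exp (-(s * κ₂)))⁻¹ = Real.exp ((κ₁ + κ₂) * s) := by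
        rw [← Real.exp_add, ← Real.exp_neg]
        congr 1
        ring
      rw [e1] at t₃
      refine t₃.congr fun n => ?_
      rw [inv_pow, mul_pow]
      congr 3 <;> ring
    have hBle : ∀ m, volume (B m) ≤ ENNReal.ofReal (Real.exp ((κ₁ + κ₂) * s)) * volume O := by
      intro m
      have t := ENNReal.Tendsto.mul_const (b := volume O) hc
        (Or.inl (ENNReal.ofReal_pos.2 (Real.exp_pos _)).ne')
      refine ge_of_tendsto t ?_
      have hz : ∀ κ : ℝ, ∀ᶠ n : ℕ in atTop, s / n * κ < 1 := by
        intro κ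
        have := (tendsto_const_div_atTop_nhds_zero_nat s).mul_const κ
        rw [zero_mul] at this
        exact this.eventually (gt_mem_nhds one_pos)
      filter_upwards [eventually_ge_atTop m, hz κ₁, hz κ₂] with n hn h1 h2
      refine (measure_mono (iInter₂_subset n hn)).trans ?_
      have hp : 0 ≤ ((1 - s / n * κ₁) * (1 - s / n * κ₂))⁻¹ :=
        inv_nonneg.2 (mul_nonneg (by linarith) (by linarith))
      rw [ENNReal.ofReal_pow hp]
      exact volume_preimage_iterate_le (continuous_splitStep hF hG _)
        (fun A hA => volume_preimage_splitStep_le hF hG (by positivity) h1 h2 hF₁ hG₁ hA) n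
        hO.measurableSet
    refine (measure_mono hAB).trans ?_
    rw [hBmono.measure_iUnion]
    exact iSup_le hBle
  rw [N.measure_eq_iInf_isOpen]
  simp_rw [ENNReal.mul_iInf_of_ne (ENNReal.ofReal_pos.2 (Real.exp_pos ((κ₁ + κ₂) * s))).ne'
    ENNReal.ofReal_ne_top]
  exact le_iInf fun O => le_iInf fun hNO => le_iInf fun hO => hopen O hO hNO

end Liouville

/-! ### The reduced cosmological system -/

/-- The fluid density at the phase space point `z = (φ, y, H)`, as determined by the Friedmann
constraint. -/
noncomputable def fluidDensity (V : ℝ → ℝ) (z : ℝ × ℝ × ℝ) : ℝ :=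
  3 * z.2.2 ^ 2 - z.2.1 ^ 2 / 2 - V z.1

/-- The acceleration of the scalar field. -/
noncomputable def fieldAccel (V α : ℝ → ℝ) (z : ℝ × ℝ × ℝ) : ℝ :=
  -3 * z.2.2 * z.2.1 - deriv V z.1 + α z.1 * fluidDensity V z

/-- The rate of change of the Hubble function. -/
noncomputable def hubbleRate (γ : ℝ) (V : ℝ → ℝ) (z : ℝ × ℝ × ℝ) : ℝ :=
  -z.2.1 ^ 2 / 2 - γ / 2 * fluidDensity V z

/-- The reduced system in the coordinates `(φ, y, H)`: the fluid density is eliminated by means of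
the constraint, so that no square roots occur. -/
noncomputable def cosmoField (γ : ℝ) (V α : ℝ → ℝ) : ℝ × ℝ × ℝ → ℝ × ℝ × ℝ :=
  secondOrderField (fieldAccel V α) (hubbleRate γ V)

/-- A degenerate turning point: the field is momentarily at rest and not accelerated. -/
def IsDegenerate (V α : ℝ → ℝ) (z : ℝ × ℝ × ℝ) : Prop := z.2.1 = 0 ∧ fieldAccel V α z = 0

/-- Projection of the phase space onto the box with corners `lo` and `hi`. -/
noncomputable def clampBox (lo hi z : ℝ × ℝ × ℝ) : ℝ × ℝ × ℝ := lo ⊔ hi ⊓ z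

section Cosmo

variable {γ : ℝ} {V α : ℝ → ℝ} {lo hi : ℝ × ℝ × ℝ}

theorem continuous_fluidDensity (hV : ContDiff ℝ 1 V) : Continuous (fluidDensity V) := by
  have := hV.continuous
  unfold fluidDensity
  fun_prop

theorem continuous_fieldAccel (hV : ContDiff ℝ 1 V) (hα : Continuous α) :
    Continuous (fieldAccel V α) := by
  have := hV.continuous
  have := hV.continuous_deriv le_rfl
  have := continuous_fluidDensity hV
  unfold fieldAccel
  fun_prop

theorem continuous_hubbleRate (hV : ContDiff ℝ 1 V) : Continuous (hubbleRate γ V) := by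
  have := continuous_fluidDensity hV
  unfold hubbleRate
  fun_prop

theorem continuous_cosmoField (hV : ContDiff ℝ 1 V) (hα : Continuous α) :
    Continuous (cosmoField γ V α) := by
  have := continuous_fieldAccel hV hα
  have := continuous_hubbleRate (γ := γ) hV
  unfold cosmoField secondOrderField
  fun_prop

theorem continuous_clampBox : Continuous (clampBox lo hi) := by
  change Continuous fun z : ℝ × ℝ × ℝ => (max lo.1 (min hi.1 z.1), max lo.2.1 (min hi.2.1 z.2.1),
    max lo.2.2 (min hi.2.2 z.2.2))
  fun_prop

theorem clampBox_mem (h : lo ≤ hi) (z : ℝ × ℝ × ℝ) : clampBox lo hi z ∈ Icc lo hi :=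
  ⟨le_sup_left, sup_le h inf_le_left⟩

theorem clampBox_eq {z : ℝ × ℝ × ℝ} (hz : z ∈ Icc lo hi) : clampBox lo hi z = z := by
  unfold clampBox
  rw [inf_eq_right.2 hz.2, sup_eq_right.2 hz.1]

theorem abs_clamp_sub_clamp_le (a b x y : ℝ) :
    |max a (min b x) - max a (min b y)| ≤ |x - y| := by
  refine (abs_max_sub_max_le_max _ _ _ _).trans ?_
  rw [sub_self, abs_zero, max_eq_right (abs_nonneg _)]
  refine (abs_min_sub_min_le_max _ _ _ _).trans ?_
  rw [sub_self, abs_zero, max_eq_right (abs_nonneg _)]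

theorem exists_bound_comp_clampBox (h : lo ≤ hi) {f : ℝ × ℝ × ℝ → ℝ} (hf : Continuous f) :
    ∃ M, ∀ z, |f (clampBox lo hi z)| ≤ M := by
  obtain ⟨M, hM⟩ := (isCompact_Icc (a := lo) (b := hi)).exists_bound_of_continuousOn hf.continuousOn
  exact ⟨M, fun z => hM _ (clampBox_mem h z)⟩

theorem exists_lipschitz_fieldAccel (h : lo ≤ hi) {A : ℝ} (hA : ∀ x, |α x| ≤ A) :
    ∃ K, ∀ σ y h y' h', |fieldAccel V α (clampBox lo hi (σ, y, h))
      - fieldAccel V α (clampBox lo hi (σ, y', h'))| ≤ K * (|y - y'| + |h - h'|) := by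
  obtain ⟨B₁, hB₁⟩ := exists_bound_comp_clampBox h (f := fun z => z.2.1) (by fun_prop)
  obtain ⟨B₂, hB₂⟩ := exists_bound_comp_clampBox h (f := fun z => z.2.2) (by fun_prop)
  have hA0 : 0 ≤ A := (abs_nonneg _).trans (hA 0)
  have hB₁0 : 0 ≤ B₁ := (abs_nonneg _).trans (hB₁ 0)
  have hB₂0 : 0 ≤ B₂ := (abs_nonneg _).trans (hB₂ 0)
  refine ⟨3 * B₁ + 3 * B₂ + 6 * A * B₂ + A * B₁, fun σ y h y' h' => ?_⟩
  have e1 := hB₁ (σ, y, h)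
  have e2 := hB₂ (σ, y, h)
  have e3 := hB₁ (σ, y', h')
  have e4 := hB₂ (σ, y', h')
  have d1 := abs_clamp_sub_clamp_le lo.2.1 hi.2.1 y y'
  have d2 := abs_clamp_sub_clamp_le lo.2.2 hi.2.2 h h'
  have hφ : (clampBox lo hi (σ, y, h)).1 = (clampBox lo hi (σ, y', h')).1 := rfl
  change |(clampBox lo hi (σ, y, h)).2.1 - (clampBox lo hi (σ, y', h')).2.1| ≤ _ at d1
  change |(clampBox lo hi (σ, y, h)).2.2 - (clampBox lo hi (σ, y', h')).2.2| ≤ _ at d2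
  set z := clampBox lo hi (σ, y, h)
  set z' := clampBox lo hi (σ, y', h')
  have hsplit : fieldAccel V α z - fieldAccel V α z'
      = -3 * z.2.2 * (z.2.1 - z'.2.1) - 3 * z'.2.1 * (z.2.2 - z'.2.2)
        + 3 * α z.1 * (z.2.2 + z'.2.2) * (z.2.2 - z'.2.2)
        - α z.1 / 2 * (z.2.1 + z'.2.1) * (z.2.1 - z'.2.1) := by
    simp only [fieldAccel, fluidDensity, hφ]
    ring
  have hαz := hA z.1
  have t1 : |-3 * z.2.2 * (z.2.1 - z'.2.1)| ≤ 3 * B₂ * |y - y'| := by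
    rw [abs_mul, abs_mul]
    norm_num
    gcongr
  have t2 : |3 * z'.2.1 * (z.2.2 - z'.2.2)| ≤ 3 * B₁ * |h - h'| := by
    rw [abs_mul, abs_mul]
    norm_num
    gcongr
  have t3 : |3 * α z.1 * (z.2.2 + z'.2.2) * (z.2.2 - z'.2.2)| ≤ 3 * A * (B₂ + B₂) * |h - h'| := by
    rw [abs_mul, abs_mul, abs_mul]
    norm_num
    gcongr
    exact (abs_add_le _ _).trans (add_le_add e2 e4)
  have t4 : |α z.1 / 2 * (z.2.1 + z'.2.1) * (z.2.1 - z'.2.1)| ≤ A / 2 * (B₁ + B₁) * |y - y'| := by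
    rw [abs_mul, abs_mul, abs_div]
    norm_num
    gcongr
    exact (abs_add_le _ _).trans (add_le_add e1 e3)
  rw [hsplit]
  refine (abs_sub _ _).trans ?_
  have t5 := (abs_add_le (-3 * z.2.2 * (z.2.1 - z'.2.1) - 3 * z'.2.1 * (z.2.2 - z'.2.2))
    (3 * α z.1 * (z.2.2 + z'.2.2) * (z.2.2 - z'.2.2)))
  have t6 := abs_sub (-3 * z.2.2 * (z.2.1 - z'.2.1)) (3 * z'.2.1 * (z.2.2 - z'.2.2))
  have n1 := abs_nonneg (y - y')
  have n2 := abs_nonneg (h - h')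
  have p1 := mul_nonneg hB₁0 n1
  have p2 := mul_nonneg hB₂0 n2
  have p3 := mul_nonneg (mul_nonneg hA0 hB₂0) n1
  have p4 := mul_nonneg (mul_nonneg hA0 hB₁0) n2
  nlinarith

theorem exists_lipschitz_hubbleRate (h : lo ≤ hi) :
    ∃ K, ∀ σ y h y' h', |hubbleRate γ V (clampBox lo hi (σ, y, h))
      - hubbleRate γ V (clampBox lo hi (σ, y', h'))| ≤ K * (|y - y'| + |h - h'|) := by
  obtain ⟨B₁, hB₁⟩ := exists_bound_comp_clampBox h (f := fun z => z.2.1) (by fun_prop)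
  obtain ⟨B₂, hB₂⟩ := exists_bound_comp_clampBox h (f := fun z => z.2.2) (by fun_prop)
  have hB₁0 : 0 ≤ B₁ := (abs_nonneg _).trans (hB₁ 0)
  have hB₂0 : 0 ≤ B₂ := (abs_nonneg _).trans (hB₂ 0)
  refine ⟨|γ / 4 - 1 / 2| * (B₁ + B₁) + 3 * |γ / 2| * (B₂ + B₂), fun σ y h y' h' => ?_⟩
  have e1 := hB₁ (σ, y, h)
  have e2 := hB₂ (σ, y, h)
  have e3 := hB₁ (σ, y', h')
  have e4 := hB₂ (σ, y', h')
  have d1 := abs_clamp_sub_clamp_le lo.2.1 hi.2.1 y y'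
  have d2 := abs_clamp_sub_clamp_le lo.2.2 hi.2.2 h h'
  have hφ : (clampBox lo hi (σ, y, h)).1 = (clampBox lo hi (σ, y', h')).1 := rfl
  change |(clampBox lo hi (σ, y, h)).2.1 - (clampBox lo hi (σ, y', h')).2.1| ≤ _ at d1
  change |(clampBox lo hi (σ, y, h)).2.2 - (clampBox lo hi (σ, y', h')).2.2| ≤ _ at d2
  set z := clampBox lo hi (σ, y, h)
  set z' := clampBox lo hi (σ, y', h')
  have hsplit : hubbleRate γ V z - hubbleRate γ V z'
      = (γ / 4 - 1 / 2) * (z.2.1 + z'.2.1) * (z.2.1 - z'.2.1)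
        - 3 * (γ / 2) * (z.2.2 + z'.2.2) * (z.2.2 - z'.2.2) := by
    simp only [hubbleRate, fluidDensity, hφ]
    ring
  have t1 : |(γ / 4 - 1 / 2) * (z.2.1 + z'.2.1) * (z.2.1 - z'.2.1)|
      ≤ |γ / 4 - 1 / 2| * (B₁ + B₁) * |y - y'| := by
    rw [abs_mul, abs_mul]
    gcongr
    exact (abs_add_le _ _).trans (add_le_add e1 e3)
  have t2 : |3 * (γ / 2) * (z.2.2 + z'.2.2) * (z.2.2 - z'.2.2)|
      ≤ 3 * |γ / 2| * (B₂ + B₂) * |h - h'| := by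
    rw [abs_mul, abs_mul, abs_mul, abs_of_pos (by norm_num : (0 : ℝ) < 3)]
    gcongr
    exact (abs_add_le _ _).trans (add_le_add e2 e4)
  rw [hsplit]
  refine (abs_sub _ _).trans ?_
  have n1 := abs_nonneg (y - y')
  have n2 := abs_nonneg (h - h')
  have p1 : 0 ≤ |γ / 4 - 1 / 2| * (B₁ + B₁) * |h - h'| := by positivity
  have p2 : 0 ≤ 3 * |γ / 2| * (B₂ + B₂) * |y - y'| := by positivity
  linarith

/-- The Liouville estimate for the cosmological system in a box. The divergence of the vector field
is `-(3H + α y) - 3γH`. -/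
theorem volume_le_of_flow (hV : ContDiff ℝ 1 V) (hα : Continuous α) {A : ℝ} (hA : ∀ x, |α x| ≤ A)
    (hbox : lo ≤ hi) {κ₁ κ₂ s : ℝ} (hκ₁0 : 0 ≤ κ₁) (hκ₂0 : 0 ≤ κ₂)
    (hκ₁ : ∀ z ∈ Icc lo hi, 3 * z.2.2 + α z.1 * z.2.1 ≤ κ₁)
    (hκ₂ : ∀ z ∈ Icc lo hi, 3 * γ * z.2.2 ≤ κ₂) (hs : 0 < s) {S N : Set (ℝ × ℝ × ℝ)}
    (hS : ∀ p ∈ S, ∃ X : ℝ → ℝ × ℝ × ℝ, IsTraj (cosmoField γ V α) s X ∧ X 0 = p ∧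
      (∀ t ∈ Icc 0 s, X t ∈ Icc lo hi) ∧ (∀ t ∈ Ico 0 s, ¬ IsDegenerate V α (X t)) ∧ X s ∈ N) :
    volume S ≤ ENNReal.ofReal (Real.exp ((κ₁ + κ₂) * s)) * volume N := by
  obtain ⟨K₁, hK₁⟩ := exists_lipschitz_fieldAccel (V := V) hbox hA
  obtain ⟨K₂, hK₂⟩ := exists_lipschitz_hubbleRate (γ := γ) (V := V) hbox
  obtain ⟨M₁, hM₁⟩ := exists_bound_comp_clampBox hbox (continuous_fieldAccel hV hα)
  obtain ⟨M₂, hM₂⟩ := exists_bound_comp_clampBox hbox (continuous_hubbleRate (γ := γ) hV)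
  refine volume_le_of_forall_traj (F := fun z => fieldAccel V α (clampBox lo hi z))
    (G := fun z => hubbleRate γ V (clampBox lo hi z)) (K := max K₁ K₂) (M := max M₁ M₂)
    ((continuous_fieldAccel hV hα).comp continuous_clampBox)
    ((continuous_hubbleRate hV).comp continuous_clampBox) ?_ ?_
    (fun z => (hM₁ z).trans (le_max_left _ _)) (fun z => (hM₂ z).trans (le_max_right _ _)) hs
    ?_ ?_ ?_
  · intro σ y h y' h'
    refine (hK₁ σ y h y' h').trans ?_
    gcongr
    exact le_max_left _ _
  · intro σ y h y' h'
    refine (hK₂ σ y h y' h').trans ?_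
    gcongr
    exact le_max_right _ _
  · intro φ h y₁ y₂ hy
    have m₁ := hκ₁ _ (clampBox_mem hbox (φ, y₁, h))
    have m₂ := hκ₁ _ (clampBox_mem hbox (φ, y₂, h))
    have hle : max lo.2.1 (min hi.2.1 y₁) ≤ max lo.2.1 (min hi.2.1 y₂) := by gcongr
    have hd := abs_clamp_sub_clamp_le lo.2.1 hi.2.1 y₂ y₁
    rw [abs_of_nonneg (sub_nonneg.2 hle), abs_of_nonneg (sub_nonneg.2 hy)] at hd
    have e₁ : clampBox lo hi (φ, y₁, h) = (max lo.1 (min hi.1 φ), max lo.2.1 (min hi.2.1 y₁),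
      max lo.2.2 (min hi.2.2 h)) := rfl
    have e₂ : clampBox lo hi (φ, y₂, h) = (max lo.1 (min hi.1 φ), max lo.2.1 (min hi.2.1 y₂),
      max lo.2.2 (min hi.2.2 h)) := rfl
    rw [e₁] at m₁ ⊢
    rw [e₂] at m₂ ⊢
    simp only [fieldAccel, fluidDensity] at m₁ m₂ ⊢
    set a := max lo.1 (min hi.1 φ)
    set u₁ := max lo.2.1 (min hi.2.1 y₁)
    set u₂ := max lo.2.1 (min hi.2.1 y₂)
    set w := max lo.2.2 (min hi.2.2 h)
    have h1 : 3 * w + α a * ((u₁ + u₂) / 2) ≤ κ₁ := by linarith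
    have h2 := mul_le_mul_of_nonneg_right h1 (sub_nonneg.2 hle)
    have h3 := mul_le_mul_of_nonneg_left hd hκ₁0
    nlinarith
  · intro φ y h₁ h₂ hh
    have m₁ := hκ₂ _ (clampBox_mem hbox (φ, y, h₁))
    have m₂ := hκ₂ _ (clampBox_mem hbox (φ, y, h₂))
    have hle : max lo.2.2 (min hi.2.2 h₁) ≤ max lo.2.2 (min hi.2.2 h₂) := by gcongr
    have hd := abs_clamp_sub_clamp_le lo.2.2 hi.2.2 h₂ h₁
    rw [abs_of_nonneg (sub_nonneg.2 hle), abs_of_nonneg (sub_nonneg.2 hh)] at hd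
    have e₁ : clampBox lo hi (φ, y, h₁) = (max lo.1 (min hi.1 φ), max lo.2.1 (min hi.2.1 y),
      max lo.2.2 (min hi.2.2 h₁)) := rfl
    have e₂ : clampBox lo hi (φ, y, h₂) = (max lo.1 (min hi.1 φ), max lo.2.1 (min hi.2.1 y),
      max lo.2.2 (min hi.2.2 h₂)) := rfl
    rw [e₁] at m₁ ⊢
    rw [e₂] at m₂ ⊢
    simp only [hubbleRate, fluidDensity] at m₁ m₂ ⊢
    set w₁ := max lo.2.2 (min hi.2.2 h₁)
    set w₂ := max lo.2.2 (min hi.2.2 h₂)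
    have h1 : 3 * γ * ((w₁ + w₂) / 2) ≤ κ₂ := by linarith
    have h2 := mul_le_mul_of_nonneg_right h1 (sub_nonneg.2 hle)
    have h3 := mul_le_mul_of_nonneg_left hd hκ₂0
    nlinarith
  · intro p hp
    obtain ⟨X, hX, hX0, hXbox, hnd, hXs⟩ := hS p hp
    refine ⟨X, ⟨hX.1, fun t ht => ?_⟩, hX0, fun t ht => ?_, hXs⟩
    · have := hX.2 t ht
      simp only [secondOrderField, clampBox_eq (hXbox t ⟨ht.1.le, ht.2.le⟩)]
      exact this
    · rw [clampBox_eq (hXbox t ⟨ht.1, ht.2.le⟩)]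
      exact hnd t ht

theorem exists_flow_constants (hα : Continuous α) :
    ∃ κ, 0 ≤ κ ∧ (∀ z ∈ Icc lo hi, 3 * z.2.2 + α z.1 * z.2.1 ≤ κ) ∧
      ∀ z ∈ Icc lo hi, 3 * γ * z.2.2 ≤ κ := by
  obtain ⟨M₁, hM₁⟩ := (isCompact_Icc (a := lo) (b := hi)).exists_bound_of_continuousOn
    (f := fun z => 3 * z.2.2 + α z.1 * z.2.1) (by fun_prop)
  obtain ⟨M₂, hM₂⟩ := (isCompact_Icc (a := lo) (b := hi)).exists_bound_of_continuousOn
    (f := fun z => 3 * γ * z.2.2) (by fun_prop)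
  refine ⟨max 0 (max M₁ M₂), le_max_left _ _, fun z hz => ?_, fun z hz => ?_⟩
  · exact (le_abs_self _).trans ((hM₁ z hz).trans ((le_max_left _ _).trans (le_max_right _ _)))
  · exact (le_abs_self _).trans ((hM₂ z hz).trans ((le_max_right _ _).trans (le_max_right _ _)))

/-- Local existence for the cosmological system. -/
theorem exists_traj_cosmoField (hV : ContDiff ℝ 1 V) (hα : Continuous α) (p : ℝ × ℝ × ℝ) :
    ∃ s > 0, ∃ X : ℝ → ℝ × ℝ × ℝ, IsTraj (cosmoField γ V α) s X ∧ X 0 = p := by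
  have hc := continuous_cosmoField (γ := γ) hV hα
  set lo : ℝ × ℝ × ℝ := p - (1, 1, 1) with hlo
  set hi : ℝ × ℝ × ℝ := p + (1, 1, 1) with hhi
  have hbox : lo ≤ hi := by
    rw [hlo, hhi]
    refine ⟨?_, ?_, ?_⟩ <;> simp <;> linarith
  obtain ⟨M, hM⟩ := (isCompact_Icc (a := lo) (b := hi)).exists_bound_of_continuousOn hc.continuousOn
  obtain ⟨X, hX, hX0⟩ := exists_traj_of_bounded (hc.comp (continuous_clampBox (lo := lo) (hi := hi)))
    (fun z => hM _ (clampBox_mem hbox z)) one_pos p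
  have hnhds : Icc lo hi ∈ 𝓝 p := by
    have h1 : ∀ x : ℝ, Icc (x - 1) (x + 1) ∈ 𝓝 x := fun x =>
      Icc_mem_nhds (by linarith) (by linarith)
    have := prod_mem_nhds (h1 p.1) (prod_mem_nhds (h1 p.2.1) (h1 p.2.2))
    refine mem_of_superset this ?_
    rintro ⟨a, b, c⟩ ⟨ha, hb, hc⟩
    exact ⟨⟨ha.1, hb.1, hc.1⟩, ⟨ha.2, hb.2, hc.2⟩⟩
  have h1 : Tendsto X (𝓝[Icc 0 1] 0) (𝓝 p) := by
    have := hX.1 0 ⟨le_rfl, zero_le_one⟩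
    rwa [ContinuousWithinAt, hX0] at this
  have h2 := h1.eventually hnhds
  rw [nhdsWithin_Icc_eq_nhdsGE one_pos] at h2
  obtain ⟨u, hu, hsub⟩ := mem_nhdsGE_iff_exists_Icc_subset.1 h2
  have hX' := hX.mono (min_le_right u 1)
  refine ⟨min u 1, lt_min hu one_pos, X, ⟨hX'.1, fun t ht => ?_⟩, hX0⟩
  have := hX'.2 t ht
  have hmem : X t ∈ Icc lo hi := hsub ⟨ht.1.le, ht.2.le.trans (min_le_left _ _)⟩
  simp only [Function.comp, clampBox_eq hmem] at this
  exact this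

end Cosmo

/-! ### Almost no trajectory meets a degenerate turning point -/

section Degenerate

variable {γ : ℝ} {V α : ℝ → ℝ} {lo hi : ℝ × ℝ × ℝ} {φm : ℝ}

/-- The degenerate turning points with `φ ≤ φm`, in the coordinates `(φ, H)`. -/
def degenerateCurve (V α : ℝ → ℝ) (φm : ℝ) : Set (ℝ × ℝ) :=
  {q | q.1 ≤ φm ∧ fieldAccel V α (q.1, 0, q.2) = 0}

theorem isClosed_degenerateCurve (hV : ContDiff ℝ 1 V) (hα : Continuous α) :
    IsClosed (degenerateCurve V α φm) := by
  have := continuous_fieldAccel hV hα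
  exact (isClosed_le continuous_fst continuous_const).inter
    (isClosed_eq (by fun_prop) continuous_const)

theorem volume_degenerateCurve (hV : ContDiff ℝ 1 V) (hα : Continuous α)
    (hcrit : ∀ x < φm, deriv V x ≠ 0) : volume (degenerateCurve V α φm) = 0 := by
  rw [Measure.volume_eq_prod, Measure.measure_prod_null (isClosed_degenerateCurve hV hα).measurableSet]
  have hae : ∀ᵐ x : ℝ, x ≠ φm := by simp [ae_iff]
  filter_upwards [hae] with x hx
  have hsub : ∀ h₁ ∈ Prod.mk x ⁻¹' degenerateCurve V α φm,
      ∀ h₂ ∈ Prod.mk x ⁻¹' degenerateCurve V α φm, h₂ = h₁ ∨ h₂ = -h₁ := by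
    rintro h₁ ⟨hle, e1⟩ h₂ ⟨-, e2⟩
    have hlt : x < φm := lt_of_le_of_ne hle hx
    have hc := hcrit x hlt
    simp only [fieldAccel, fluidDensity] at e1 e2
    have hα0 : α x ≠ 0 := by
      intro h0
      rw [h0] at e1
      exact hc (by linarith)
    have h3 : α x * (h₂ ^ 2 - h₁ ^ 2) = 0 := by linarith
    have h4 : h₂ ^ 2 - h₁ ^ 2 = 0 := (mul_eq_zero.1 h3).resolve_left hα0
    exact sq_eq_sq_iff_eq_or_eq_neg.1 (sub_eq_zero.1 h4)
  rcases (Prod.mk x ⁻¹' degenerateCurve V α φm).eq_empty_or_nonempty with h | ⟨h₁, hh₁⟩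
  · simp [h]
  · have : Prod.mk x ⁻¹' degenerateCurve V α φm ⊆ {h₁, -h₁} := fun h₂ hh₂ => hsub h₁ hh₁ h₂ hh₂
    exact measure_mono_null this (Set.Finite.measure_zero ((finite_singleton _).insert _) volume)

/-- The initial data in a box whose trajectory meets a degenerate turning point for the first time
at a time in `(a, b]`, while staying in the box and to the left of `φm`. -/
def hitSet (γ : ℝ) (V α : ℝ → ℝ) (lo hi : ℝ × ℝ × ℝ) (φm a b : ℝ) : Set (ℝ × ℝ × ℝ) :=
  {p | ∃ τ ∈ Ioc a b, ∃ X : ℝ → ℝ × ℝ × ℝ, IsTraj (cosmoField γ V α) τ X ∧ X 0 = p ∧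
    (∀ t ∈ Icc 0 τ, X t ∈ Icc lo hi ∧ (X t).1 ≤ φm) ∧
    (∀ t ∈ Ico 0 τ, ¬ IsDegenerate V α (X t)) ∧ IsDegenerate V α (X τ)}

theorem IsTraj.abs_sub_le {F G : ℝ × ℝ × ℝ → ℝ} {s M : ℝ} {X : ℝ → ℝ × ℝ × ℝ}
    (hX : IsTraj (secondOrderField F G) s X)
    (hM : ∀ t ∈ Ioo 0 s, ‖secondOrderField F G (X t)‖ ≤ M) : ∀ t ∈ Icc 0 s,
      |(X t).1 - (X 0).1| ≤ M * t ∧ |(X t).2.1 - (X 0).2.1| ≤ M * t ∧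
      |(X t).2.2 - (X 0).2.2| ≤ M * t := by
  have hc := hX.1
  have hd := fun t ht => hasDerivAt_triple_iff.1 (hX.2 t ht)
  have hn : ∀ t ∈ Ioo 0 s, |(X t).2.1| ≤ M ∧ |F (X t)| ≤ M ∧ |G (X t)| ≤ M := by
    intro t ht
    have h1 := hM t ht
    simp only [secondOrderField, Prod.norm_def, Real.norm_eq_abs, max_le_iff] at h1
    exact h1
  have hg : ContinuousOn (fun t => M * t) (Icc 0 s) := by fun_prop
  have hg' : ∀ t ∈ Ioo 0 s, HasDerivAt (fun t => M * t) M t := fun t _ => by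
    simpa using (hasDerivAt_id t).const_mul M
  have c1 : ContinuousOn (fun t => (X t).1 - (X 0).1) (Icc 0 s) :=
    (continuous_fst.comp_continuousOn hc).sub continuousOn_const
  have c2 : ContinuousOn (fun t => (X t).2.1 - (X 0).2.1) (Icc 0 s) :=
    ((continuous_fst.comp continuous_snd).comp_continuousOn hc).sub continuousOn_const
  have c3 : ContinuousOn (fun t => (X t).2.2 - (X 0).2.2) (Icc 0 s) :=
    ((continuous_snd.comp continuous_snd).comp_continuousOn hc).sub continuousOn_const
  intro t ht
  exact ⟨abs_le_of_abs_deriv_le c1 hg (fun t ht => (hd t ht).1.sub_const _) hg'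
      (fun t ht => (hn t ht).1) (by simp) (by simp) t ht,
    abs_le_of_abs_deriv_le c2 hg (fun t ht => (hd t ht).2.1.sub_const _) hg'
      (fun t ht => (hn t ht).2.1) (by simp) (by simp) t ht,
    abs_le_of_abs_deriv_le c3 hg (fun t ht => (hd t ht).2.2.sub_const _) hg'
      (fun t ht => (hn t ht).2.2) (by simp) (by simp) t ht⟩

theorem volume_slab (C : Set (ℝ × ℝ)) (hC : MeasurableSet C) (a : ℝ) :
    volume {p : ℝ × ℝ × ℝ | (p.1, p.2.2) ∈ C ∧ |p.2.1| ≤ a}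
      = volume C * ENNReal.ofReal (2 * a) := by
  have hm : MeasurableSet {p : ℝ × ℝ × ℝ | (p.1, p.2.2) ∈ C ∧ |p.2.1| ≤ a} := by
    refine MeasurableSet.inter ?_ ?_
    · exact (by fun_prop : Measurable fun p : ℝ × ℝ × ℝ => (p.1, p.2.2)) hC
    · exact measurableSet_le (by fun_prop : Measurable fun p : ℝ × ℝ × ℝ => |p.2.1|)
        measurable_const
  rw [← measurePreserving_insert_middle.measure_preimage hm.nullMeasurableSet]
  have h1 : (fun p : (ℝ × ℝ) × ℝ => ((p.1.1, p.2, p.1.2) : ℝ × ℝ × ℝ)) ⁻¹'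
      {p : ℝ × ℝ × ℝ | (p.1, p.2.2) ∈ C ∧ |p.2.1| ≤ a} = C ×ˢ Icc (-a) a := by
    ext p
    simp [abs_le]
  rw [h1, Measure.volume_eq_prod, Measure.prod_prod, Real.volume_Icc]
  congr 2
  ring

theorem volume_hitSet_le {M ε : ℝ} (hM : ∀ z ∈ Icc lo hi, ‖cosmoField γ V α z‖ ≤ M) (hM0 : 0 ≤ M) :
    volume (hitSet γ V α lo hi φm 0 ε) ≤
      volume (Metric.cthickening (M * ε)
        (degenerateCurve V α φm ∩ Icc (lo.1, lo.2.2) (hi.1, hi.2.2))) *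
        ENNReal.ofReal (2 * (M * ε)) := by
  rw [← volume_slab _ Metric.isClosed_cthickening.measurableSet]
  apply measure_mono
  rintro p ⟨τ, hτ, X, hX, rfl, hbox, -, hdeg⟩
  have hτm : τ ∈ Icc 0 τ := ⟨hτ.1.le, le_rfl⟩
  obtain ⟨e1, e2, e3⟩ := IsTraj.abs_sub_le hX (M := M)
    (fun t ht => hM _ (hbox t ⟨ht.1.le, ht.2.le⟩).1) τ hτm
  have hle : M * τ ≤ M * ε := mul_le_mul_of_nonneg_left hτ.2 hM0
  obtain ⟨hb, hφ⟩ := hbox τ hτm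
  constructor
  · refine Metric.mem_cthickening_of_dist_le _ ((X τ).1, (X τ).2.2) _ _ ⟨⟨hφ, ?_⟩, ?_⟩ ?_
    · change fieldAccel V α ((X τ).1, 0, (X τ).2.2) = 0
      have h0 : X τ = ((X τ).1, 0, (X τ).2.2) := by
        ext <;> simp [hdeg.1]
      rw [← h0]
      exact hdeg.2
    · exact ⟨⟨hb.1.1, hb.1.2.2⟩, ⟨hb.2.1, hb.2.2.2⟩⟩
    · rw [dist_comm, Prod.dist_eq, Real.dist_eq, Real.dist_eq]
      exact max_le (e1.trans hle) (e3.trans hle)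
  · rw [hdeg.1, zero_sub, abs_neg] at e2
    exact e2.trans hle

/-- Almost every trajectory avoids the degenerate turning points: they form a null curve in the
plane `y = 0`, and near that plane the time to reach it is at least proportional to `|y|`. -/
theorem volume_hitSet (hV : ContDiff ℝ 1 V) (hα : Continuous α) {A : ℝ} (hA : ∀ x, |α x| ≤ A)
    (hbox : lo ≤ hi) (hcrit : ∀ x < φm, deriv V x ≠ 0) {T : ℝ} (hT : 0 < T) :
    volume (hitSet γ V α lo hi φm 0 T) = 0 := by
  obtain ⟨M, hM⟩ := (isCompact_Icc (a := lo) (b := hi)).exists_bound_of_continuousOn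
    (continuous_cosmoField (γ := γ) hV hα).continuousOn
  have hM0 : 0 ≤ M := (norm_nonneg _).trans (hM lo ⟨le_rfl, hbox⟩)
  obtain ⟨κ, hκ0, hκ₁, hκ₂⟩ := exists_flow_constants (γ := γ) (lo := lo) (hi := hi) hα
  set W := degenerateCurve V α φm ∩ Icc (lo.1, lo.2.2) (hi.1, hi.2.2) with hW
  have hWc : IsCompact W := isCompact_Icc.inter_left (isClosed_degenerateCurve hV hα)
  have hW0 : volume W = 0 := measure_mono_null inter_subset_left (volume_degenerateCurve hV hα hcrit)
  set E := ENNReal.ofReal (Real.exp ((κ + κ) * T)) with hE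
  have hE1 : 1 ≤ E := by
    rw [hE, ← ENNReal.ofReal_one]
    exact ENNReal.ofReal_le_ofReal (Real.one_le_exp (by positivity))
  have hstep : ∀ m : ℕ, 0 < m → ∀ j : ℕ, j < m →
      volume (hitSet γ V α lo hi φm (j * (T / m)) ((j + 1) * (T / m)))
        ≤ E * volume (hitSet γ V α lo hi φm 0 (T / m)) := by
    intro m hm j hj
    have hm' : (0 : ℝ) < m := by exact_mod_cast hm
    rcases Nat.eq_zero_or_pos j with rfl | hj0
    · simp only [Nat.cast_zero, zero_mul, zero_add, one_mul]
      exact le_mul_of_one_le_left zero_le hE1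
    · have hj' : (0 : ℝ) < j := by exact_mod_cast hj0
      have hs : 0 < j * (T / m) := by positivity
      have hsT : j * (T / m) ≤ T := by
        have : (j : ℝ) ≤ m := by exact_mod_cast hj.le
        rw [← mul_div_assoc, div_le_iff₀ hm']
        nlinarith
      refine (volume_le_of_flow hV hα hA hbox hκ0 hκ0 hκ₁ hκ₂ hs
        (N := hitSet γ V α lo hi φm 0 (T / m)) ?_).trans ?_
      · rintro p ⟨τ, hτ, X, hX, hX0, hb, hnd, hd⟩
        refine ⟨X, hX.mono hτ.1.le, hX0, fun t ht => (hb t ⟨ht.1, ht.2.trans hτ.1.le⟩).1,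
          fun t ht => hnd t ⟨ht.1, ht.2.trans hτ.1⟩, ?_⟩
        refine ⟨τ - j * (T / m), ⟨by linarith [hτ.1], by linarith [hτ.2]⟩,
          fun t => X (j * (T / m) + t), hX.shift hs.le, by simp, fun t ht => ?_, fun t ht => ?_, ?_⟩
        · exact hb _ ⟨by linarith [ht.1], by linarith [ht.2]⟩
        · exact hnd _ ⟨by linarith [ht.1], by linarith [ht.2]⟩
        · simpa using hd
      · refine mul_le_mul_left (ENNReal.ofReal_le_ofReal (Real.exp_le_exp.2 ?_)) _
        gcongr
  have hbound : ∀ m : ℕ, 0 < m → volume (hitSet γ V α lo hi φm 0 T)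
      ≤ E * ENNReal.ofReal (2 * (M * T)) * volume (Metric.cthickening (M * T / m) W) := by
    intro m hm
    have hm' : (0 : ℝ) < m := by exact_mod_cast hm
    have hcover : hitSet γ V α lo hi φm 0 T ⊆
        ⋃ j ∈ Finset.range m, hitSet γ V α lo hi φm (j * (T / m)) ((j + 1) * (T / m)) := by
      rintro p ⟨τ, hτ, X, h⟩
      have hTm : 0 < T / m := by positivity
      obtain ⟨j, hj⟩ : ∃ j : ℕ, ⌈τ / (T / m)⌉₊ = j + 1 :=
        Nat.exists_eq_succ_of_ne_zero (Nat.ceil_pos.2 (div_pos hτ.1 hTm)).ne'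
      have h1 : τ / (T / m) ≤ j + 1 := by
        have := Nat.le_ceil (τ / (T / m)); rw [hj] at this; exact_mod_cast this
      have h2 : (j : ℝ) < τ / (T / m) := by
        apply Nat.lt_ceil.1; omega
      have hjm : j < m := by
        have h3 : τ / (T / m) ≤ m := by
          rw [div_le_iff₀ hTm, mul_div_cancel₀ _ hm'.ne']; exact hτ.2
        exact_mod_cast h2.trans_le h3
      refine mem_iUnion₂.2 ⟨j, Finset.mem_range.2 hjm, τ, ⟨?_, ?_⟩, X, h⟩
      · rwa [lt_div_iff₀ hTm] at h2
      · rwa [div_le_iff₀ hTm] at h1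
    refine (measure_mono hcover).trans ((measure_biUnion_finset_le _ _).trans ?_)
    refine (Finset.sum_le_sum fun j hj => (hstep m hm j (Finset.mem_range.1 hj)).trans
      (mul_le_mul_right (volume_hitSet_le hM hM0) E)).trans (le_of_eq ?_)
    rw [Finset.sum_const, Finset.card_range, nsmul_eq_mul, ← mul_div_assoc M T]
    have e1 : ENNReal.ofReal (2 * (M * T)) = m * ENNReal.ofReal (2 * (M * T / m)) := by
      rw [← ENNReal.ofReal_natCast, ← ENNReal.ofReal_mul hm'.le]
      congr 1
      field_simp
    rw [e1]
    ring
  have hlim : Tendsto (fun m : ℕ => E * ENNReal.ofReal (2 * (M * T)) *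
      volume (Metric.cthickening (M * T / m) W)) atTop (𝓝 0) := by
    have t1 := (tendsto_measure_cthickening_of_isCompact (μ := volume) hWc).comp
      (tendsto_const_div_atTop_nhds_zero_nat (M * T))
    rw [hW0] at t1
    have := ENNReal.Tendsto.const_mul (a := E * ENNReal.ofReal (2 * (M * T))) t1
      (Or.inr (ENNReal.mul_ne_top ENNReal.ofReal_ne_top ENNReal.ofReal_ne_top))
    rwa [mul_zero] at this
  refine le_antisymm (ge_of_tendsto hlim ?_) zero_le
  filter_upwards [eventually_gt_atTop 0] with m hm using hbound m hm

end Degenerate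

/-! ### Comparison of trajectories climbing towards the maximum -/

theorem nonneg_of_barrier {f f' : ℝ → ℝ} {a b : ℝ} (hf : ContinuousOn f (Icc a b))
    (hf' : ∀ t ∈ Ioo a b, HasDerivAt f (f' t) t) (hb : ∀ t ∈ Ioo a b, f t < 0 → 0 ≤ f' t)
    (h0 : 0 ≤ f a) : ∀ t ∈ Icc a b, 0 ≤ f t := by
  have hcl : IsClosed ({t | 0 ≤ f t} ∩ Icc a b) := by
    have := hf.preimage_isClosed_of_isClosed isClosed_Icc (isClosed_Ici (a := (0 : ℝ)))
    rwa [inter_comm] at this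
  refine fun t ht => hcl.Icc_subset_of_forall_exists_gt h0 ?_ ht
  rintro x ⟨hx, hxa, hxb⟩ y hy
  by_contra hne
  rw [not_nonempty_iff_eq_empty, eq_empty_iff_forall_notMem] at hne
  have hneg : ∀ t ∈ Ioc x (min y b), f t < 0 := by
    intro t ht
    by_contra h
    exact hne t ⟨not_lt.1 h, ht.1, ht.2.trans (min_le_left _ _)⟩
  have hxm : x < min y b := lt_min hy hxb
  have h1 := le_of_deriv_le (f := fun _ => f x) (g := f) (f' := fun _ => 0) (g' := f')
    (a := x) (b := min y b) continuousOn_const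
    (hf.mono (Icc_subset_Icc hxa (min_le_right _ _))) (fun t _ => hasDerivAt_const _ _)
    (fun t ht => hf' t ⟨hxa.trans_lt ht.1, ht.2.trans_le (min_le_right _ _)⟩)
    (fun t ht => hb t ⟨hxa.trans_lt ht.1, ht.2.trans_le (min_le_right _ _)⟩
      (hneg t ⟨ht.1, ht.2.le⟩)) le_rfl (min y b) ⟨hxm.le, le_rfl⟩
  have h2 := hneg (min y b) ⟨hxm, le_rfl⟩
  have h3 : 0 ≤ f x := hx
  linarith

theorem le_of_monotone_while_pos {f f' : ℝ → ℝ} {a b : ℝ} (hf : ContinuousOn f (Icc a b))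
    (hf' : ∀ t ∈ Ioo a b, HasDerivAt f (f' t) t) (hb : ∀ t ∈ Ioo a b, 0 < f t → 0 ≤ f' t)
    (h0 : 0 < f a) : ∀ t ∈ Icc a b, f a ≤ f t := by
  have hcl : IsClosed ({t | f a ≤ f t} ∩ Icc a b) := by
    have := hf.preimage_isClosed_of_isClosed isClosed_Icc (isClosed_Ici (a := f a))
    rwa [inter_comm] at this
  refine fun t ht => hcl.Icc_subset_of_forall_exists_gt (le_refl (f a)) ?_ ht
  rintro x ⟨hx, hxa, hxb⟩ y hy
  have hx' : f a ≤ f x := hx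
  have h1 : ContinuousWithinAt f (Icc x b) x :=
    (hf x ⟨hxa, hxb.le⟩).mono (Icc_subset_Icc_left hxa)
  have h2 := h1.eventually (lt_mem_nhds (h0.trans_le hx'))
  rw [nhdsWithin_Icc_eq_nhdsGE hxb] at h2
  obtain ⟨u, hu, hsub⟩ := mem_nhdsGE_iff_exists_Icc_subset.1 h2
  have hxm : x < min u (min y b) := lt_min hu (lt_min hy hxb)
  have hmb : min u (min y b) ≤ b := (min_le_right _ _).trans (min_le_right _ _)
  refine ⟨min u (min y b), ?_, hxm, (min_le_right _ _).trans (min_le_left _ _)⟩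
  have h3 := le_of_deriv_le (f := fun _ => f x) (g := f) (f' := fun _ => 0) (g' := f')
    (a := x) (b := min u (min y b)) continuousOn_const
    (hf.mono (Icc_subset_Icc hxa hmb)) (fun t _ => hasDerivAt_const _ _)
    (fun t ht => hf' t ⟨hxa.trans_lt ht.1, ht.2.trans_le hmb⟩)
    (fun t ht => hb t ⟨hxa.trans_lt ht.1, ht.2.trans_le hmb⟩
      (hsub ⟨ht.1.le, ht.2.le.trans (min_le_left _ _)⟩)) le_rfl _ ⟨hxm.le, le_rfl⟩
  exact hx'.trans h3

/-- A trajectory with `φ' > 0` on `[c, φm)`, described by the expansion-normalized velocity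
`x = φ'/H` and density `w = ρ/H²` as functions of `φ`. The function `P` stands for `V'/V`. Both
quantities tend to `0` at `φm`. -/
structure IsClimbing (γ : ℝ) (P α : ℝ → ℝ) (φm c : ℝ) (x w : ℝ → ℝ) : Prop where
  contx : ContinuousOn x (Ico c φm)
  contw : ContinuousOn w (Ico c φm)
  posx : ∀ s ∈ Ico c φm, 0 < x s
  posw : ∀ s ∈ Ico c φm, 0 < w s
  lex : ∀ s ∈ Ico c φm, x s ≤ 1
  lew : ∀ s ∈ Ico c φm, w s ≤ 1
  derivx : ∀ s ∈ Ioo c φm, HasDerivAt x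
    (-3 - P s * (3 - x s ^ 2 / 2 - w s) / x s + α s * w s / x s + (x s ^ 2 + γ * w s) / 2) s
  derivw : ∀ s ∈ Ioo c φm, HasDerivAt w (w s * (γ * (w s - 3) / x s + x s - α s)) s
  limx : Tendsto x (𝓝[<] φm) (𝓝 0)
  limw : Tendsto w (𝓝[<] φm) (𝓝 0)

/-- Near the maximum the logarithmic derivative `P = V'/V` is comparable to the distance `φm - φ`,
and the coupling `α` is nonnegative. -/
structure IsHyperbolic (P α : ℝ → ℝ) (φm c k₁ k₂ : ℝ) : Prop where
  pos : 0 < k₁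
  lower : ∀ s ∈ Ico c φm, k₁ * (φm - s) ≤ P s
  upper : ∀ s ∈ Ico c φm, P s ≤ k₂ * (φm - s)
  coupling : ∀ s ∈ Ico c φm, 0 ≤ α s

section Climbing

variable {γ φm c k₁ k₂ : ℝ} {P α x w x₁ w₁ x₂ w₂ : ℝ → ℝ}

theorem IsHyperbolic.nonneg (h : IsHyperbolic P α φm c k₁ k₂) {s : ℝ} (hs : s ∈ Ico c φm) :
    0 ≤ P s :=
  (mul_nonneg h.pos.le (by linarith [hs.2])).trans (h.lower s hs)

/-- A climbing trajectory which comes to rest at the maximum is slow near it: if `x` exceeded a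
large multiple of `φm - φ`, it would overshoot. -/
theorem IsClimbing.le_linear (hγ : 0 ≤ γ) (hk₂ : 0 ≤ k₂) (hP : IsHyperbolic P α φm c k₁ k₂)
    (h : IsClimbing γ P α φm c x w) : ∀ s ∈ Ico c φm, x s ≤ (6 + k₂) * (φm - s) := by
  intro s hs
  by_contra hcon
  push Not at hcon
  set Z := 6 + k₂ with hZ
  have hmono : ∀ b ∈ Ico s φm, x s - Z * (φm - s) ≤ x b - Z * (φm - b) := by
    intro b hb
    refine le_of_monotone_while_pos (f := fun t => x t - Z * (φm - t)) (a := s) (b := b)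
      (f' := fun t => (-3 - P t * (3 - x t ^ 2 / 2 - w t) / x t + α t * w t / x t
        + (x t ^ 2 + γ * w t) / 2) + Z) ?_ ?_ ?_ (by linarith) b ⟨hb.1, le_rfl⟩
    · refine (h.contx.mono fun t ht => ⟨hs.1.trans ht.1, ht.2.trans_lt hb.2⟩).sub ?_
      fun_prop
    · intro t ht
      have h1 := h.derivx t ⟨hs.1.trans_lt ht.1, ht.2.trans hb.2⟩
      have h2 : HasDerivAt (fun t => Z * (φm - t)) (-Z) t := by
        simpa using ((hasDerivAt_id t).const_sub φm).const_mul Z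
      exact (h1.sub h2).congr_deriv (by ring)
    · intro t ht hpos
      have ht' : t ∈ Ico c φm := ⟨hs.1.trans ht.1.le, ht.2.trans hb.2⟩
      have px := h.posx t ht'
      have pw := h.posw t ht'
      have hP0 := hP.nonneg ht'
      have hPu := hP.upper t ht'
      have hα := hP.coupling t ht'
      have hxt : Z * (φm - t) < x t := by linarith
      have hu : 0 < φm - t := by linarith [ht'.2]
      have e1 : P t * (3 - x t ^ 2 / 2 - w t) / x t ≤ k₂ / 2 := by
        rw [div_le_iff₀ px]
        have a1 : P t * (3 - x t ^ 2 / 2 - w t) ≤ P t * 3 := by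
          apply mul_le_mul_of_nonneg_left _ hP0
          nlinarith [sq_nonneg (x t)]
        have a2 : 6 * (φm - t) ≤ x t := by nlinarith
        nlinarith
      have e2 : 0 ≤ α t * w t / x t := by positivity
      have e3 : 0 ≤ (x t ^ 2 + γ * w t) / 2 := by positivity
      rw [hZ]
      linarith
  have hlim : Tendsto (fun b => x b - Z * (φm - b)) (𝓝[<] φm) (𝓝 0) := by
    have h1 : Tendsto (fun b => Z * (φm - b)) (𝓝[<] φm) (𝓝 0) := by
      have : Continuous fun b => Z * (φm - b) := by fun_prop
      have h2 := this.tendsto φm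
      simp only [sub_self, mul_zero] at h2
      exact h2.mono_left nhdsWithin_le_nhds
    simpa using h.limx.sub h1
  have hge := ge_of_tendsto hlim (b := x s - Z * (φm - s)) (by
    filter_upwards [Ioo_mem_nhdsLT hs.2] with b hb using hmono b ⟨hb.1.le, hb.2⟩)
  linarith

theorem IsClimbing.hasDerivAt_log_x (h : IsClimbing γ P α φm c x w) {s : ℝ} (hs : s ∈ Ioo c φm) :
    HasDerivAt (fun s => Real.log (x s)) (-3 / x s - 3 * (P s / x s ^ 2) + P s / 2
      + (P s + α s) * (w s / x s ^ 2) + x s / 2 + γ / 2 * (w s / x s)) s := by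
  have hx := (h.posx s ⟨hs.1.le, hs.2⟩).ne'
  refine ((h.derivx s hs).log hx).congr_deriv ?_
  field_simp
  ring

theorem IsClimbing.hasDerivAt_log_w (h : IsClimbing γ P α φm c x w) {s : ℝ} (hs : s ∈ Ioo c φm) :
    HasDerivAt (fun s => Real.log (w s)) (γ * (w s - 3) / x s + x s - α s) s := by
  have hw := (h.posw s ⟨hs.1.le, hs.2⟩).ne'
  exact ((h.derivw s hs).log hw).congr_deriv (by field_simp)

/-- The relative density gap grows while the second trajectory is faster and denser. -/
theorem log_w_rate_gap {x₁ x₂ w₁ w₂ a : ℝ} (hγ : 0 ≤ γ) (hx₁ : 0 < x₁) (hx : x₁ ≤ x₂)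
    (hw : w₁ ≤ w₂) (hw₁ : w₁ ≤ 1) :
    2 * γ * (1 / x₁ - 1 / x₂) ≤ (γ * (w₂ - 3) / x₂ + x₂ - a) - (γ * (w₁ - 3) / x₁ + x₁ - a) := by
  have hx₂ : 0 < x₂ := hx₁.trans_le hx
  have hδ : 1 / x₂ ≤ 1 / x₁ := one_div_le_one_div_of_le hx₁ hx
  have h1 : (γ * (w₂ - 3) / x₂ + x₂ - a) - (γ * (w₁ - 3) / x₁ + x₁ - a)
      = γ * ((3 - w₁) * (1 / x₁ - 1 / x₂)) + γ * ((w₂ - w₁) / x₂) + (x₂ - x₁) := by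
    field_simp
    ring
  rw [h1]
  have h2 : 0 ≤ (w₂ - w₁) / x₂ := div_nonneg (by linarith) hx₂.le
  have h3 := mul_nonneg hγ h2
  have h4 : 2 * (1 / x₁ - 1 / x₂) ≤ (3 - w₁) * (1 / x₁ - 1 / x₂) :=
    mul_le_mul_of_nonneg_right (by linarith) (by linarith)
  have h5 := mul_le_mul_of_nonneg_left h4 hγ
  linarith

/-- The relative velocity gap grows while the second trajectory is faster and its relative density
gap is at least twice the relative velocity gap. -/
theorem log_x_rate_gap {x₁ x₂ w₁ w₂ p a : ℝ} (hγ : 0 ≤ γ) (hp : 0 ≤ p) (ha : 0 ≤ a)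
    (hx₁ : 0 < x₁) (hx : x₁ ≤ x₂) (hw : w₁ / x₁ ^ 2 ≤ w₂ / x₂ ^ 2) (hw₁ : 0 ≤ w₁) :
    3 * (1 / x₁ - 1 / x₂) ≤
      (-3 / x₂ - 3 * (p / x₂ ^ 2) + p / 2 + (p + a) * (w₂ / x₂ ^ 2) + x₂ / 2 + γ / 2 * (w₂ / x₂))
      - (-3 / x₁ - 3 * (p / x₁ ^ 2) + p / 2 + (p + a) * (w₁ / x₁ ^ 2) + x₁ / 2
        + γ / 2 * (w₁ / x₁)) := by
  have hx₂ : 0 < x₂ := hx₁.trans_le hx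
  have h1 : p / x₂ ^ 2 ≤ p / x₁ ^ 2 := by gcongr
  have h2 := mul_le_mul_of_nonneg_left hw (add_nonneg hp ha)
  have h3 : w₁ / x₁ ≤ w₂ / x₂ := by
    have e1 : w₁ / x₁ = w₁ / x₁ ^ 2 * x₁ := by field_simp
    have e2 : w₂ / x₂ = w₂ / x₂ ^ 2 * x₂ := by field_simp
    rw [e1, e2]
    exact mul_le_mul hw hx hx₁.le (le_trans (by positivity) hw)
  have h4 := mul_le_mul_of_nonneg_left h3 (by linarith : 0 ≤ γ / 2)
  have e3 : -3 / x₂ = -3 * (1 / x₂) := by ring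
  have e4 : -3 / x₁ = -3 * (1 / x₁) := by ring
  rw [e3, e4]
  linarith

/-- The relative gaps of velocity and density between two climbing trajectories, the second one
being initially faster and denser, both diverge at the maximum. -/
theorem IsClimbing.exists_gap_growth (hγ : 0 < γ) (hk₂ : 0 ≤ k₂) (hc : c < φm)
    (hP : IsHyperbolic P α φm c k₁ k₂)
    (h₁ : IsClimbing γ P α φm c x₁ w₁) (h₂ : IsClimbing γ P α φm c x₂ w₂)
    (hx : x₁ c < x₂ c) (hw : w₁ c < w₂ c) : ∃ κ > 0, ∀ s ∈ Ico c φm,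
      κ * (Real.log (φm - c) - Real.log (φm - s)) ≤ Real.log (x₂ s) - Real.log (x₁ s) ∧
      κ * (Real.log (φm - c) - Real.log (φm - s)) ≤ Real.log (w₂ s) - Real.log (w₁ s) := by
  have hcm : c ∈ Ico c φm := ⟨le_rfl, hc⟩
  set ξ : ℝ → ℝ := fun s => Real.log (x₂ s) - Real.log (x₁ s) with hξ
  set r : ℝ → ℝ := fun s => Real.log (w₂ s) - Real.log (w₁ s) with hr
  have hξ0 : 0 < ξ c := sub_pos.2 (Real.log_lt_log (h₁.posx c hcm) hx)
  have hr0 : 0 < r c := sub_pos.2 (Real.log_lt_log (h₁.posw c hcm) hw)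
  set m := min (ξ c) (r c / 2) with hm
  have hm0 : 0 < m := lt_min hξ0 (by linarith)
  have cξ : ContinuousOn ξ (Ico c φm) :=
    (h₂.contx.log fun s hs => (h₂.posx s hs).ne').sub (h₁.contx.log fun s hs => (h₁.posx s hs).ne')
  have cr : ContinuousOn r (Ico c φm) :=
    (h₂.contw.log fun s hs => (h₂.posw s hs).ne').sub (h₁.contw.log fun s hs => (h₁.posw s hs).ne')
  have dξ := fun s (hs : s ∈ Ioo c φm) => (h₂.hasDerivAt_log_x hs).sub (h₁.hasDerivAt_log_x hs)
  have dr := fun s (hs : s ∈ Ioo c φm) => (h₂.hasDerivAt_log_w hs).sub (h₁.hasDerivAt_log_w hs)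
  have lex : ∀ s ∈ Ico c φm, 0 ≤ ξ s → x₁ s ≤ x₂ s := fun s hs h =>
    (Real.log_le_log_iff (h₁.posx s hs) (h₂.posx s hs)).1 (sub_nonneg.1 h)
  have lew : ∀ s ∈ Ico c φm, 0 ≤ r s → w₁ s ≤ w₂ s := fun s hs h =>
    (Real.log_le_log_iff (h₁.posw s hs) (h₂.posw s hs)).1 (sub_nonneg.1 h)
  have leκ : ∀ s ∈ Ico c φm, 2 * ξ s ≤ r s → w₁ s / x₁ s ^ 2 ≤ w₂ s / x₂ s ^ 2 := by
    intro s hs h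
    have p1 := h₁.posx s hs
    have p2 := h₂.posx s hs
    have p3 := h₁.posw s hs
    have p4 := h₂.posw s hs
    rw [← Real.log_le_log_iff (by positivity) (by positivity), Real.log_div p3.ne' (by positivity),
      Real.log_div p4.ne' (by positivity), Real.log_pow, Real.log_pow]
    simp only [hξ, hr] at h
    push_cast
    linarith
  -- the ordering of the two trajectories persists
  have hpersist : ∀ s ∈ Ico c φm, m ≤ ξ s ∧ r c ≤ r s := by
    intro s hs
    have hsub : Icc c s ⊆ Ico c φm := fun t ht => ⟨ht.1, ht.2.trans_lt hs.2⟩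
    have hcl : IsClosed ({t | m ≤ ξ t ∧ r c ≤ r t} ∩ Icc c s) := by
      have e1 := (cξ.mono hsub).preimage_isClosed_of_isClosed isClosed_Icc (isClosed_Ici (a := m))
      have e2 := (cr.mono hsub).preimage_isClosed_of_isClosed isClosed_Icc (isClosed_Ici (a := r c))
      convert e1.inter e2 using 1
      ext t
      simp only [mem_inter_iff, mem_ofPred_eq, mem_preimage, mem_Ici]
      tauto
    refine hcl.Icc_subset_of_forall_exists_gt ⟨min_le_left _ _, le_rfl⟩ ?_ ⟨hs.1, le_rfl⟩
    rintro t ⟨⟨ht1, ht2⟩, hta, htb⟩ y hy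
    have n1 : ∀ᶠ τ in 𝓝[Icc t s] t, 0 < ξ τ :=
      ((cξ t (hsub ⟨hta, htb.le⟩)).mono fun τ hτ => hsub ⟨hta.trans hτ.1, hτ.2⟩).eventually
        (lt_mem_nhds (hm0.trans_le ht1))
    have n2 : ∀ᶠ τ in 𝓝[Icc t s] t, 0 < r τ :=
      ((cr t (hsub ⟨hta, htb.le⟩)).mono fun τ hτ => hsub ⟨hta.trans hτ.1, hτ.2⟩).eventually
        (lt_mem_nhds (hr0.trans_le ht2))
    have n3 := n1.and n2
    rw [nhdsWithin_Icc_eq_nhdsGE htb] at n3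
    obtain ⟨u, hu, husub⟩ := mem_nhdsGE_iff_exists_Icc_subset.1 n3
    set b := min u (min y s) with hb
    have htb' : t < b := lt_min hu (lt_min hy htb)
    have hbs : b ≤ s := (min_le_right _ _).trans (min_le_right _ _)
    have hI : Icc t b ⊆ Ico c φm := fun τ hτ => hsub ⟨hta.trans hτ.1, hτ.2.trans hbs⟩
    have hIo : ∀ τ ∈ Ioo t b, τ ∈ Ioo c φm := fun τ hτ =>
      ⟨hta.trans_lt hτ.1, (hI ⟨hτ.1.le, hτ.2.le⟩).2⟩
    have hposI : ∀ τ ∈ Icc t b, 0 < ξ τ ∧ 0 < r τ := fun τ hτ =>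
      husub ⟨hτ.1, hτ.2.trans (min_le_left _ _)⟩
    have hrI : ∀ τ ∈ Icc t b, r c ≤ r τ := by
      refine fun τ hτ => ht2.trans ?_
      refine le_of_deriv_le (f := fun _ => r t) (f' := fun _ => 0) continuousOn_const (cr.mono hI)
        (fun _ _ => hasDerivAt_const _ _) (fun τ hτ => dr τ (hIo τ hτ)) ?_ le_rfl τ hτ
      intro τ hτ
      have hτI := hI ⟨hτ.1.le, hτ.2.le⟩
      obtain ⟨q1, q2⟩ := hposI τ ⟨hτ.1.le, hτ.2.le⟩
      have hl := lex τ hτI q1.le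
      refine le_trans ?_ (log_w_rate_gap hγ.le (h₁.posx τ hτI) hl (lew τ hτI q2.le) (h₁.lew τ hτI))
      have := one_div_le_one_div_of_le (h₁.posx τ hτI) hl
      exact mul_nonneg (by positivity) (by linarith)
    refine ⟨b, ⟨?_, hrI b ⟨htb'.le, le_rfl⟩⟩, htb', (min_le_right _ _).trans (min_le_left _ _)⟩
    have := nonneg_of_barrier (f := fun τ => ξ τ - m) (a := t) (b := b) ((cξ.mono hI).sub
      continuousOn_const) (fun τ hτ => (dξ τ (hIo τ hτ)).sub_const m) ?_ (by linarith) b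
      ⟨htb'.le, le_rfl⟩
    · linarith
    intro τ hτ hneg
    have hτI := hI ⟨hτ.1.le, hτ.2.le⟩
    obtain ⟨q1, q2⟩ := hposI τ ⟨hτ.1.le, hτ.2.le⟩
    have q3 := hrI τ ⟨hτ.1.le, hτ.2.le⟩
    have q4 : m ≤ r c / 2 := min_le_right _ _
    have hl := lex τ hτI q1.le
    refine le_trans ?_ (log_x_rate_gap hγ.le (hP.nonneg hτI) (hP.coupling τ hτI) (h₁.posx τ hτI) hl
      (leκ τ hτI (by linarith)) (h₁.posw τ hτI).le)
    have := one_div_le_one_div_of_le (h₁.posx τ hτI) hl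
    linarith
  -- a lower bound for the common rate
  set Z := 6 + k₂ with hZ
  have hZ0 : 0 < Z := by positivity
  have hrate : ∀ s ∈ Ico c φm, m / (Z * (φm - s)) ≤ 1 / x₁ s - 1 / x₂ s := by
    intro s hs
    have p1 := h₁.posx s hs
    have p2 := h₂.posx s hs
    have hle := h₂.le_linear hγ.le hk₂ hP s hs
    have hq := (hpersist s hs).1
    have e1 : x₂ s / x₁ s = Real.exp (ξ s) := by
      rw [hξ, Real.exp_sub, Real.exp_log p2, Real.exp_log p1]
    have e2 : 1 / x₁ s - 1 / x₂ s = (x₂ s / x₁ s - 1) / x₂ s := by field_simp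
    rw [e2, e1]
    have e3 := Real.add_one_le_exp (ξ s)
    have hu : 0 < φm - s := by linarith [hs.2]
    calc m / (Z * (φm - s)) ≤ m / x₂ s := by gcongr
      _ ≤ (Real.exp (ξ s) - 1) / x₂ s := by gcongr; linarith
  have hord : ∀ s ∈ Ico c φm, x₁ s ≤ x₂ s ∧ w₁ s ≤ w₂ s := fun s hs =>
    ⟨lex s hs (hm0.le.trans (hpersist s hs).1), lew s hs (hr0.le.trans (hpersist s hs).2)⟩
  set κ := min γ 3 * m / Z with hκ
  have hκ0 : 0 < κ := by
    have : 0 < min γ 3 := lt_min hγ (by norm_num)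
    positivity
  have dL : ∀ s ∈ Ioo c φm, HasDerivAt
      (fun s => κ * (Real.log (φm - c) - Real.log (φm - s))) (κ * (1 / (φm - s))) s := by
    intro s hs
    have hne : φm - s ≠ 0 := by linarith [hs.2]
    have := (((hasDerivAt_id s).const_sub φm).log hne).const_sub (Real.log (φm - c))
    refine (this.const_mul κ).congr_deriv ?_
    simp
    ring
  have cL : ContinuousOn (fun s => κ * (Real.log (φm - c) - Real.log (φm - s))) (Ico c φm) := by
    refine continuousOn_const.mul (continuousOn_const.sub (ContinuousOn.log (by fun_prop) ?_))
    intro s hs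
    linarith [hs.2]
  have hgr : ∀ s ∈ Ico c φm,
      2 * (κ * (Real.log (φm - c) - Real.log (φm - s)) + m) ≤ r s := by
    intro s hs
    have hI : Icc c s ⊆ Ico c φm := fun τ hτ => ⟨hτ.1, hτ.2.trans_lt hs.2⟩
    refine le_of_deriv_le (((cL.mono hI).add continuousOn_const).const_smul (2 : ℝ)) (cr.mono hI)
      (fun τ hτ => ((dL τ ⟨hτ.1, hτ.2.trans hs.2⟩).add_const m).const_mul 2)
      (fun τ hτ => dr τ ⟨hτ.1, hτ.2.trans hs.2⟩) ?_ ?_ s ⟨hs.1, le_rfl⟩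
    · intro τ hτ
      have hτI := hI ⟨hτ.1.le, hτ.2.le⟩
      obtain ⟨o1, o2⟩ := hord τ hτI
      refine le_trans ?_ (log_w_rate_gap hγ.le (h₁.posx τ hτI) o1 o2 (h₁.lew τ hτI))
      have hu : 0 < φm - τ := by linarith [hτI.2]
      have e1 : 2 * (κ * (1 / (φm - τ))) = 2 * min γ 3 * (m / (Z * (φm - τ))) := by
        rw [hκ]; field_simp
      rw [e1]
      have hmin : min γ 3 ≤ γ := min_le_left _ _
      have := hrate τ hτI
      gcongr
    · change 2 * (κ * (Real.log (φm - c) - Real.log (φm - c)) + m) ≤ r c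
      have : m ≤ r c / 2 := min_le_right _ _
      rw [sub_self, mul_zero, zero_add]
      linarith
  have hgξ : ∀ s ∈ Ico c φm, κ * (Real.log (φm - c) - Real.log (φm - s)) + m ≤ ξ s := by
    intro s hs
    have hI : Icc c s ⊆ Ico c φm := fun τ hτ => ⟨hτ.1, hτ.2.trans_lt hs.2⟩
    have := nonneg_of_barrier
      (f := fun τ => ξ τ - (κ * (Real.log (φm - c) - Real.log (φm - τ)) + m)) (a := c) (b := s)
      ((cξ.mono hI).sub ((cL.mono hI).add continuousOn_const))
      (fun τ hτ => (dξ τ ⟨hτ.1, hτ.2.trans hs.2⟩).sub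
        ((dL τ ⟨hτ.1, hτ.2.trans hs.2⟩).add_const m)) ?_ ?_ s ⟨hs.1, le_rfl⟩
    · linarith
    · intro τ hτ hneg
      have hτI := hI ⟨hτ.1.le, hτ.2.le⟩
      have hrr := hgr τ hτI
      rw [sub_nonneg]
      refine le_trans ?_ (log_x_rate_gap hγ.le (hP.nonneg hτI) (hP.coupling τ hτI)
        (h₁.posx τ hτI) (hord τ hτI).1 (leκ τ hτI (by linarith)) (h₁.posw τ hτI).le)
      have hu : 0 < φm - τ := by linarith [hτI.2]
      have e1 : κ * (1 / (φm - τ)) = min γ 3 * (m / (Z * (φm - τ))) := by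
        rw [hκ]; field_simp
      rw [e1]
      have hmin : min γ 3 ≤ 3 := min_le_right _ _
      have := hrate τ hτI
      gcongr
    · simp only [sub_self, mul_zero, zero_add]
      have : m ≤ ξ c := min_le_left _ _
      linarith
  refine ⟨κ, hκ0, fun s hs => ⟨by linarith [hgξ s hs], ?_⟩⟩
  have h1 := hgr s hs
  have hu : 0 < φm - s := by linarith [hs.2]
  have h2 : Real.log (φm - s) ≤ Real.log (φm - c) := Real.log_le_log hu (by linarith [hs.1])
  have h3 := mul_nonneg hκ0.le (sub_nonneg.2 h2)
  linarith

/-- The rate of change of `x₂²/2 - q x₁²/2 + q k₁ u²/2`, where `u` is the distance to the maximum,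
is nonnegative when `w₂ ≥ q w₁` for a large `q`: the density terms have the favourable sign, and the
remaining ones are of first order in `u`. -/
theorem kinetic_gap_rate_nonneg {x₁ x₂ w₁ w₂ p a q u Z : ℝ} (hγ : 0 ≤ γ)
    (hZ : 0 ≤ Z) (hq : 1 ≤ q) (hqk : q * k₁ = k₁ + 3 * (Z + k₂) + Z ^ 2) (hu : 0 ≤ u)
    (hx₁ : 0 < x₁) (hx : x₁ ≤ x₂) (hw₁ : 0 < w₁) (hx1 : x₁ ≤ 1) (hx₁u : x₁ ≤ Z * u)
    (hx₂u : x₂ ≤ Z * u) (hw : q * w₁ ≤ w₂) (hp : 0 ≤ p) (hpl : k₁ * u ≤ p) (hpu : p ≤ k₂ * u)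
    (ha : 0 ≤ a) (hZu : Z ^ 3 * u ^ 2 ≤ k₁) :
    0 ≤ x₂ * (-3 - p * (3 - x₂ ^ 2 / 2 - w₂) / x₂ + a * w₂ / x₂ + (x₂ ^ 2 + γ * w₂) / 2)
      - q * (x₁ * (-3 - p * (3 - x₁ ^ 2 / 2 - w₁) / x₁ + a * w₁ / x₁
        + (x₁ ^ 2 + γ * w₁) / 2)) - q * k₁ * u := by
  have hx₂ : 0 < x₂ := hx₁.trans_le hx
  have hq0 : 0 ≤ q := by linarith
  have m2 : x₂ * (-3 - p * (3 - x₂ ^ 2 / 2 - w₂) / x₂ + a * w₂ / x₂ + (x₂ ^ 2 + γ * w₂) / 2)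
      = -3 * x₂ - 3 * p + p * x₂ ^ 2 / 2 + (p + a + γ * x₂ / 2) * w₂ + x₂ ^ 3 / 2 := by
    field_simp
    ring
  have m1 : x₁ * (-3 - p * (3 - x₁ ^ 2 / 2 - w₁) / x₁ + a * w₁ / x₁ + (x₁ ^ 2 + γ * w₁) / 2)
      = -3 * x₁ - 3 * p + p * x₁ ^ 2 / 2 + (p + a + γ * x₁ / 2) * w₁ + x₁ ^ 3 / 2 := by
    field_simp
    ring
  rw [m1, m2]
  have a1 : 0 ≤ p * x₂ ^ 2 / 2 := by positivity
  have a2 : 0 ≤ x₂ ^ 3 / 2 := by positivity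
  have a3 : (p + a + γ * x₁ / 2) * (q * w₁) ≤ (p + a + γ * x₂ / 2) * w₂ := by
    apply mul_le_mul _ hw (by positivity) (by positivity)
    gcongr
  have a4 : p * x₁ ^ 2 ≤ p := mul_le_of_le_one_right hp (pow_le_one₀ hx₁.le hx1)
  have a5 : x₁ ^ 3 ≤ k₁ * u := by
    have b1 : x₁ ^ 3 ≤ (Z * u) ^ 3 := pow_le_pow_left₀ hx₁.le hx₁u 3
    have b4 := mul_le_mul_of_nonneg_right hZu hu
    linarith
  have a6 : q * (-3 * x₁ - 3 * p + p * x₁ ^ 2 / 2 + (p + a + γ * x₁ / 2) * w₁ + x₁ ^ 3 / 2)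
      ≤ q * (-2 * (k₁ * u) + (p + a + γ * x₁ / 2) * w₁) := by
    apply mul_le_mul_of_nonneg_left _ hq0
    linarith
  have a7 : q * k₁ * u = (k₁ + 3 * (Z + k₂) + Z ^ 2) * u := by rw [hqk]
  have a8 : 0 ≤ k₁ * u := by
    refine mul_nonneg (le_trans (by positivity) hZu) hu
  have a9 : 0 ≤ Z ^ 2 * u := by positivity
  linarith

/-- Two climbing trajectories starting at the same field value cannot be strictly ordered: the
faster and denser one would have an unbounded relative excess of density, which would be incompatible
with both of them coming to rest at the maximum. -/
theorem IsClimbing.not_lt (hγ : 0 < γ) (hk₂ : 0 ≤ k₂) (hc : c < φm)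
    (hP : IsHyperbolic P α φm c k₁ k₂)
    (h₁ : IsClimbing γ P α φm c x₁ w₁) (h₂ : IsClimbing γ P α φm c x₂ w₂)
    (hx : x₁ c < x₂ c) (hw : w₁ c < w₂ c) : False := by
  obtain ⟨κ, hκ, hgap⟩ := h₁.exists_gap_growth hγ hk₂ hc hP h₂ hx hw
  set Z := 6 + k₂ with hZ
  have hk₁ := hP.pos
  have hZ0 : 0 < Z := by positivity
  obtain ⟨q, hq1, hqk⟩ : ∃ q, 1 ≤ q ∧ q * k₁ = k₁ + 3 * (Z + k₂) + Z ^ 2 := by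
    refine ⟨1 + (3 * (Z + k₂) + Z ^ 2) / k₁, ?_, by field_simp; ring⟩
    have : 0 ≤ (3 * (Z + k₂) + Z ^ 2) / k₁ := by positivity
    linarith
  have hq0 : 0 < q := by linarith
  have hu0 : Tendsto (fun s => φm - s) (𝓝[<] φm) (𝓝[>] 0) := by
    refine tendsto_nhdsWithin_iff.2 ⟨?_, ?_⟩
    · have h : Continuous fun s : ℝ => φm - s := by fun_prop
      have := h.tendsto φm
      rw [sub_self] at this
      exact this.mono_left nhdsWithin_le_nhds
    · filter_upwards [self_mem_nhdsWithin] with s hs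
      simpa using hs
  have hu0' := tendsto_nhds_of_tendsto_nhdsWithin hu0
  have ev1 : ∀ᶠ s in 𝓝[<] φm, Real.log (φm - s) < Real.log (φm - c) - Real.log q / κ :=
    (Real.tendsto_log_nhdsGT_zero.comp hu0).eventually_lt_atBot _
  have ev2 : ∀ᶠ s in 𝓝[<] φm, Z ^ 3 * (φm - s) ^ 2 < k₁ := by
    have := (hu0'.pow 2).const_mul (Z ^ 3)
    norm_num at this
    exact this.eventually (gt_mem_nhds hk₁)
  obtain ⟨s, ⟨hs1, hs2⟩, hs⟩ := ((ev1.and ev2).and (Ioo_mem_nhdsLT hc)).exists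
  have hord : ∀ t ∈ Ico s φm, q * x₁ t ≤ x₂ t ∧ q * w₁ t ≤ w₂ t := by
    intro t ht
    have ht' : t ∈ Ico c φm := ⟨hs.1.le.trans ht.1, ht.2⟩
    have hu : 0 < φm - t := by linarith [ht.2]
    have hl := Real.log_le_log hu (by linarith [ht.1] : φm - t ≤ φm - s)
    have h1 : Real.log q ≤ κ * (Real.log (φm - c) - Real.log (φm - t)) := by
      rw [← div_le_iff₀' hκ]
      linarith
    have p1 := h₁.posx t ht'
    have p2 := h₂.posx t ht'
    have p3 := h₁.posw t ht'
    have p4 := h₂.posw t ht'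
    obtain ⟨g1, g2⟩ := hgap t ht'
    constructor
    · rw [← Real.log_le_log_iff (by positivity) p2, Real.log_mul hq0.ne' p1.ne']
      linarith
    · rw [← Real.log_le_log_iff (by positivity) p4, Real.log_mul hq0.ne' p3.ne']
      linarith
  -- the density terms cancel in the derivative of `f`
  set f : ℝ → ℝ := fun t => x₂ t ^ 2 / 2 - q * (x₁ t ^ 2 / 2) + q * k₁ / 2 * (φm - t) ^ 2 with hf
  have hmono : ∀ b ∈ Ico s φm, f s ≤ f b := by
    intro b hb
    have hI : Icc s b ⊆ Ico c φm := fun t ht => ⟨hs.1.le.trans ht.1, ht.2.trans_lt hb.2⟩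
    have c1 := h₁.contx.mono hI
    have c2 := h₂.contx.mono hI
    refine le_of_deriv_le (f := fun _ => f s) (f' := fun _ => 0) (g := f) (a := s) (b := b)
      (g' := fun t => x₂ t * (-3 - P t * (3 - x₂ t ^ 2 / 2 - w₂ t) / x₂ t + α t * w₂ t / x₂ t
          + (x₂ t ^ 2 + γ * w₂ t) / 2)
        - q * (x₁ t * (-3 - P t * (3 - x₁ t ^ 2 / 2 - w₁ t) / x₁ t + α t * w₁ t / x₁ t
          + (x₁ t ^ 2 + γ * w₁ t) / 2)) - q * k₁ * (φm - t))
      continuousOn_const (by fun_prop) (fun _ _ => hasDerivAt_const _ _) ?_ ?_ le_rfl b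
      ⟨hb.1, le_rfl⟩
    · intro t ht
      have ht' : t ∈ Ioo c φm := ⟨hs.1.trans ht.1, ht.2.trans hb.2⟩
      have d1 := ((h₁.derivx t ht').pow 2).div_const 2
      have d2 := ((h₂.derivx t ht').pow 2).div_const 2
      have d3 := ((((hasDerivAt_id t).const_sub φm).pow 2).const_mul (q * k₁ / 2))
      refine ((d2.sub (d1.const_mul q)).add d3).congr_deriv ?_
      simp
      ring
    · intro t ht
      have ht' : t ∈ Ico c φm := hI ⟨ht.1.le, ht.2.le⟩
      have p1 := h₁.posx t ht'
      have p2 := h₂.posx t ht'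
      have p3 := h₁.posw t ht'
      have hP0 := hP.nonneg ht'
      have hPu := hP.upper t ht'
      have hPl := hP.lower t ht'
      have hα := hP.coupling t ht'
      have hu : 0 < φm - t := by linarith [ht'.2]
      have e1 := h₁.le_linear hγ.le hk₂ hP t ht'
      have e2 := h₂.le_linear hγ.le hk₂ hP t ht'
      obtain ⟨o1, o2⟩ := hord t ⟨ht.1.le, ht.2.trans hb.2⟩
      have o3 : x₁ t ≤ x₂ t := by nlinarith
      have b3 : Z ^ 3 * (φm - t) ^ 2 ≤ k₁ := by
        refine le_trans ?_ hs2.le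
        gcongr
        exact ht.1.le
      exact kinetic_gap_rate_nonneg hγ.le hZ0.le hq1 hqk hu.le p1 o3 p3 (h₁.lex t ht') e1 e2
        o2 hP0 hPl hPu hα b3
  have hlim : Tendsto f (𝓝[<] φm) (𝓝 0) := by
    have h := (((h₂.limx.pow 2).div_const 2).sub (((h₁.limx.pow 2).div_const 2).const_mul q)).add
      ((hu0'.pow 2).const_mul (q * k₁ / 2))
    norm_num at h
    exact h
  have hle : f s ≤ 0 := ge_of_tendsto hlim (by
    filter_upwards [Ioo_mem_nhdsLT hs.2] with b hb using hmono b ⟨hb.1.le, hb.2⟩)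
  have hsI : s ∈ Ico c φm := ⟨hs.1.le, hs.2⟩
  have p1 := h₁.posx s hsI
  have hu : 0 < φm - s := by linarith [hs.2]
  have e2 := h₂.le_linear hγ.le hk₂ hP s hsI
  have o1 := (hord s ⟨le_rfl, hs.2⟩).1
  have f1 : k₁ * (φm - s) ^ 2 ≤ x₁ s ^ 2 := by
    have h1 : q * (k₁ * (φm - s) ^ 2) ≤ q * x₁ s ^ 2 := by
      simp only [hf] at hle
      have := sq_nonneg (x₂ s)
      linarith
    exact le_of_mul_le_mul_left h1 hq0
  have f2 : (q * x₁ s) ^ 2 ≤ (Z * (φm - s)) ^ 2 :=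
    pow_le_pow_left₀ (by positivity) (o1.trans e2) 2
  have f3 : q ^ 2 * (k₁ * (φm - s) ^ 2) ≤ q ^ 2 * x₁ s ^ 2 := by gcongr
  have f4 : q * k₁ * (φm - s) ^ 2 ≤ q ^ 2 * k₁ * (φm - s) ^ 2 := by
    have : q ≤ q ^ 2 := by nlinarith
    gcongr
  have f5 : 0 < (k₁ + 3 * (Z + k₂)) * (φm - s) ^ 2 := by positivity
  rw [hqk] at f4
  linarith

end Climbing

/-! ### The climbing data form a null set -/

section ClimbingData

variable {γ φm c k₁ k₂ A B ξ : ℝ} {P α x w : ℝ → ℝ}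

theorem IsHyperbolic.mono (h : IsHyperbolic P α φm c k₁ k₂) {c' : ℝ} (hc : c ≤ c') :
    IsHyperbolic P α φm c' k₁ k₂ :=
  ⟨h.pos, fun s hs => h.lower s ⟨hc.trans hs.1, hs.2⟩, fun s hs => h.upper s ⟨hc.trans hs.1, hs.2⟩,
    fun s hs => h.coupling s ⟨hc.trans hs.1, hs.2⟩⟩

theorem IsClimbing.mono (h : IsClimbing γ P α φm c x w) {c' : ℝ} (hc : c ≤ c') :
    IsClimbing γ P α φm c' x w := by
  have h1 : Ico c' φm ⊆ Ico c φm := Ico_subset_Ico_left hc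
  have h2 : Ioo c' φm ⊆ Ioo c φm := Ioo_subset_Ioo_left hc
  exact ⟨h.contx.mono h1, h.contw.mono h1, fun s hs => h.posx s (h1 hs),
    fun s hs => h.posw s (h1 hs), fun s hs => h.lex s (h1 hs), fun s hs => h.lew s (h1 hs),
    fun s hs => h.derivx s (h2 hs), fun s hs => h.derivw s (h2 hs), h.limx, h.limw⟩

/-- A short-range Lipschitz bound for climbing trajectories, uniform as long as the initial `x` is
bounded away from `0`. -/
theorem IsClimbing.abs_sub_le (hγ₀ : 0 ≤ γ) (hγ₂ : γ ≤ 2) (hP : IsHyperbolic P α φm c k₁ k₂)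
    (hB : ∀ s ∈ Ico c φm, P s ≤ B) (hA : ∀ s ∈ Ico c φm, α s ≤ A)
    (h : IsClimbing γ P α φm c x w) (hξ : 0 < ξ) (hx : 2 * ξ ≤ x c) {b : ℝ} (hb : b ∈ Ico c φm)
    (hbc : (6 + 6 * B) * (b - c) ≤ 3 * ξ ^ 2) :
    |x b - x c| ≤ (5 + A + (3 * B + A + 6) / ξ) * (b - c) ∧
      |w b - w c| ≤ (5 + A + (3 * B + A + 6) / ξ) * (b - c) := by
  have hI : Icc c b ⊆ Ico c φm := fun t ht => ⟨ht.1, ht.2.trans_lt hb.2⟩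
  have hIo : ∀ t ∈ Ioo c b, t ∈ Ioo c φm := fun t ht => ⟨ht.1, ht.2.trans hb.2⟩
  have c1 := h.contx.mono hI
  have c2 := h.contw.mono hI
  have hB0 : 0 ≤ B := (hP.nonneg hb).trans (hB b hb)
  have hA0 : 0 ≤ A := (hP.coupling b hb).trans (hA b hb)
  have hlow : ∀ t ∈ Icc c b, ξ ≤ x t := by
    intro t ht
    have h1 := le_of_deriv_le (f := fun t => x c ^ 2 - (6 + 6 * B) * (t - c))
      (f' := fun _ => -(6 + 6 * B)) (g := fun t => x t ^ 2) (a := c) (b := b)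
      (g' := fun t => 2 * (x t * (-3 - P t * (3 - x t ^ 2 / 2 - w t) / x t + α t * w t / x t
        + (x t ^ 2 + γ * w t) / 2))) (by fun_prop) (c1.pow 2) ?_ ?_ ?_ (by simp) t ht
    · have h2 : (6 + 6 * B) * (t - c) ≤ (6 + 6 * B) * (b - c) := by
        have := ht.2
        gcongr
      have h3 : (2 * ξ) ^ 2 ≤ x c ^ 2 := pow_le_pow_left₀ (by positivity) hx 2
      have h4 : ξ ^ 2 ≤ x t ^ 2 := by linarith
      exact (sq_le_sq₀ hξ.le (h.posx t (hI ht)).le).1 h4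
    · intro t _
      have := (((hasDerivAt_id t).sub_const c).const_mul (6 + 6 * B)).const_sub (x c ^ 2)
      simpa using this
    · intro t ht
      exact ((h.derivx t (hIo t ht)).pow 2).congr_deriv (by simp; ring)
    · intro t ht
      have ht' := hI ⟨ht.1.le, ht.2.le⟩
      have p1 := h.posx t ht'
      have p2 := h.posw t ht'
      have p3 := h.lex t ht'
      have q1 := hP.nonneg ht'
      have q2 := hB t ht'
      have q3 := hP.coupling t ht'
      have m1 : x t * (-3 - P t * (3 - x t ^ 2 / 2 - w t) / x t + α t * w t / x t
          + (x t ^ 2 + γ * w t) / 2) = -3 * x t - 3 * P t + P t * x t ^ 2 / 2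
          + (P t + α t + γ * x t / 2) * w t + x t ^ 3 / 2 := by
        field_simp
        ring
      rw [m1]
      have a1 : 0 ≤ P t * x t ^ 2 / 2 := by positivity
      have a2 : 0 ≤ (P t + α t + γ * x t / 2) * w t := by positivity
      have a3 : 0 ≤ x t ^ 3 / 2 := by positivity
      linarith
  have hL : ∀ t ∈ Ioo c b, 1 / x t ≤ 1 / ξ := fun t ht =>
    one_div_le_one_div_of_le hξ (hlow t ⟨ht.1.le, ht.2.le⟩)
  have hg : ContinuousOn (fun t => (5 + A + (3 * B + A + 6) / ξ) * (t - c)) (Icc c b) := by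
    fun_prop
  have hg' : ∀ t ∈ Ioo c b, HasDerivAt (fun t => (5 + A + (3 * B + A + 6) / ξ) * (t - c))
      (5 + A + (3 * B + A + 6) / ξ) t := fun t _ => by
    simpa using ((hasDerivAt_id t).sub_const c).const_mul (5 + A + (3 * B + A + 6) / ξ)
  have hdiv : (3 * B + A + 6) / ξ = 3 * B * (1 / ξ) + A * (1 / ξ) + 6 * (1 / ξ) := by ring
  have hξ' : 0 < 1 / ξ := by positivity
  refine ⟨abs_le_of_abs_deriv_le (c1.sub continuousOn_const) hg
    (fun t ht => (h.derivx t (hIo t ht)).sub_const _) hg' ?_ (by simp) (by simp) b ⟨hb.1, le_rfl⟩,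
    abs_le_of_abs_deriv_le (c2.sub continuousOn_const) hg
    (fun t ht => (h.derivw t (hIo t ht)).sub_const _) hg' ?_ (by simp) (by simp) b ⟨hb.1, le_rfl⟩⟩
  all_goals
    intro t ht
    have ht' := hI ⟨ht.1.le, ht.2.le⟩
    have p1 := h.posx t ht'
    have p2 := h.posw t ht'
    have p3 := h.lex t ht'
    have p4 := h.lew t ht'
    have q1 := hP.nonneg ht'
    have q2 := hB t ht'
    have q3 := hP.coupling t ht'
    have q4 := hA t ht'
    have q5 := hL t ht
    have q6 : x t ^ 2 ≤ 1 := pow_le_one₀ p1.le p3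
    have q7 : 0 < 1 / x t := by positivity
    have q8 : 0 ≤ x t ^ 2 := by positivity
    have q9 : γ * w t ≤ 2 * 1 := mul_le_mul hγ₂ p4 p2.le (by norm_num)
    have q10 : 0 ≤ γ * w t := by positivity
    rw [hdiv, abs_le]
  · have e1 : P t * (3 - x t ^ 2 / 2 - w t) / x t = P t * (3 - x t ^ 2 / 2 - w t) * (1 / x t) := by
      ring
    have e2 : α t * w t / x t = α t * w t * (1 / x t) := by ring
    have s1 : 0 ≤ 3 - x t ^ 2 / 2 - w t := by linarith
    have b1 : P t * (3 - x t ^ 2 / 2 - w t) * (1 / x t) ≤ B * 3 * (1 / ξ) := by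
      gcongr
      linarith
    have b2 : 0 ≤ P t * (3 - x t ^ 2 / 2 - w t) * (1 / x t) := by positivity
    have b3 : α t * w t * (1 / x t) ≤ A * 1 * (1 / ξ) := by gcongr
    have b4 : 0 ≤ α t * w t * (1 / x t) := by positivity
    rw [e1, e2]
    have b5 : 0 ≤ B * (1 / ξ) := by positivity
    have b6 : 0 ≤ A * (1 / ξ) := by positivity
    constructor <;> linarith
  · have e1 : w t * (γ * (w t - 3) / x t + x t - α t)
        = -(γ * w t * (3 - w t) * (1 / x t)) + w t * x t - w t * α t := by ring
    have s1 : 0 ≤ 3 - w t := by linarith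
    have b1 : γ * w t * (3 - w t) * (1 / x t) ≤ 2 * 1 * 3 * (1 / ξ) := by
      gcongr
      linarith
    have b2 : 0 ≤ γ * w t * (3 - w t) * (1 / x t) := by positivity
    have b3 : w t * x t ≤ 1 * 1 := by gcongr
    have b4 : w t * α t ≤ 1 * A := by gcongr
    have b5 : 0 ≤ w t * x t := by positivity
    have b6 : 0 ≤ w t * α t := by positivity
    have b7 : 0 ≤ B * (1 / ξ) := by positivity
    have b8 : 0 ≤ A * (1 / ξ) := by positivity
    rw [e1]
    constructor <;> linarith

/-- The points `(φ, x, w)` from which some climbing trajectory starts. -/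
def climbingData (γ : ℝ) (P α : ℝ → ℝ) (φm c : ℝ) : Set (ℝ × ℝ × ℝ) :=
  {p | p.1 ∈ Ico c φm ∧ ∃ x w : ℝ → ℝ, IsClimbing γ P α φm p.1 x w ∧ x p.1 = p.2.1 ∧ w p.1 = p.2.2}

/-- Two climbing data with nearby field values cannot be ordered by a substantial amount. -/
theorem not_lt_of_mem_climbingData (hγ₀ : 0 < γ) (hγ₂ : γ ≤ 2) (hk₂ : 0 ≤ k₂)
    (hP : IsHyperbolic P α φm c k₁ k₂) (hB : ∀ s ∈ Ico c φm, P s ≤ B)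
    (hA : ∀ s ∈ Ico c φm, α s ≤ A) (hξ : 0 < ξ) {p q : ℝ × ℝ × ℝ}
    (hp : p ∈ climbingData γ P α φm c) (hq : q ∈ climbingData γ P α φm c)
    (hpξ : 2 * ξ ≤ p.2.1) (hqξ : 2 * ξ ≤ q.2.1) {η s : ℝ} (hpq : |p.1 - q.1| ≤ 2 * η)
    (hη : (6 + 6 * B) * (2 * η) ≤ 3 * ξ ^ 2)
    (hs : (5 + A + (3 * B + A + 6) / ξ) * (2 * η) + 2 * η < s) :
    ¬ (p.2.1 + s ≤ q.2.1 + 2 * η ∧ p.2.2 + s ≤ q.2.2 + 2 * η) := by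
  rintro ⟨hx, hw⟩
  obtain ⟨hpI, x₁, w₁, h₁, e1, e2⟩ := hp
  obtain ⟨hqI, x₂, w₂, h₂, e3, e4⟩ := hq
  have hB0 : 0 ≤ B := (hP.nonneg hpI).trans (hB _ hpI)
  have hA0 : 0 ≤ A := (hP.coupling _ hpI).trans (hA _ hpI)
  have hL : 0 ≤ 5 + A + (3 * B + A + 6) / ξ := by positivity
  rw [abs_le] at hpq
  rcases le_total p.1 q.1 with hle | hle
  · have hsub : Ico p.1 φm ⊆ Ico c φm := Ico_subset_Ico_left hpI.1
    have hd : q.1 - p.1 ≤ 2 * η := by linarith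
    obtain ⟨g1, g2⟩ := h₁.abs_sub_le hγ₀.le hγ₂ (hP.mono hpI.1) (fun s hs => hB s (hsub hs))
      (fun s hs => hA s (hsub hs)) hξ (by rw [e1]; exact hpξ) (b := q.1) ⟨hle, hqI.2⟩
      (le_trans (mul_le_mul_of_nonneg_left hd (by positivity)) hη)
    have hd' := mul_le_mul_of_nonneg_left hd hL
    rw [abs_le] at g1 g2
    exact (h₁.mono hle).not_lt hγ₀ hk₂ hqI.2 (hP.mono hqI.1) h₂ (by linarith) (by linarith)
  · have hsub : Ico q.1 φm ⊆ Ico c φm := Ico_subset_Ico_left hqI.1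
    have hd : p.1 - q.1 ≤ 2 * η := by linarith
    obtain ⟨g1, g2⟩ := h₂.abs_sub_le hγ₀.le hγ₂ (hP.mono hqI.1) (fun s hs => hB s (hsub hs))
      (fun s hs => hA s (hsub hs)) hξ (by rw [e3]; exact hqξ) (b := p.1) ⟨hle, hpI.2⟩
      (le_trans (mul_le_mul_of_nonneg_left hd (by positivity)) hη)
    have hd' := mul_le_mul_of_nonneg_left hd hL
    rw [abs_le] at g1 g2
    exact h₁.not_lt hγ₀ hk₂ hpI.2 (hP.mono hpI.1) (h₂.mono hle) (by linarith) (by linarith)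

theorem isAddHaarMeasure_volume_triple : (volume : Measure (ℝ × ℝ × ℝ)).IsAddHaarMeasure := by
  have h : (volume : Measure (ℝ × ℝ)).IsAddHaarMeasure := by
    rw [Measure.volume_eq_prod]
    infer_instance
  rw [Measure.volume_eq_prod]
  infer_instance

/-- The climbing data form a null set: the closure of a piece of it contains no two points
differing by a positive multiple of `(0, 1, 1)`, so that Steinhaus' theorem applies. -/
theorem volume_climbingData (hγ₀ : 0 < γ) (hγ₂ : γ ≤ 2) (hk₂ : 0 ≤ k₂)
    (hP : IsHyperbolic P α φm c k₁ k₂) (hA : ∀ s ∈ Ico c φm, α s ≤ A) :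
    volume (climbingData γ P α φm c) = 0 := by
  refine measure_null_of_locally_null _ fun p₀ hp₀ => ?_
  have hξ₀ : 0 < p₀.2.1 := by
    obtain ⟨hI, x, w, h, e1, -⟩ := hp₀
    rw [← e1]
    exact h.posx _ ⟨le_rfl, hI.2⟩
  set ξ := p₀.2.1 / 4 with hξ
  have hξ0 : 0 < ξ := by positivity
  set K := climbingData γ P α φm c ∩ {q | 2 * ξ < q.2.1} with hK
  refine ⟨K, inter_mem self_mem_nhdsWithin (mem_nhdsWithin_of_mem_nhds ?_), ?_⟩
  · exact (isOpen_lt continuous_const (by fun_prop)).mem_nhds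
      (show 2 * ξ < p₀.2.1 by rw [hξ]; linarith)
  have hcm : c < φm := hp₀.1.1.trans_lt hp₀.1.2
  set B := k₂ * (φm - c) with hBdef
  have hB : ∀ s ∈ Ico c φm, P s ≤ B := fun s hs => (hP.upper s hs).trans (by
    rw [hBdef]
    have := hs.1
    gcongr)
  have hB0 : 0 ≤ B := mul_nonneg hk₂ (by linarith)
  have hA0 : 0 ≤ A := (hP.coupling c ⟨le_rfl, hcm⟩).trans (hA c ⟨le_rfl, hcm⟩)
  by_contra hne
  have hpos : 0 < volume (closure K) :=
    (pos_iff_ne_zero.2 hne).trans_le (measure_mono subset_closure)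
  have := isAddHaarMeasure_volume_triple
  have hst := Measure.sub_mem_nhds_zero_of_addHaar_pos volume (closure K)
    isClosed_closure.measurableSet hpos
  have hline : Tendsto (fun s : ℝ => ((0, s, s) : ℝ × ℝ × ℝ)) (𝓝[>] 0) (𝓝 0) := by
    have : Continuous fun s : ℝ => ((0, s, s) : ℝ × ℝ × ℝ) := by fun_prop
    exact (this.tendsto 0).mono_left nhdsWithin_le_nhds
  obtain ⟨s, hs, hs0⟩ := ((hline.eventually hst).and self_mem_nhdsWithin).exists
  replace hs0 : 0 < s := hs0
  obtain ⟨a, ha, b, hb, hab⟩ := hs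
  set L := 5 + A + (3 * B + A + 6) / ξ with hL
  have hL0 : 0 ≤ L := by positivity
  obtain ⟨η, hη0, hη1, hη2⟩ : ∃ η > 0, (6 + 6 * B) * (2 * η) ≤ 3 * ξ ^ 2 ∧
      L * (2 * η) + 2 * η < s := by
    have t1 : Tendsto (fun η : ℝ => (6 + 6 * B) * (2 * η)) (𝓝[>] 0) (𝓝 0) := by
      have : Continuous fun η : ℝ => (6 + 6 * B) * (2 * η) := by fun_prop
      simpa using (this.tendsto 0).mono_left nhdsWithin_le_nhds
    have t2 : Tendsto (fun η : ℝ => L * (2 * η) + 2 * η) (𝓝[>] 0) (𝓝 0) := by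
      have : Continuous fun η : ℝ => L * (2 * η) + 2 * η := by fun_prop
      simpa using (this.tendsto 0).mono_left nhdsWithin_le_nhds
    obtain ⟨η, ⟨h1, h2⟩, h3⟩ := (((t1.eventually (gt_mem_nhds (by positivity : 0 < 3 * ξ ^ 2))).and
      (t2.eventually (gt_mem_nhds hs0))).and self_mem_nhdsWithin).exists
    exact ⟨η, h3, h1.le, h2⟩
  obtain ⟨a', ha', hda⟩ := Metric.mem_closure_iff.1 ha η hη0
  obtain ⟨b', hb', hdb⟩ := Metric.mem_closure_iff.1 hb η hη0
  simp only [Prod.dist_eq, Real.dist_eq, max_lt_iff, abs_lt] at hda hdb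
  obtain ⟨⟨a1, a2⟩, ⟨a3, a4⟩, a5, a6⟩ := hda
  obtain ⟨⟨b1, b2⟩, ⟨b3, b4⟩, b5, b6⟩ := hdb
  have e1 : a.1 - b.1 = 0 := congrArg Prod.fst hab
  have e2 : a.2.1 - b.2.1 = s := congrArg (fun z => z.2.1) hab
  have e3 : a.2.2 - b.2.2 = s := congrArg (fun z => z.2.2) hab
  refine not_lt_of_mem_climbingData hγ₀ hγ₂ hk₂ hP hB hA hξ0 hb'.1 ha'.1 hb'.2.le ha'.2.le
    (η := η) (s := s) (abs_le.2 ⟨by linarith, by linarith⟩) hη1 hη2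
    ⟨by linarith, by linarith⟩

end ClimbingData

/-! ### Trajectories climbing to the saddle, for a nonnegative coupling -/

/-- A trajectory of the vector field `v` on the time interval `[0, ∞)`. -/
def IsGlobalTraj {E : Type*} [NormedAddCommGroup E] [NormedSpace ℝ E] (v : E → E) (X : ℝ → E) :
    Prop := ∀ s, IsTraj v s X

section GlobalTraj

variable {E : Type*} [NormedAddCommGroup E] [NormedSpace ℝ E] {v : E → E} {X : ℝ → E}

theorem IsGlobalTraj.hasDerivAt (h : IsGlobalTraj v X) {t : ℝ} (ht : 0 < t) :
    HasDerivAt X (v (X t)) t :=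
  (h (t + 1)).2 t ⟨ht, by linarith⟩

theorem IsGlobalTraj.continuousOn (h : IsGlobalTraj v X) : ContinuousOn X (Ici 0) := by
  intro t ht
  have h1 := (h (t + 1)).1 t ⟨ht, by linarith⟩
  refine h1.mono_of_mem_nhdsWithin ?_
  rw [← Ici_inter_Iic]
  exact inter_mem self_mem_nhdsWithin (mem_nhdsWithin_of_mem_nhds (Iic_mem_nhds (by linarith)))

theorem IsGlobalTraj.shift (h : IsGlobalTraj v X) {a : ℝ} (ha : 0 ≤ a) :
    IsGlobalTraj v (fun t => X (a + t)) := by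
  intro s
  have := (h (s + a)).shift ha
  rwa [add_sub_cancel_right] at this

end GlobalTraj

section Cosmo

variable {γ : ℝ} {V α : ℝ → ℝ} {X : ℝ → ℝ × ℝ × ℝ} {t : ℝ}

/-- The continuity equation of the fluid. -/
theorem hasDerivAt_fluidDensity (hV : ContDiff ℝ 1 V) (h : HasDerivAt X (cosmoField γ V α (X t)) t) :
    HasDerivAt (fun t => fluidDensity V (X t))
      (-fluidDensity V (X t) * (3 * γ * (X t).2.2 + α (X t).1 * (X t).2.1)) t := by
  obtain ⟨h1, h2, h3⟩ := hasDerivAt_triple_iff.1 h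
  have hVd : HasDerivAt V (deriv V (X t).1) (X t).1 :=
    (hV.differentiable one_ne_zero _).hasDerivAt
  have h4 := hVd.comp t h1
  refine ((((h3.pow 2).const_mul 3).sub ((h2.pow 2).div_const 2)).sub h4).congr_deriv ?_
  simp only [fieldAccel, hubbleRate, fluidDensity]
  norm_num
  ring

/-- The data of the trajectories converging to the saddle point with `φ' > 0` throughout, and
staying in the region where the expansion-normalized variables are at most `1`. -/
def climbingSet (γ : ℝ) (V α : ℝ → ℝ) (φm c Hs : ℝ) : Set (ℝ × ℝ × ℝ) :=
  {p | ∃ X, IsGlobalTraj (cosmoField γ V α) X ∧ X 0 = p ∧ (∀ t ≥ 0, (X t).1 ∈ Ico c φm ∧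
    0 < (X t).2.1 ∧ (X t).2.1 ≤ (X t).2.2 ∧ 0 < fluidDensity V (X t) ∧
    fluidDensity V (X t) ≤ (X t).2.2 ^ 2) ∧ Tendsto X atTop (𝓝 (φm, 0, Hs))}

theorem climbing_of_mem_climbingSet (hV : ContDiff ℝ 1 V) {φm c Hs : ℝ} (hHs : 0 < Hs)
    (hsaddle : 3 * Hs ^ 2 = V φm) (hVpos : ∀ s ∈ Ico c φm, 0 < V s) {p : ℝ × ℝ × ℝ}
    (hp : p ∈ climbingSet γ V α φm c Hs) :
    (p.1, p.2.1 / p.2.2, fluidDensity V p / p.2.2 ^ 2) ∈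
      climbingData γ (fun s => deriv V s / V s) α φm c := by
  obtain ⟨X, hX, hX0, hreg, hlim⟩ := hp
  have hHpos : ∀ t ≥ 0, 0 < (X t).2.2 := fun t ht => (hreg t ht).2.1.trans_le (hreg t ht).2.2.1
  set f : ℝ → ℝ := fun t => (X t).1 with hf
  have hfc : ContinuousOn f (Ici 0) := continuous_fst.comp_continuousOn hX.continuousOn
  have hfd : ∀ t > 0, HasDerivAt f (X t).2.1 t := fun t ht =>
    (hasDerivAt_triple_iff.1 (hX.hasDerivAt ht)).1
  have hmono : StrictMonoOn f (Ici 0) := by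
    refine strictMonoOn_of_deriv_pos (convex_Ici 0) hfc fun t ht => ?_
    rw [interior_Ici] at ht
    rw [(hfd t ht).deriv]
    exact (hreg t (le_of_lt ht)).2.1
  have hflim : Tendsto f atTop (𝓝 φm) := (continuous_fst.tendsto _).comp hlim
  have him : Ico p.1 φm ⊆ f '' Ici 0 := by
    intro σ hσ
    obtain ⟨T, hT, hT0⟩ := ((hflim.eventually (lt_mem_nhds hσ.2)).and (eventually_ge_atTop 0)).exists
    have h0 : f 0 = p.1 := by rw [← hX0]
    have := intermediate_value_Icc hT0 (hfc.mono Icc_subset_Ici_self) ⟨h0.trans_le hσ.1, hT.le⟩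
    exact image_mono Icc_subset_Ici_self this
  set τ := Function.invFunOn f (Ici 0) with hτ
  have hτ0 : ∀ σ ∈ Ico p.1 φm, 0 ≤ τ σ := fun σ hσ => Function.invFunOn_mem (him hσ)
  have hτf : ∀ σ ∈ Ico p.1 φm, (X (τ σ)).1 = σ := fun σ hσ => Function.invFunOn_eq (him hσ)
  have hτinv : ∀ t ≥ 0, τ (f t) = t := fun t ht => hmono.injOn.leftInvOn_invFunOn ht
  have hτp : τ p.1 = 0 := by
    have := hτinv 0 le_rfl
    simp only [hf, hX0] at this
    exact this
  have hτpos : ∀ σ ∈ Ioo p.1 φm, 0 < τ σ := by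
    intro σ hσ
    refine lt_of_le_of_ne (hτ0 σ ⟨hσ.1.le, hσ.2⟩) fun h => ?_
    have h1 := hτf σ ⟨hσ.1.le, hσ.2⟩
    rw [← h, hX0] at h1
    exact hσ.1.ne h1
  have hτc : ContinuousOn τ (Ico p.1 φm) := (continuousOn_invFunOn ordConnected_Ici hmono).mono him
  have hXτ : ContinuousOn (fun σ => X (τ σ)) (Ico p.1 φm) := hX.continuousOn.comp hτc hτ0
  have hτd : ∀ σ ∈ Ioo p.1 φm, HasDerivAt τ ((X (τ σ)).2.1)⁻¹ σ := by
    intro σ hσ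
    have h1 := hasDerivAt_invFunOn ordConnected_Ici hfc hmono (Ici_mem_nhds (hτpos σ hσ))
      (hfd _ (hτpos σ hσ)) (hreg _ (hτ0 σ ⟨hσ.1.le, hσ.2⟩)).2.1.ne'
    have h2 : f (τ σ) = σ := hτf σ ⟨hσ.1.le, hσ.2⟩
    rwa [h2] at h1
  have hτlim : Tendsto τ (𝓝[<] φm) atTop := by
    refine tendsto_atTop.2 fun T => ?_
    have hT0 : (0 : ℝ) ≤ max T 0 := le_max_right _ _
    have h1 : f (max T 0) < φm := (hreg _ hT0).1.2
    have h0 : p.1 ≤ f (max T 0) := by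
      have : f 0 = p.1 := by rw [← hX0]
      rw [← this]
      exact hmono.monotoneOn (mem_Ici.2 le_rfl) hT0 hT0
    filter_upwards [Ioo_mem_nhdsLT h1] with σ hσ
    have hσI : σ ∈ Ico p.1 φm := ⟨h0.trans hσ.1.le, hσ.2⟩
    have h2 : f (τ σ) = σ := hτf σ hσI
    by_contra h3
    push Not at h3
    have h4 := hmono.monotoneOn (hτ0 σ hσI) hT0 (h3.le.trans (le_max_left _ _))
    linarith [hσ.1]
  have hXlim := hlim.comp hτlim
  have hyl : Tendsto (fun σ => (X (τ σ)).2.1) (𝓝[<] φm) (𝓝 0) :=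
    ((by fun_prop : Continuous fun z : ℝ × ℝ × ℝ => z.2.1).tendsto _).comp hXlim
  have hHl : Tendsto (fun σ => (X (τ σ)).2.2) (𝓝[<] φm) (𝓝 Hs) :=
    ((by fun_prop : Continuous fun z : ℝ × ℝ × ℝ => z.2.2).tendsto _).comp hXlim
  have hρl : Tendsto (fun σ => fluidDensity V (X (τ σ))) (𝓝[<] φm) (𝓝 0) := by
    have h1 := ((continuous_fluidDensity hV).tendsto _).comp hXlim
    have h2 : fluidDensity V (φm, 0, Hs) = 0 := by
      simp only [fluidDensity]
      linarith
    rwa [h2] at h1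
  have c1 : ContinuousOn (fun σ => (X (τ σ)).2.1) (Ico p.1 φm) :=
    (by fun_prop : Continuous fun z : ℝ × ℝ × ℝ => z.2.1).comp_continuousOn hXτ
  have c2 : ContinuousOn (fun σ => (X (τ σ)).2.2) (Ico p.1 φm) :=
    (by fun_prop : Continuous fun z : ℝ × ℝ × ℝ => z.2.2).comp_continuousOn hXτ
  have c3 : ContinuousOn (fun σ => fluidDensity V (X (τ σ))) (Ico p.1 φm) :=
    (continuous_fluidDensity hV).comp_continuousOn hXτ
  have hregτ := fun σ (hσ : σ ∈ Ico p.1 φm) => hreg (τ σ) (hτ0 σ hσ)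
  have hHτ := fun σ (hσ : σ ∈ Ico p.1 φm) => hHpos (τ σ) (hτ0 σ hσ)
  have hp1 : p.1 ∈ Ico c φm := by
    have := (hreg 0 le_rfl).1
    rwa [hX0] at this
  refine ⟨hp1, fun σ => (X (τ σ)).2.1 / (X (τ σ)).2.2,
    fun σ => fluidDensity V (X (τ σ)) / (X (τ σ)).2.2 ^ 2,
    ⟨c1.div c2 fun σ hσ => (hHτ σ hσ).ne', c3.div (c2.pow 2) fun σ hσ => (pow_pos (hHτ σ hσ) 2).ne',
    fun σ hσ => div_pos (hregτ σ hσ).2.1 (hHτ σ hσ),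
    fun σ hσ => div_pos (hregτ σ hσ).2.2.2.1 (pow_pos (hHτ σ hσ) 2),
    fun σ hσ => (div_le_one (hHτ σ hσ)).2 (hregτ σ hσ).2.2.1,
    fun σ hσ => (div_le_one (pow_pos (hHτ σ hσ) 2)).2 (hregτ σ hσ).2.2.2.2, ?_, ?_, ?_, ?_⟩, ?_, ?_⟩
  · intro σ hσ
    have hσ' : σ ∈ Ico p.1 φm := ⟨hσ.1.le, hσ.2⟩
    obtain ⟨-, h2, h3⟩ := hasDerivAt_triple_iff.1 (hX.hasDerivAt (hτpos σ hσ))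
    have h4 := (h2.comp σ (hτd σ hσ)).div (h3.comp σ (hτd σ hσ)) (hHτ σ hσ').ne'
    refine h4.congr_deriv ?_
    have hy := (hregτ σ hσ').2.1.ne'
    have hH := (hHτ σ hσ').ne'
    have hVσ : V σ ≠ 0 := (hVpos σ ⟨hp1.1.trans hσ.1.le, hσ.2⟩).ne'
    have hVe : V σ = 3 * (X (τ σ)).2.2 ^ 2 - (X (τ σ)).2.1 ^ 2 / 2 - fluidDensity V (X (τ σ)) := by
      simp only [fluidDensity, hτf σ hσ']
      ring
    have e1 : 3 - ((X (τ σ)).2.1 / (X (τ σ)).2.2) ^ 2 / 2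
        - fluidDensity V (X (τ σ)) / (X (τ σ)).2.2 ^ 2 = V σ / (X (τ σ)).2.2 ^ 2 := by
      rw [hVe]
      field_simp
    rw [e1]
    simp only [Function.comp, fieldAccel, hubbleRate, hτf σ hσ']
    field_simp
    ring
  · intro σ hσ
    have hσ' : σ ∈ Ico p.1 φm := ⟨hσ.1.le, hσ.2⟩
    have h2 := hasDerivAt_fluidDensity hV (hX.hasDerivAt (hτpos σ hσ))
    obtain ⟨-, -, h3⟩ := hasDerivAt_triple_iff.1 (hX.hasDerivAt (hτpos σ hσ))
    have h4 := (h2.comp σ (hτd σ hσ)).div ((h3.comp σ (hτd σ hσ)).pow 2)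
      (pow_pos (hHτ σ hσ') 2).ne'
    refine h4.congr_deriv ?_
    have hy := (hregτ σ hσ').2.1.ne'
    have hH := (hHτ σ hσ').ne'
    simp only [Function.comp, Pi.pow_apply, hubbleRate, hτf σ hσ']
    field_simp
    ring
  · have := hyl.div hHl hHs.ne'
    rwa [zero_div] at this
  · have := hρl.div (hHl.pow 2) (pow_pos hHs 2).ne'
    rwa [zero_div] at this
  · simp only [hτp, hX0]
  · simp only [hτp, hX0]

/-- The climbing set is null. -/
theorem volume_climbingSet (hγ₀ : 0 < γ) (hγ₂ : γ ≤ 2) (hV : ContDiff ℝ 1 V) {A : ℝ}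
    (hA : ∀ x, |α x| ≤ A) {φm c Hs k₁ k₂ : ℝ} (hk₂ : 0 ≤ k₂) (hHs : 0 < Hs)
    (hsaddle : 3 * Hs ^ 2 = V φm) (hVpos : ∀ s ∈ Ico c φm, 0 < V s)
    (hP : IsHyperbolic (fun s => deriv V s / V s) α φm c k₁ k₂) :
    volume (climbingSet γ V α φm c Hs) = 0 := by
  have h0 := volume_climbingData hγ₀ hγ₂ hk₂ hP (A := A) (fun s _ => (le_abs_self _).trans (hA s))
  set h : ℝ × ℝ × ℝ → ℝ := fun q => Real.sqrt (V q.1 / (3 - q.2.1 ^ 2 / 2 - q.2.2)) with hh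
  set Θ : ℝ × ℝ × ℝ → ℝ × ℝ × ℝ := fun q => (q.1, q.2.1 * h q, h q) with hΘ
  have hden : ∀ q ∈ climbingData γ (fun s => deriv V s / V s) α φm c,
      0 < 3 - q.2.1 ^ 2 / 2 - q.2.2 := by
    rintro q ⟨hI, x, w, hc, e1, e2⟩
    have hm : q.1 ∈ Ico q.1 φm := ⟨le_rfl, hI.2⟩
    have p1 := hc.posx _ hm
    have p2 := hc.lex _ hm
    have p3 := hc.lew _ hm
    rw [e1] at p1 p2
    rw [e2] at p3
    have := pow_le_one₀ (n := 2) p1.le p2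
    linarith
  have hdiff : DifferentiableOn ℝ Θ (climbingData γ (fun s => deriv V s / V s) α φm c) := by
    intro q hq
    have d1 : DifferentiableAt ℝ (fun q : ℝ × ℝ × ℝ => V q.1) q :=
      (hV.differentiable one_ne_zero q.1).comp q differentiableAt_fst
    have d2 : DifferentiableAt ℝ (fun q : ℝ × ℝ × ℝ => 3 - q.2.1 ^ 2 / 2 - q.2.2) q := by fun_prop
    have d3 : DifferentiableAt ℝ
        (fun q : ℝ × ℝ × ℝ => V q.1 / (3 - q.2.1 ^ 2 / 2 - q.2.2)) q := by
      simp only [div_eq_mul_inv (V _)]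
      exact d1.mul ((differentiableAt_inv (hden q hq).ne').comp q d2)
    have d3' : DifferentiableAt ℝ h q := d3.sqrt (div_pos (hVpos _ hq.1) (hden q hq)).ne'
    have d4 : DifferentiableAt ℝ Θ q := by
      rw [hΘ]
      fun_prop
    exact d4.differentiableWithinAt
  have := isAddHaarMeasure_volume_triple
  refine measure_mono_null ?_
    (addHaar_image_eq_zero_of_differentiableOn_of_addHaar_eq_zero volume hdiff h0)
  intro p hp
  have hq := climbing_of_mem_climbingSet hV hHs hsaddle hVpos hp
  refine ⟨_, hq, ?_⟩
  have hH : 0 < p.2.2 := by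
    obtain ⟨X, -, rfl, hreg, -⟩ := hp
    exact (hreg 0 le_rfl).2.1.trans_le (hreg 0 le_rfl).2.2.1
  have hd := hden _ hq
  have e1 : h (p.1, p.2.1 / p.2.2, fluidDensity V p / p.2.2 ^ 2) = p.2.2 := by
    simp only [hh] at hd ⊢
    have e2 : V p.1 / (3 - (p.2.1 / p.2.2) ^ 2 / 2 - fluidDensity V p / p.2.2 ^ 2) = p.2.2 ^ 2 := by
      rw [div_eq_iff hd.ne']
      simp only [fluidDensity]
      field_simp
      ring
    rw [e2, Real.sqrt_sq hH.le]
  simp only [hΘ, e1]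
  ext
  · rfl
  · exact div_mul_cancel₀ _ hH.ne'
  · rfl

end Cosmo

/-! ### Trajectories converging to the saddle, for a nonnegative coupling -/

/-- The data of the trajectories which converge to the saddle point `(φm, 0, Hs)` from the left. -/
def saddleSet (γ : ℝ) (V α : ℝ → ℝ) (φm Hs : ℝ) : Set (ℝ × ℝ × ℝ) :=
  {p | ∃ X, IsGlobalTraj (cosmoField γ V α) X ∧ X 0 = p ∧ (∀ t ≥ 0, (X t).1 < φm ∧
    0 < fluidDensity V (X t) ∧ Hs ≤ (X t).2.2) ∧ Tendsto X atTop (𝓝 (φm, 0, Hs))}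

section Saddle

variable {γ φm Hs : ℝ} {V α : ℝ → ℝ} {X : ℝ → ℝ × ℝ × ℝ}

/-- Near a nondegenerate maximum with positive value, `V'/V` is comparable to the distance. -/
theorem exists_isHyperbolic (hV : ContDiff ℝ 1 V) (hcrit : deriv V φm = 0) (hpos : 0 < V φm)
    {v : ℝ} (hv : v < 0) (hv' : HasDerivAt (deriv V) v φm) (hα : ∀ x, 0 ≤ α x) :
    ∃ c < φm, ∃ k₁ k₂, 0 ≤ k₂ ∧ (∀ s ∈ Ico c φm, 0 < V s) ∧
      IsHyperbolic (fun s => deriv V s / V s) α φm c k₁ k₂ := by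
  have h1 : Tendsto (fun s => slope (deriv V) φm s) (𝓝[<] φm) (𝓝 v) :=
    (hasDerivAt_iff_tendsto_slope.1 hv').mono_left
      (nhdsWithin_mono _ fun x hx => ne_of_lt hx)
  have h2 : Tendsto V (𝓝[<] φm) (𝓝 (V φm)) := hV.continuous.continuousAt.mono_left nhdsWithin_le_nhds
  have hev := ((h1.eventually (lt_mem_nhds (by linarith : 2 * v < v))).and
    (h1.eventually (gt_mem_nhds (by linarith : v < v / 2)))).and
    ((h2.eventually (lt_mem_nhds (by linarith : V φm / 2 < V φm))).and
    (h2.eventually (gt_mem_nhds (by linarith : V φm < 2 * V φm))))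
  obtain ⟨l, hl, hsub⟩ := mem_nhdsLT_iff_exists_Ioo_subset.1 hev
  have hl' : l < φm := hl
  have key : ∀ s ∈ Ico ((l + φm) / 2) φm, -v / 2 * (φm - s) ≤ deriv V s ∧
      deriv V s ≤ -2 * v * (φm - s) ∧ V φm / 2 < V s ∧ V s < 2 * V φm := by
    intro s hs
    obtain ⟨⟨g1, g2⟩, g3, g4⟩ := hsub ⟨by linarith [hs.1], hs.2⟩
    have hu : 0 < φm - s := by linarith [hs.2]
    have e1 : slope (deriv V) φm s = -(deriv V s / (φm - s)) := by
      rw [slope_def_field, hcrit, sub_zero, ← neg_sub φm s, div_neg]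
    rw [e1] at g1 g2
    refine ⟨?_, ?_, g3, g4⟩
    · rw [← le_div_iff₀ hu]
      linarith
    · rw [← div_le_iff₀ hu]
      linarith
  refine ⟨(l + φm) / 2, by linarith, -v / 2 / (2 * V φm), -2 * v / (V φm / 2), ?_, ?_,
    ⟨?_, ?_, ?_, fun s _ => hα s⟩⟩
  · exact div_nonneg (by linarith) (by linarith)
  · exact fun s hs => by linarith [(key s hs).2.2.1]
  · exact div_pos (by linarith) (by linarith)
  · intro s hs
    obtain ⟨g1, g2, g3, g4⟩ := key s hs
    have hu : 0 < φm - s := by linarith [hs.2]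
    rw [div_mul_eq_mul_div]
    have : 0 ≤ -v / 2 * (φm - s) := mul_nonneg (by linarith) hu.le
    exact div_le_div₀ (this.trans g1) g1 (by linarith) g4.le
  · intro s hs
    obtain ⟨g1, g2, g3, g4⟩ := key s hs
    have hu : 0 < φm - s := by linarith [hs.2]
    rw [div_mul_eq_mul_div]
    exact div_le_div₀ (mul_nonneg (by linarith) hu.le) g2 (by linarith) g3.le

/-- With a nonnegative coupling, a field which has turned to the left cannot return to the turning
point: the energy `y²/2 + V + ρ b(φ)`, where `b` vanishes at the turning point, decreases. -/
theorem field_lt_of_turn (hγ : 0 < γ) (hV : ContDiff ℝ 1 V) (hαc : Continuous α)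
    (hα : ∀ x, 0 ≤ α x) (hX : IsGlobalTraj (cosmoField γ V α) X)
    (hρ : ∀ t ≥ 0, 0 < fluidDensity V (X t)) (hH : ∀ t ≥ 0, 0 < (X t).2.2) {t₀ t₃ : ℝ}
    (h0 : 0 ≤ t₀) (h03 : t₀ < t₃) (hy0 : (X t₀).2.1 = 0) (hy : ∀ t ∈ Ioc t₀ t₃, (X t).2.1 < 0) :
    ∀ t ≥ t₃, (X t).1 < (X t₀).1 := by
  have hc1 : ContinuousOn (fun t => (X t).1) (Ici 0) :=
    continuous_fst.comp_continuousOn hX.continuousOn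
  have hd := fun t (ht : 0 < t) => hasDerivAt_triple_iff.1 (hX.hasDerivAt ht)
  have hanti : StrictAntiOn (fun t => (X t).1) (Icc t₀ t₃) := by
    refine strictAntiOn_of_deriv_neg (convex_Icc _ _) (hc1.mono fun t ht => h0.trans ht.1) ?_
    intro t ht
    rw [interior_Icc] at ht
    rw [(hd t (h0.trans_lt ht.1)).1.deriv]
    exact hy t ⟨ht.1, ht.2.le⟩
  by_contra hcon
  push Not at hcon
  obtain ⟨t₅, h35, h5⟩ := hcon
  have hcl : IsCompact (Icc t₃ t₅ ∩ {t | (X t₀).1 ≤ (X t).1}) := by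
    refine isCompact_Icc.of_isClosed_subset ?_ inter_subset_left
    exact (hc1.mono fun t ht => (h0.trans h03.le).trans ht.1).preimage_isClosed_of_isClosed
      isClosed_Icc isClosed_Ici
  obtain ⟨t₄, ⟨h4I, h4⟩, hleast⟩ := hcl.exists_isLeast ⟨t₅, ⟨h35, le_rfl⟩, h5⟩
  replace h4 : (X t₀).1 ≤ (X t₄).1 := h4
  have h34 : t₃ < t₄ := by
    refine lt_of_le_of_ne h4I.1 fun h => ?_
    have h6 : (X t₃).1 < (X t₀).1 := hanti ⟨le_rfl, h03.le⟩ ⟨h03.le, le_rfl⟩ h03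
    rw [h] at h6
    linarith
  have hlt : ∀ t ∈ Ioo t₀ t₄, (X t).1 < (X t₀).1 := by
    intro t ht
    rcases le_or_gt t t₃ with h | h
    · exact hanti ⟨le_rfl, h03.le⟩ ⟨ht.1.le, h⟩ ht.1
    · by_contra h6
      exact absurd (hleast ⟨⟨h.le, ht.2.le.trans h4I.2⟩, not_lt.1 h6⟩) (not_le.2 ht.2)
  set W : ℝ → ℝ := fun x => ∫ r in (X t₀).1..x, α r with hW
  have hWd : ∀ x, HasDerivAt W (α x) x := fun x => (hαc.integral_hasStrictDerivAt _ x).hasDerivAt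
  have hW0 : W (X t₀).1 = 0 := intervalIntegral.integral_same
  have hWmono : Monotone W := monotone_of_deriv_nonneg (fun x => (hWd x).differentiableAt)
    fun x => by rw [(hWd x).deriv]; exact hα x
  set E : ℝ → ℝ := fun t => (X t).2.1 ^ 2 / 2 + V (X t).1
    + fluidDensity V (X t) * (1 - Real.exp (W (X t).1)) with hE
  have hEc : ContinuousOn E (Ici 0) := by
    have c1 : ContinuousOn (fun t => (X t).2.1) (Ici 0) :=
      (by fun_prop : Continuous fun z : ℝ × ℝ × ℝ => z.2.1).comp_continuousOn hX.continuousOn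
    have c2 : ContinuousOn (fun t => fluidDensity V (X t)) (Ici 0) :=
      (continuous_fluidDensity hV).comp_continuousOn hX.continuousOn
    have c3 : ContinuousOn (fun t => V (X t).1) (Ici 0) := hV.continuous.comp_continuousOn hc1
    have c4 : ContinuousOn (fun t => W (X t).1) (Ici 0) :=
      (continuous_iff_continuousAt.2 fun x => (hWd x).continuousAt).comp_continuousOn hc1
    exact (((c1.pow 2).div_const 2).add c3).add
      (c2.mul (continuousOn_const.sub (Real.continuous_exp.comp_continuousOn c4)))
  have hEd : ∀ t > 0, HasDerivAt E (-3 * (X t).2.2 * (X t).2.1 ^ 2 - 3 * γ * (X t).2.2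
      * fluidDensity V (X t) * (1 - Real.exp (W (X t).1))) t := by
    intro t ht
    obtain ⟨d1, d2, d3⟩ := hd t ht
    have d4 := (hV.differentiable one_ne_zero (X t).1).hasDerivAt.comp t d1
    have d5 := ((hWd (X t).1).comp t d1).exp.const_sub 1
    have d6 := hasDerivAt_fluidDensity hV (hX.hasDerivAt ht)
    refine ((((d2.pow 2).div_const 2).add d4).add (d6.mul d5)).congr_deriv ?_
    simp only [fieldAccel, Function.comp]
    norm_num
    ring
  have hEle : ∀ t ∈ Ioo t₀ t₄, -3 * (X t).2.2 * (X t).2.1 ^ 2 - 3 * γ * (X t).2.2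
      * fluidDensity V (X t) * (1 - Real.exp (W (X t).1)) ≤ -3 * (X t).2.2 * (X t).2.1 ^ 2 := by
    intro t ht
    have ht0 : 0 ≤ t := h0.trans ht.1.le
    have b0 : 0 ≤ 1 - Real.exp (W (X t).1) := by
      have := hWmono (hlt t ht).le
      rw [hW0] at this
      linarith [Real.exp_le_one_iff.2 this]
    have := hH t ht0
    have := hρ t ht0
    have : 0 ≤ 3 * γ * (X t).2.2 * fluidDensity V (X t) * (1 - Real.exp (W (X t).1)) := by
      positivity
    linarith
  have e1 : E t₃ < E t₀ := by
    have : StrictAntiOn E (Icc t₀ t₃) := by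
      refine strictAntiOn_of_deriv_neg (convex_Icc _ _) (hEc.mono fun t ht => h0.trans ht.1) ?_
      intro t ht
      rw [interior_Icc] at ht
      rw [(hEd t (h0.trans_lt ht.1)).deriv]
      refine (hEle t ⟨ht.1, ht.2.trans h34⟩).trans_lt ?_
      have h6 := hy t ⟨ht.1, ht.2.le⟩
      have h7 := hH t (h0.trans ht.1.le)
      have := mul_pos h7 (pow_pos (neg_pos.2 h6) 2)
      nlinarith
    exact this ⟨le_rfl, h03.le⟩ ⟨h03.le, le_rfl⟩ h03
  have e2 : E t₄ ≤ E t₃ := by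
    refine le_of_deriv_le (g := fun _ => E t₃) (g' := fun _ => 0)
      (hEc.mono fun t ht => (h0.trans h03.le).trans ht.1) continuousOn_const
      (fun t ht => hEd t ((h0.trans_lt h03).trans ht.1)) (fun _ _ => hasDerivAt_const _ _) ?_ le_rfl
      t₄ ⟨h34.le, le_rfl⟩
    intro t ht
    refine (hEle t ⟨h03.trans ht.1, ht.2⟩).trans ?_
    have h7 := hH t ((h0.trans h03.le).trans ht.1.le)
    have := mul_nonneg h7.le (sq_nonneg (X t).2.1)
    linarith
  have h44 : (X t₄).1 = (X t₀).1 := by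
    refine le_antisymm ?_ h4
    have h6 : Tendsto (fun t => (X t).1) (𝓝[<] t₄) (𝓝 (X t₄).1) :=
      ((hd t₄ ((h0.trans_lt h03).trans h34)).1.continuousAt.tendsto).mono_left nhdsWithin_le_nhds
    refine le_of_tendsto h6 ?_
    filter_upwards [Ioo_mem_nhdsLT (h03.trans h34)] with t ht using (hlt t ht).le
  have e3 : E t₀ = V (X t₀).1 := by
    simp only [hE, hy0, hW0, Real.exp_zero]
    ring
  have e4 : E t₄ = (X t₄).2.1 ^ 2 / 2 + V (X t₀).1 := by
    simp only [hE, h44, hW0, Real.exp_zero]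
    ring
  have := sq_nonneg (X t₄).2.1
  linarith

/-- A trajectory which converges to the saddle and avoids degenerate turning points eventually moves
to the right, if the coupling is nonnegative. -/
theorem eventually_velocity_pos (hγ : 0 < γ) (hV : ContDiff ℝ 1 V) (hαc : Continuous α)
    (hα : ∀ x, 0 ≤ α x) (hX : IsGlobalTraj (cosmoField γ V α) X)
    (hρ : ∀ t ≥ 0, 0 < fluidDensity V (X t)) (hH : ∀ t ≥ 0, 0 < (X t).2.2)
    (hlt : ∀ t ≥ 0, (X t).1 < φm) (hlim : Tendsto (fun t => (X t).1) atTop (𝓝 φm))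
    (hnd : ∀ t ≥ 0, ¬ IsDegenerate V α (X t)) : ∃ T ≥ 0, ∀ t ≥ T, 0 < (X t).2.1 := by
  have hc1 : ContinuousOn (fun t => (X t).1) (Ici 0) :=
    continuous_fst.comp_continuousOn hX.continuousOn
  have hc2 : ContinuousOn (fun t => (X t).2.1) (Ici 0) :=
    (by fun_prop : Continuous fun z : ℝ × ℝ × ℝ => z.2.1).comp_continuousOn hX.continuousOn
  have hd := fun t (ht : 0 < t) => hasDerivAt_triple_iff.1 (hX.hasDerivAt ht)
  have hnn : ∃ T ≥ 0, ∀ t ≥ T, 0 ≤ (X t).2.1 := by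
    by_contra hcon
    push Not at hcon
    obtain ⟨t₁, h1, -⟩ := hcon 0 le_rfl
    obtain ⟨t₂, h2, hy2⟩ : ∃ t₂ ≥ t₁, 0 < (X t₂).2.1 := by
      by_contra hno
      push Not at hno
      have hle : ∀ t ≥ t₁, (X t).1 ≤ (X t₁).1 := by
        intro t ht
        exact le_of_deriv_le (g := fun _ => (X t₁).1) (g' := fun _ => 0)
          (hc1.mono fun s hs => h1.trans hs.1) continuousOn_const
          (fun s hs => (hd s (h1.trans_lt hs.1)).1) (fun _ _ => hasDerivAt_const _ _)
          (fun s hs => hno s hs.1.le) le_rfl t ⟨ht, le_rfl⟩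
      have := le_of_tendsto hlim ((eventually_ge_atTop t₁).mono hle)
      linarith [hlt t₁ h1]
    have h20 : 0 ≤ t₂ := h1.trans h2
    obtain ⟨t₃, h3, hy3⟩ := hcon t₂ h20
    have hcl : IsCompact (Icc t₂ t₃ ∩ {t | 0 ≤ (X t).2.1}) := by
      refine isCompact_Icc.of_isClosed_subset ?_ inter_subset_left
      exact (hc2.mono fun t ht => h20.trans ht.1).preimage_isClosed_of_isClosed
        isClosed_Icc isClosed_Ici
    obtain ⟨t₀, ⟨h0I, h0⟩, hgr⟩ := hcl.exists_isGreatest ⟨t₂, ⟨le_rfl, h3⟩, hy2.le⟩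
    replace h0 : 0 ≤ (X t₀).2.1 := h0
    have h03 : t₀ < t₃ := lt_of_le_of_ne h0I.2 fun h => by rw [h] at h0; linarith
    have hneg : ∀ t ∈ Ioc t₀ t₃, (X t).2.1 < 0 := by
      intro t ht
      by_contra h6
      exact absurd (hgr ⟨⟨h0I.1.trans ht.1.le, ht.2⟩, not_lt.1 h6⟩) (not_le.2 ht.1)
    have hy0 : (X t₀).2.1 = 0 := by
      refine le_antisymm ?_ h0
      have h6 : Tendsto (fun t => (X t).2.1) (𝓝[>] t₀) (𝓝 (X t₀).2.1) :=
        (hc2 t₀ (h20.trans h0I.1)).mono_left (nhdsWithin_mono _ fun t ht =>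
          (h20.trans h0I.1).trans (le_of_lt ht))
      refine le_of_tendsto h6 ?_
      filter_upwards [Ioc_mem_nhdsGT h03] with t ht using (hneg t ht).le
    have hret := field_lt_of_turn hγ hV hαc hα hX hρ hH (h20.trans h0I.1) h03 hy0 hneg
    have := le_of_tendsto hlim ((eventually_ge_atTop t₃).mono fun t ht => (hret t ht).le)
    linarith [hlt t₀ (h20.trans h0I.1)]
  obtain ⟨T, hT, hnn⟩ := hnn
  refine ⟨T + 1, by linarith, fun t ht => lt_of_le_of_ne (hnn t (by linarith)) fun h => ?_⟩
  have hmin : IsLocalMin (fun t => (X t).2.1) t := by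
    filter_upwards [Ioi_mem_nhds (by linarith : T < t)] with s hs
    simp only [← h]
    exact hnn s (le_of_lt hs)
  exact hnd t (by linarith) ⟨h.symm, hmin.hasDerivAt_eq_zero (hd t (by linarith)).2.1⟩

/-- A global trajectory with a limit stays in a box. -/
theorem IsGlobalTraj.exists_box {v : ℝ × ℝ × ℝ → ℝ × ℝ × ℝ} (hX : IsGlobalTraj v X)
    {z : ℝ × ℝ × ℝ} (hlim : Tendsto X atTop (𝓝 z)) :
    ∃ m : ℕ, ∀ t ≥ 0, X t ∈ Icc (-(m : ℝ), -(m : ℝ), -(m : ℝ)) ((m : ℝ), (m : ℝ), (m : ℝ)) := by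
  obtain ⟨T, hT⟩ := eventually_atTop.1 (hlim.eventually (Metric.ball_mem_nhds z one_pos))
  obtain ⟨B, hB⟩ := (isCompact_Icc (a := (0 : ℝ)) (b := T)).exists_bound_of_continuousOn
    (hX.continuousOn.mono Icc_subset_Ici_self)
  obtain ⟨m, hm⟩ := exists_nat_ge (max B (‖z‖ + 1))
  refine ⟨m, fun t ht => ?_⟩
  have hn : ‖X t‖ ≤ m := by
    rcases le_total t T with h | h
    · exact (hB t ⟨ht, h⟩).trans ((le_max_left _ _).trans hm)
    · have h1 : ‖X t - z‖ < 1 := by simpa [dist_eq_norm] using hT t h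
      have h2 : ‖X t‖ ≤ ‖X t - z‖ + ‖z‖ := by simpa using norm_add_le (X t - z) z
      linarith [(le_max_right B (‖z‖ + 1)).trans hm]
  simp only [Prod.norm_def, Real.norm_eq_abs, max_le_iff, abs_le] at hn
  exact ⟨⟨hn.1.1, hn.2.1.1, hn.2.2.1⟩, ⟨hn.1.2, hn.2.1.2, hn.2.2.2⟩⟩

theorem volume_rest : volume {p : ℝ × ℝ × ℝ | p.2.1 = 0} = 0 := by
  have h1 : {p : ℝ × ℝ × ℝ | p.2.1 = 0} = univ ×ˢ (({0} : Set ℝ) ×ˢ univ) := by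
    ext p
    simp
  rw [h1, Measure.volume_eq_prod, Measure.prod_prod, Measure.volume_eq_prod, Measure.prod_prod]
  simp

theorem neg_cube_le_cube (m : ℕ) :
    ((-(m : ℝ), -(m : ℝ), -(m : ℝ)) : ℝ × ℝ × ℝ) ≤ ((m : ℝ), (m : ℝ), (m : ℝ)) := by
  have h : -(m : ℝ) ≤ m := by
    have := Nat.cast_nonneg (α := ℝ) m
    linarith
  exact ⟨h, h, h⟩

/-- The data of convergent trajectories which avoid degenerate turning points and enter a given null
set at a positive integer time form a null set. -/
theorem volume_enter (hV : ContDiff ℝ 1 V) (hαc : Continuous α) {A : ℝ} (hA : ∀ x, |α x| ≤ A)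
    {N : Set (ℝ × ℝ × ℝ)} (hN : volume N = 0) (z : ℝ × ℝ × ℝ) :
    volume {p | ∃ X, IsGlobalTraj (cosmoField γ V α) X ∧ X 0 = p ∧ Tendsto X atTop (𝓝 z) ∧
      (∀ t ≥ 0, ¬ IsDegenerate V α (X t)) ∧ ∃ n : ℕ, X ((n : ℝ) + 1) ∈ N} = 0 := by
  set lo : ℕ → ℝ × ℝ × ℝ := fun m => (-(m : ℝ), -(m : ℝ), -(m : ℝ)) with hlo
  set hi : ℕ → ℝ × ℝ × ℝ := fun m => ((m : ℝ), (m : ℝ), (m : ℝ)) with hhi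
  set S : ℕ → ℕ → Set (ℝ × ℝ × ℝ) := fun m n => {p | ∃ X : ℝ → ℝ × ℝ × ℝ,
    IsTraj (cosmoField γ V α) ((n : ℝ) + 1) X ∧ X 0 = p ∧
    (∀ t ∈ Icc 0 ((n : ℝ) + 1), X t ∈ Icc (lo m) (hi m)) ∧
    (∀ t ∈ Ico 0 ((n : ℝ) + 1), ¬ IsDegenerate V α (X t)) ∧ X ((n : ℝ) + 1) ∈ N} with hS
  have hS0 : ∀ m n, volume (S m n) = 0 := by
    intro m n
    obtain ⟨κ, hκ0, hκ₁, hκ₂⟩ := exists_flow_constants (γ := γ) (lo := lo m) (hi := hi m) hαc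
    have := volume_le_of_flow hV hαc hA (neg_cube_le_cube m) hκ0 hκ0 hκ₁ hκ₂
      (by positivity : (0 : ℝ) < n + 1) (S := S m n) (N := N) fun p hp => hp
    rw [hN, mul_zero] at this
    exact le_antisymm this zero_le
  refine measure_mono_null (t := ⋃ m, ⋃ n, S m n) ?_
    (measure_iUnion_null fun m => measure_iUnion_null fun n => hS0 m n)
  rintro p ⟨X, hX, hX0, hlim, hnd, n, hn⟩
  obtain ⟨m, hm⟩ := hX.exists_box hlim
  exact mem_iUnion₂.2 ⟨m, n, X, hX _, hX0, fun t ht => hm t ht.1, fun t ht => hnd t ht.1, hn⟩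

theorem volume_saddleSet_of_nonneg (hγ₀ : 0 < γ) (hγ₂ : γ ≤ 2) (hV : ContDiff ℝ 1 V)
    (hcrit : ∀ x < φm, deriv V x ≠ 0) (hcm : deriv V φm = 0) (hpos : 0 < V φm)
    {v : ℝ} (hv : v < 0) (hv' : HasDerivAt (deriv V) v φm) (hHs : 0 < Hs)
    (hsaddle : 3 * Hs ^ 2 = V φm) (hαc : Continuous α) {A : ℝ} (hA : ∀ x, |α x| ≤ A)
    (hα : ∀ x, 0 ≤ α x) : volume (saddleSet γ V α φm Hs) = 0 := by
  obtain ⟨c, hc, k₁, k₂, hk₂, hVpos, hP⟩ := exists_isHyperbolic hV hcm hpos hv hv' hα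
  have hK := volume_climbingSet hγ₀ hγ₂ hV hA hk₂ hHs hsaddle hVpos hP
  set lo : ℕ → ℝ × ℝ × ℝ := fun m => (-(m : ℝ), -(m : ℝ), -(m : ℝ)) with hlo
  set hi : ℕ → ℝ × ℝ × ℝ := fun m => ((m : ℝ), (m : ℝ), (m : ℝ)) with hhi
  have hh0 : ∀ m n : ℕ, volume (hitSet γ V α (lo m) (hi m) φm 0 ((n : ℝ) + 1)) = 0 := fun m n =>
    volume_hitSet hV hαc hA (neg_cube_le_cube m) hcrit (by positivity)
  refine measure_mono_null (t := {p | p.2.1 = 0} ∪ ((⋃ m, ⋃ n : ℕ,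
    hitSet γ V α (lo m) (hi m) φm 0 ((n : ℝ) + 1)) ∪ {p | ∃ X, IsGlobalTraj (cosmoField γ V α) X ∧
      X 0 = p ∧ Tendsto X atTop (𝓝 (φm, 0, Hs)) ∧ (∀ t ≥ 0, ¬ IsDegenerate V α (X t)) ∧
      ∃ n : ℕ, X ((n : ℝ) + 1) ∈ climbingSet γ V α φm c Hs})) ?_
    (measure_union_null volume_rest (measure_union_null
      (measure_iUnion_null fun m => measure_iUnion_null fun n => hh0 m n)
      (volume_enter hV hαc hA hK _)))
  rintro p ⟨X, hX, hX0, hreg, hlim⟩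
  obtain ⟨m, hm⟩ := hX.exists_box hlim
  by_cases hdeg : ∃ t ≥ 0, IsDegenerate V α (X t)
  · obtain ⟨t₁, h1, hd1⟩ := hdeg
    have hcl : IsCompact (Icc 0 t₁ ∩ {t | IsDegenerate V α (X t)}) := by
      refine isCompact_Icc.of_isClosed_subset ?_ inter_subset_left
      have hz : IsClosed {z : ℝ × ℝ × ℝ | IsDegenerate V α z} :=
        (isClosed_eq (by fun_prop) continuous_const).inter
          (isClosed_eq (continuous_fieldAccel hV hαc) continuous_const)
      exact (hX t₁).1.preimage_isClosed_of_isClosed isClosed_Icc hz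
    obtain ⟨τ, ⟨hτI, hτ⟩, hleast⟩ := hcl.exists_isLeast ⟨t₁, ⟨h1, le_rfl⟩, hd1⟩
    replace hτ : IsDegenerate V α (X τ) := hτ
    rcases eq_or_lt_of_le hτI.1 with h0 | h0
    · left
      rw [← h0, hX0] at hτ
      exact hτ.1
    · right
      left
      obtain ⟨n, hn⟩ := exists_nat_ge τ
      refine mem_iUnion₂.2 ⟨m, n, τ, ⟨h0, by linarith⟩, X, hX τ, hX0, fun t ht =>
        ⟨hm t ht.1, (hreg t ht.1).1.le⟩, fun t ht hcon => ?_, hτ⟩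
      exact absurd (hleast ⟨⟨ht.1, ht.2.le.trans hτI.2⟩, hcon⟩) (not_le.2 ht.2)
  · push Not at hdeg
    right
    right
    have l1 : Tendsto (fun t => (X t).1) atTop (𝓝 φm) := (continuous_fst.tendsto _).comp hlim
    have l2 : Tendsto (fun t => (X t).2.2 - (X t).2.1) atTop (𝓝 Hs) := by
      have := ((by fun_prop : Continuous fun z : ℝ × ℝ × ℝ => z.2.2 - z.2.1).tendsto _).comp hlim
      simpa [Function.comp_def] using this
    have l3 : Tendsto (fun t => (X t).2.2 ^ 2 - fluidDensity V (X t)) atTop (𝓝 (Hs ^ 2)) := by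
      have hcf := continuous_fluidDensity hV
      have := ((by fun_prop : Continuous fun z : ℝ × ℝ × ℝ =>
        z.2.2 ^ 2 - fluidDensity V z).tendsto _).comp hlim
      have h2 : fluidDensity V (φm, 0, Hs) = 0 := by
        simp only [fluidDensity]
        linarith
      simpa [Function.comp_def, h2] using this
    obtain ⟨T₁, hT₁, hy⟩ := eventually_velocity_pos hγ₀ hV hαc hα hX (fun t ht => (hreg t ht).2.1)
      (fun t ht => hHs.trans_le (hreg t ht).2.2) (fun t ht => (hreg t ht).1) l1 hdeg
    obtain ⟨T₂, hT₂⟩ := eventually_atTop.1 (((l1.eventually (lt_mem_nhds hc)).and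
      (l2.eventually (lt_mem_nhds hHs))).and (l3.eventually (lt_mem_nhds (pow_pos hHs 2))))
    obtain ⟨n, hn⟩ := exists_nat_ge (max T₁ T₂)
    have hn1 := (le_max_left _ _).trans hn
    have hn2 := (le_max_right _ _).trans hn
    have hn0 : (0 : ℝ) ≤ (n : ℝ) + 1 := by positivity
    refine ⟨X, hX, hX0, hlim, hdeg, n,
      fun t => X ((n : ℝ) + 1 + t), hX.shift hn0, by simp, fun t ht => ?_, ?_⟩
    · obtain ⟨⟨g1, g2⟩, g3⟩ := hT₂ ((n : ℝ) + 1 + t) (by linarith)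
      obtain ⟨g4, g5, g6⟩ := hreg ((n : ℝ) + 1 + t) (by linarith)
      exact ⟨⟨g1.le, g4⟩, hy _ (by linarith), by linarith, g5, by linarith⟩
    · exact hlim.comp (tendsto_atTop_add_const_left _ _ tendsto_id)

end Saddle

/-! ### Trajectories converging to the saddle, for a nonpositive coupling -/

section Settling

variable {γ φm Hs δ A : ℝ} {V α : ℝ → ℝ} {X : ℝ → ℝ × ℝ × ℝ}

theorem strictMonoOn_potential (hV : ContDiff ℝ 1 V) (hinc : ∀ x < φm, 0 < deriv V x) :
    StrictMonoOn V (Iic φm) := by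
  refine strictMonoOn_of_deriv_pos (convex_Iic _) hV.continuous.continuousOn fun x hx => ?_
  rw [interior_Iic] at hx
  exact hinc x hx

/-- The data of the trajectories which converge to the saddle point `(φm, 0, Hs)` with `φ' > 0`,
inside the box of size `δ`. -/
def settlingSet (γ : ℝ) (V α : ℝ → ℝ) (φm Hs δ : ℝ) : Set (ℝ × ℝ × ℝ) :=
  {p | ∃ X, IsGlobalTraj (cosmoField γ V α) X ∧ X 0 = p ∧ (∀ t ≥ 0,
    X t ∈ Icc (φm - δ, 0, Hs) (φm, δ, Hs + δ) ∧ (X t).1 < φm ∧ 0 < (X t).2.1 ∧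
    0 < fluidDensity V (X t)) ∧ Tendsto X atTop (𝓝 (φm, 0, Hs))}

/-- Trajectories settling at the saddle do so at least as fast as the Hubble friction dictates. -/
theorem exists_settling_rates (hγ₀ : 0 < γ) (hγ₂ : γ ≤ 2) (hV : ContDiff ℝ 1 V)
    (hinc : ∀ x < φm, 0 < deriv V x) (hHs : 0 < Hs) (hsaddle : 3 * Hs ^ 2 = V φm)
    (hA : ∀ x, |α x| ≤ A) (hα : ∀ x, α x ≤ 0) (hδ : 0 < δ) :
    ∃ C₁ C₂ C₃ : ℝ, 0 ≤ C₁ ∧ 0 ≤ C₂ ∧ 0 ≤ C₃ ∧ ∀ X, IsGlobalTraj (cosmoField γ V α) X →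
      (∀ t ≥ 0, X t ∈ Icc (φm - δ, 0, Hs) (φm, δ, Hs + δ) ∧ (X t).1 < φm ∧ 0 < (X t).2.1 ∧
        0 < fluidDensity V (X t)) → Tendsto X atTop (𝓝 (φm, 0, Hs)) → ∀ t ≥ 0,
      X t ∈ Icc (φm - C₂ * Real.exp (-3 * Hs * t), 0, Hs)
        (φm, C₁ * Real.exp (-3 * Hs * t), Hs + C₃ * Real.exp (-3 * γ * Hs * t)) := by
  obtain ⟨R, hR⟩ := (isCompact_Icc (a := ((φm - δ, 0, Hs) : ℝ × ℝ × ℝ))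
    (b := (φm, δ, Hs + δ))).exists_bound_of_continuousOn (continuous_fluidDensity hV).continuousOn
  have hA0 : 0 ≤ A := (abs_nonneg _).trans (hA 0)
  have hR0 : 0 ≤ R := (norm_nonneg _).trans (hR (φm, 0, Hs)
    ⟨⟨by linarith, le_rfl, le_rfl⟩, ⟨le_rfl, hδ.le, by linarith⟩⟩)
  refine ⟨δ, δ / (3 * Hs), (δ ^ 2 / 2 + R * Real.exp (A * δ)) / (6 * Hs), hδ.le, by positivity,
    by positivity, fun X hX hreg hlim t ht => ?_⟩
  have hd := fun t (ht : 0 < t) => hasDerivAt_triple_iff.1 (hX.hasDerivAt ht)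
  have hc : ∀ s, ContinuousOn X (Icc 0 s) := fun s => (hX s).1
  have c1 : ∀ s, ContinuousOn (fun t => (X t).1) (Icc 0 s) := fun s =>
    continuous_fst.comp_continuousOn (hc s)
  have c2 : ∀ s, ContinuousOn (fun t => (X t).2.1) (Icc 0 s) := fun s =>
    (by fun_prop : Continuous fun z : ℝ × ℝ × ℝ => z.2.1).comp_continuousOn (hc s)
  have c3 : ∀ s, ContinuousOn (fun t => fluidDensity V (X t)) (Icc 0 s) := fun s =>
    (continuous_fluidDensity hV).comp_continuousOn (hc s)
  have hacc : ∀ t > 0, fieldAccel V α (X t) ≤ -3 * Hs * (X t).2.1 := by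
    intro t ht
    obtain ⟨hb, h1, h2, h3⟩ := hreg t ht.le
    have e1 := hinc _ h1
    have e2 := mul_nonneg (sub_nonneg.2 hb.1.2.2) h2.le
    have e3 := mul_nonneg (neg_nonneg.2 (hα (X t).1)) h3.le
    simp only [fieldAccel] at e2 ⊢
    linarith
  have dE : ∀ k t : ℝ, HasDerivAt (fun t => Real.exp (k * t)) (Real.exp (k * t) * k) t := fun k t =>
    by simpa using ((hasDerivAt_id t).const_mul k).exp
  -- decay of the velocity
  have hy : ∀ t ≥ 0, (X t).2.1 ≤ δ * Real.exp (-3 * Hs * t) := by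
    intro t ht
    have h1 := le_of_deriv_le (f := fun t => (X t).2.1 * Real.exp (3 * Hs * t)) (a := 0) (b := t)
      (g := fun _ => (X 0).2.1) (g' := fun _ => 0) ((c2 t).mul (by fun_prop)) continuousOn_const
      (fun s hs => (hd s hs.1).2.1.mul (dE (3 * Hs) s)) (fun _ _ => hasDerivAt_const _ _)
      (fun s hs => ?_) (by simp) t ⟨ht, le_rfl⟩
    · have h2 : (X 0).2.1 ≤ δ := (hreg 0 le_rfl).1.2.2.1
      have h3 : Real.exp (-3 * Hs * t) * Real.exp (3 * Hs * t) = 1 := by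
        rw [← Real.exp_add, ← Real.exp_zero]
        congr 1
        ring
      have h4 := Real.exp_pos (-3 * Hs * t)
      calc (X t).2.1 = (X t).2.1 * Real.exp (3 * Hs * t) * Real.exp (-3 * Hs * t) := by
            rw [mul_assoc, mul_comm (Real.exp (3 * Hs * t)), h3, mul_one]
        _ ≤ δ * Real.exp (-3 * Hs * t) := by
            apply mul_le_mul_of_nonneg_right (h1.trans h2) h4.le
    · have h2 := mul_nonneg (sub_nonneg.2 (hacc s hs.1)) (Real.exp_pos (3 * Hs * s)).le
      linarith
  -- decay of the distance to the maximum
  have hφ : ∀ t ≥ 0, φm - (X t).1 ≤ (X t).2.1 / (3 * Hs) := by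
    intro t ht
    have hanti : ∀ b ≥ t, (X b).1 + (X b).2.1 / (3 * Hs) ≤ (X t).1 + (X t).2.1 / (3 * Hs) := by
      intro b hb
      refine le_of_deriv_le (f := fun t => (X t).1 + (X t).2.1 / (3 * Hs)) (a := t) (b := b)
        (g := fun _ => (X t).1 + (X t).2.1 / (3 * Hs)) (g' := fun _ => 0)
        (((c1 b).add ((c2 b).div_const _)).mono (Icc_subset_Icc_left ht)) continuousOn_const
        (fun s hs => (hd s (ht.trans_lt hs.1)).1.add ((hd s (ht.trans_lt hs.1)).2.1.div_const _))
        (fun _ _ => hasDerivAt_const _ _) (fun s hs => ?_) le_rfl b ⟨hb, le_rfl⟩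
      have h1 := hacc s (ht.trans_lt hs.1)
      have h2 : fieldAccel V α (X s) / (3 * Hs) ≤ -(X s).2.1 := by
        rw [div_le_iff₀ (by positivity)]
        linarith
      linarith
    have hl : Tendsto (fun b => (X b).1 + (X b).2.1 / (3 * Hs)) atTop (𝓝 φm) := by
      have := ((by fun_prop : Continuous fun z : ℝ × ℝ × ℝ => z.1 + z.2.1 / (3 * Hs)).tendsto
        _).comp hlim
      simpa [Function.comp_def] using this
    have := le_of_tendsto hl ((eventually_ge_atTop t).mono hanti)
    linarith
  -- decay of the density
  have hρ : ∀ t ≥ 0, fluidDensity V (X t) ≤ R * Real.exp (A * δ) * Real.exp (-3 * γ * Hs * t) := by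
    intro t ht
    have h1 := le_of_deriv_le (a := 0) (b := t)
      (f := fun t => fluidDensity V (X t) * Real.exp (3 * γ * Hs * t - A * (X t).1))
      (g := fun _ => fluidDensity V (X 0) * Real.exp (-(A * (X 0).1))) (g' := fun _ => 0)
      ((c3 t).mul (Real.continuous_exp.comp_continuousOn
        ((by fun_prop : ContinuousOn (fun t => 3 * γ * Hs * t) (Icc 0 t)).sub
          (continuousOn_const.mul (c1 t)))))
      continuousOn_const
      (fun s hs => (hasDerivAt_fluidDensity hV (hX.hasDerivAt hs.1)).mul
        ((((hasDerivAt_id s).const_mul (3 * γ * Hs)).sub ((hd s hs.1).1.const_mul A)).exp))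
      (fun _ _ => hasDerivAt_const _ _) (fun s hs => ?_) (by simp) t ⟨ht, le_rfl⟩
    · have h2 : fluidDensity V (X 0) ≤ R := (le_abs_self _).trans (hR _ (hreg 0 le_rfl).1)
      have h5 : fluidDensity V (X t) = fluidDensity V (X t)
          * Real.exp (3 * γ * Hs * t - A * (X t).1)
          * (Real.exp (A * (X t).1) * Real.exp (-3 * γ * Hs * t)) := by
        rw [mul_assoc, ← Real.exp_add, ← Real.exp_add]
        ring_nf
        simp
      have h6 : Real.exp (-(A * (X 0).1)) * Real.exp (A * (X t).1) ≤ Real.exp (A * δ) := by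
        rw [← Real.exp_add]
        apply Real.exp_le_exp.2
        have e1 : (X t).1 ≤ φm := (hreg t ht).1.2.1
        have e2 : φm - δ ≤ (X 0).1 := (hreg 0 le_rfl).1.1.1
        have e3 := mul_le_mul_of_nonneg_left (by linarith : (X t).1 - (X 0).1 ≤ δ) hA0
        linarith
      rw [h5]
      calc _ ≤ fluidDensity V (X 0) * Real.exp (-(A * (X 0).1))
            * (Real.exp (A * (X t).1) * Real.exp (-3 * γ * Hs * t)) := by gcongr
        _ = fluidDensity V (X 0) * (Real.exp (-(A * (X 0).1)) * Real.exp (A * (X t).1))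
            * Real.exp (-3 * γ * Hs * t) := by ring
        _ ≤ _ := by gcongr
    · obtain ⟨hb, g1, g2, g3⟩ := hreg s hs.1.le
      have e1 : 0 ≤ (X s).2.2 - Hs := sub_nonneg.2 hb.1.2.2
      have e2 : 0 ≤ α (X s).1 + A := by linarith [neg_abs_le (α (X s).1), hA (X s).1]
      have e3 := mul_nonneg (mul_nonneg g3.le (add_nonneg (mul_nonneg (mul_nonneg
        (by norm_num : (0 : ℝ) ≤ 3) hγ₀.le) e1) (mul_nonneg e2 g2.le)))
        (Real.exp_pos (3 * γ * Hs * s - A * (X s).1)).le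
      simp only [Pi.sub_apply, id, mul_one]
      linarith
  obtain ⟨hb, h1, h2, h3⟩ := hreg t ht
  have hyt := hy t ht
  have hφt := hφ t ht
  have hρt := hρ t ht
  refine ⟨⟨?_, h2.le, hb.1.2.2⟩, ⟨h1.le, hyt, ?_⟩⟩
  · change φm - δ / (3 * Hs) * Real.exp (-3 * Hs * t) ≤ (X t).1
    have h4 : (X t).2.1 / (3 * Hs) ≤ δ * Real.exp (-3 * Hs * t) / (3 * Hs) := by gcongr
    rw [div_mul_eq_mul_div]
    linarith
  · change (X t).2.2 ≤ Hs + (δ ^ 2 / 2 + R * Real.exp (A * δ)) / (6 * Hs)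
      * Real.exp (-3 * γ * Hs * t)
    have hVle : V (X t).1 ≤ V φm := (strictMonoOn_potential hV hinc).monotoneOn
      (mem_Iic.2 h1.le) (mem_Iic.2 le_rfl) h1.le
    have hy2 : (X t).2.1 ^ 2 ≤ δ ^ 2 * Real.exp (-3 * γ * Hs * t) := by
      calc (X t).2.1 ^ 2 ≤ (δ * Real.exp (-3 * Hs * t)) ^ 2 := pow_le_pow_left₀ h2.le hyt 2
        _ = δ ^ 2 * Real.exp (2 * (-3 * Hs * t)) := by
          rw [mul_pow, ← Real.exp_nat_mul]
          norm_num
        _ ≤ δ ^ 2 * Real.exp (-3 * γ * Hs * t) := by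
          apply mul_le_mul_of_nonneg_left (Real.exp_le_exp.2 _) (sq_nonneg δ)
          have := mul_nonneg (mul_nonneg hHs.le ht) (sub_nonneg.2 hγ₂)
          linarith
    have hHl : Hs ≤ (X t).2.2 := hb.1.2.2
    have e1 : 6 * Hs * ((X t).2.2 - Hs) ≤ (X t).2.1 ^ 2 / 2 + fluidDensity V (X t) := by
      have e2 : 3 * (X t).2.2 ^ 2 = (X t).2.1 ^ 2 / 2 + V (X t).1 + fluidDensity V (X t) := by
        simp only [fluidDensity]
        ring
      have e3 := sq_nonneg ((X t).2.2 - Hs)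
      linarith
    have e4 : (X t).2.2 - Hs ≤ (δ ^ 2 / 2 + R * Real.exp (A * δ)) * Real.exp (-3 * γ * Hs * t)
        / (6 * Hs) := by
      rw [le_div_iff₀ (by positivity)]
      linarith
    rw [div_mul_eq_mul_div]
    linarith

/-- The settling set is null: its points approach the saddle so fast that the volume occupied at
time `t` is smaller than the contraction of phase space volume by the flow allows. -/
theorem volume_settlingSet (hγ₀ : 0 < γ) (hγ₂ : γ ≤ 2) (hV : ContDiff ℝ 1 V)
    (hinc : ∀ x < φm, 0 < deriv V x) (hHs : 0 < Hs) (hsaddle : 3 * Hs ^ 2 = V φm)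
    (hαc : Continuous α) (hA : ∀ x, |α x| ≤ A) (hα : ∀ x, α x ≤ 0) :
    volume (settlingSet γ V α φm Hs (Hs / 4)) = 0 := by
  obtain ⟨C₁, C₂, C₃, h1, h2, h3, hrate⟩ := exists_settling_rates hγ₀ hγ₂ hV hinc hHs hsaddle hA hα
    (by positivity : 0 < Hs / 4)
  set β := Hs * (9 - 3 * γ) / 4 with hβ
  have hβ0 : 0 < β := by
    have : 0 < 9 - 3 * γ := by linarith
    positivity
  have hbound : ∀ t > 0, volume (settlingSet γ V α φm Hs (Hs / 4))
      ≤ ENNReal.ofReal (C₁ * C₂ * C₃ * Real.exp (-(β * t))) := by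
    intro t ht
    refine (volume_le_of_flow (γ := γ) (V := V) (lo := (φm - Hs / 4, 0, Hs))
      (hi := (φm, Hs / 4, Hs + Hs / 4)) hV hαc hA
      ⟨by simp; positivity, by simp; positivity, by simp; positivity⟩ (κ₁ := 3 * (Hs + Hs / 4))
      (κ₂ := 3 * γ * (Hs + Hs / 4)) (by positivity) (by positivity) ?_ ?_ ht
      (N := Icc (φm - C₂ * Real.exp (-3 * Hs * t), 0, Hs)
        (φm, C₁ * Real.exp (-3 * Hs * t), Hs + C₃ * Real.exp (-3 * γ * Hs * t))) ?_).trans ?_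
    · intro z hz
      have e1 : 0 ≤ z.2.1 := hz.1.2.1
      have e2 : z.2.2 ≤ Hs + Hs / 4 := hz.2.2.2
      have e3 := mul_nonneg (neg_nonneg.2 (hα z.1)) e1
      linarith
    · intro z hz
      have e2 : z.2.2 ≤ Hs + Hs / 4 := hz.2.2.2
      gcongr
    · rintro p ⟨X, hX, hX0, hreg, hlim⟩
      exact ⟨X, hX t, hX0, fun s hs => (hreg s hs.1).1,
        fun s hs hd => (hreg s hs.1).2.2.1.ne' hd.1, hrate X hX hreg hlim t ht.le⟩
    · rw [Icc_prod_eq, Icc_prod_eq, Measure.volume_eq_prod, Measure.prod_prod,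
        Measure.volume_eq_prod, Measure.prod_prod, Real.volume_Icc, Real.volume_Icc,
        Real.volume_Icc, ← ENNReal.ofReal_mul (by simp; positivity),
        ← ENNReal.ofReal_mul (by simp; positivity), ← ENNReal.ofReal_mul (by positivity)]
      apply ENNReal.ofReal_le_ofReal
      refine le_of_eq ?_
      have e1 : -(β * t) = (3 * (Hs + Hs / 4) + 3 * γ * (Hs + Hs / 4)) * t + -3 * Hs * t
          + -3 * Hs * t + -3 * γ * Hs * t := by
        rw [hβ]
        ring
      rw [e1, Real.exp_add, Real.exp_add, Real.exp_add]
      ring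
  have hlim : Tendsto (fun t => ENNReal.ofReal (C₁ * C₂ * C₃ * Real.exp (-(β * t)))) atTop
      (𝓝 0) := by
    have t1 : Tendsto (fun t => Real.exp (-(β * t))) atTop (𝓝 0) :=
      Real.tendsto_exp_neg_atTop_nhds_zero.comp (tendsto_id.const_mul_atTop hβ0)
    have t2 := ENNReal.tendsto_ofReal (t1.const_mul (C₁ * C₂ * C₃))
    simpa using t2
  exact le_antisymm (ge_of_tendsto hlim ((eventually_gt_atTop 0).mono hbound)) zero_le

theorem volume_saddleSet_of_nonpos (hγ₀ : 0 < γ) (hγ₂ : γ ≤ 2) (hV : ContDiff ℝ 1 V)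
    (hinc : ∀ x < φm, 0 < deriv V x) (hHs : 0 < Hs) (hsaddle : 3 * Hs ^ 2 = V φm)
    (hαc : Continuous α) (hA : ∀ x, |α x| ≤ A) (hα : ∀ x, α x ≤ 0) :
    volume (saddleSet γ V α φm Hs) = 0 := by
  refine measure_mono_null ?_ (volume_enter (γ := γ) hV hαc hA
    (volume_settlingSet hγ₀ hγ₂ hV hinc hHs hsaddle hαc hA hα) (φm, 0, Hs))
  rintro p ⟨X, hX, hX0, hreg, hlim⟩
  have hd := fun t (ht : 0 < t) => hasDerivAt_triple_iff.1 (hX.hasDerivAt ht)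
  have c1 : ContinuousOn (fun t => (X t).1) (Ici 0) :=
    continuous_fst.comp_continuousOn hX.continuousOn
  have c2 : ContinuousOn (fun t => (X t).2.1) (Ici 0) :=
    (by fun_prop : Continuous fun z : ℝ × ℝ × ℝ => z.2.1).comp_continuousOn hX.continuousOn
  have l1 : Tendsto (fun t => (X t).1) atTop (𝓝 φm) := (continuous_fst.tendsto _).comp hlim
  -- a field at rest or moving to the left would never move to the right again
  have hy : ∀ t ≥ 0, 0 < (X t).2.1 := by
    intro t₁ h1
    by_contra hcon
    push Not at hcon
    have hneg : ∀ t ≥ t₁, (X t).2.1 ≤ 0 := by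
      intro t ht
      have := nonneg_of_barrier (f := fun t => -(X t).2.1) (f' := fun t => -fieldAccel V α (X t))
        (a := t₁) (b := t) ((c2.mono fun s hs => h1.trans hs.1).neg)
        (fun s hs => (hd s (h1.trans_lt hs.1)).2.1.neg) (fun s hs hlt => ?_) (by linarith) t
        ⟨ht, le_rfl⟩
      · linarith
      · obtain ⟨g1, g2, g3⟩ := hreg s (h1.trans hs.1.le)
        have e1 := hinc _ g1
        have e2 : 0 ≤ (X s).2.2 * (X s).2.1 := mul_nonneg (hHs.le.trans g3) (by linarith)
        have e3 := mul_nonneg (neg_nonneg.2 (hα (X s).1)) g2.le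
        simp only [fieldAccel]
        linarith
    have hle : ∀ t ≥ t₁, (X t).1 ≤ (X t₁).1 := by
      intro t ht
      exact le_of_deriv_le (g := fun _ => (X t₁).1) (g' := fun _ => 0)
        (c1.mono fun s hs => h1.trans hs.1) continuousOn_const
        (fun s hs => (hd s (h1.trans_lt hs.1)).1) (fun _ _ => hasDerivAt_const _ _)
        (fun s hs => hneg s hs.1.le) le_rfl t ⟨ht, le_rfl⟩
    have := le_of_tendsto l1 ((eventually_ge_atTop t₁).mono hle)
    linarith [(hreg t₁ h1).1]
  refine ⟨X, hX, hX0, hlim, fun t ht hdeg => (hy t ht).ne' hdeg.1, ?_⟩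
  have l2 : Tendsto (fun t => (X t).2.1) atTop (𝓝 0) :=
    ((by fun_prop : Continuous fun z : ℝ × ℝ × ℝ => z.2.1).tendsto _).comp hlim
  have l3 : Tendsto (fun t => (X t).2.2) atTop (𝓝 Hs) :=
    ((by fun_prop : Continuous fun z : ℝ × ℝ × ℝ => z.2.2).tendsto _).comp hlim
  obtain ⟨T, hT⟩ := eventually_atTop.1 (((l1.eventually (lt_mem_nhds
    (by linarith : φm - Hs / 4 < φm))).and (l2.eventually (gt_mem_nhds
    (by linarith : 0 < Hs / 4)))).and (l3.eventually (gt_mem_nhds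
    (by linarith : Hs < Hs + Hs / 4))))
  obtain ⟨n, hn⟩ := exists_nat_ge T
  have hn0 : (0 : ℝ) ≤ (n : ℝ) + 1 := by positivity
  refine ⟨n, fun t => X ((n : ℝ) + 1 + t), hX.shift hn0, by simp, fun t ht => ?_,
    hlim.comp (tendsto_atTop_add_const_left _ _ tendsto_id)⟩
  obtain ⟨⟨g1, g2⟩, g3⟩ := hT ((n : ℝ) + 1 + t) (by linarith)
  obtain ⟨g4, g5, g6⟩ := hreg ((n : ℝ) + 1 + t) (by linarith)
  have g7 := hy ((n : ℝ) + 1 + t) (by linarith)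
  exact ⟨⟨⟨g1.le, g7.le, g6⟩, ⟨g4.le, g2.le, g3.le⟩⟩, g4, g7, g5⟩

end Settling

/-! ### Long-time behaviour to the left of the maximum -/

section Dynamics

variable {γ φm Hs s : ℝ} {V α : ℝ → ℝ} {X : ℝ → ℝ × ℝ × ℝ}

/-- The density stays positive, since it satisfies a linear differential equation. -/
theorem fluidDensity_pos (hV : ContDiff ℝ 1 V) (hαc : Continuous α)
    (hX : IsTraj (cosmoField γ V α) s X) (h0 : 0 < fluidDensity V (X 0)) :
    ∀ t ∈ Icc 0 s, 0 < fluidDensity V (X t) := by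
  have hg : Continuous fun z : ℝ × ℝ × ℝ => 3 * γ * z.2.2 + α z.1 * z.2.1 := by fun_prop
  obtain ⟨B, hB⟩ := (isCompact_Icc (a := (0 : ℝ)) (b := s)).exists_bound_of_continuousOn
    (hg.comp_continuousOn hX.1)
  intro t ht
  have h1 := le_of_monotone_while_pos (f := fun t => fluidDensity V (X t) * Real.exp (B * t))
    (a := 0) (b := s) (((continuous_fluidDensity hV).comp_continuousOn hX.1).mul (by fun_prop))
    (fun τ hτ => (hasDerivAt_fluidDensity hV (hX.2 τ hτ)).mul
      (((hasDerivAt_id τ).const_mul B).exp)) (fun τ hτ hpos => ?_) (by simpa using h0) t ht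
  · have h2 : 0 < fluidDensity V (X t) * Real.exp (B * t) := by
      refine lt_of_lt_of_le ?_ h1
      simpa using h0
    exact pos_of_mul_pos_left h2 (Real.exp_pos _).le
  · have h2 : 0 < fluidDensity V (X τ) := pos_of_mul_pos_left hpos (Real.exp_pos _).le
    have h3 := (abs_le.1 (hB τ ⟨hτ.1.le, hτ.2.le⟩)).2
    simp only [Function.comp] at h3
    have h4 := mul_nonneg (mul_nonneg h2.le (sub_nonneg.2 h3)) (Real.exp_pos (B * τ)).le
    simp only [id, mul_one]
    linarith

theorem fluidDensity_eq (z : ℝ × ℝ × ℝ) :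
    z.2.1 ^ 2 / 2 + fluidDensity V z = 3 * z.2.2 ^ 2 - V z.1 := by
  simp only [fluidDensity]
  ring

theorem hubbleRate_le (hγ₂ : γ ≤ 2) (z : ℝ × ℝ × ℝ) :
    hubbleRate γ V z ≤ -(γ / 2 * (3 * z.2.2 ^ 2 - V z.1)) := by
  have h1 : 0 ≤ (1 - γ / 2) * (z.2.1 ^ 2 / 2) := mul_nonneg (by linarith) (by positivity)
  rw [← fluidDensity_eq]
  simp only [hubbleRate]
  linarith

theorem hubble_antitone (hγ₀ : 0 < γ) (hX : IsTraj (cosmoField γ V α) s X)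
    (hρ : ∀ t ∈ Icc 0 s, 0 < fluidDensity V (X t)) :
    ∀ a b, 0 ≤ a → a ≤ b → b ≤ s → (X b).2.2 ≤ (X a).2.2 := by
  intro a b ha hab hb
  have hsub : Icc a b ⊆ Icc 0 s := Icc_subset_Icc ha hb
  refine le_of_deriv_le (f := fun t => (X t).2.2) (g := fun _ => (X a).2.2) (g' := fun _ => 0)
    ((by fun_prop : Continuous fun z : ℝ × ℝ × ℝ => z.2.2).comp_continuousOn (hX.1.mono hsub))
    continuousOn_const
    (fun t ht => (hasDerivAt_triple_iff.1
      (hX.2 t ⟨ha.trans_lt ht.1, ht.2.trans_le hb⟩)).2.2)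
    (fun _ _ => hasDerivAt_const _ _) (fun t ht => ?_) le_rfl b ⟨hab, le_rfl⟩
  have h1 := mul_pos hγ₀ (hρ t (hsub ⟨ht.1.le, ht.2.le⟩))
  simp only [hubbleRate]
  linarith [sq_nonneg (X t).2.1]

/-- The field cannot run away to the left as long as the Hubble function is bounded: where `V ≤ -1`,
the speed of the field is controlled by the rate of decrease of the Hubble function. -/
theorem field_ge (hγ₀ : 0 < γ) (hγ₂ : γ ≤ 2) {L : ℝ} (hL : ∀ x ≤ L, V x ≤ -1)
    (hX : IsTraj (cosmoField γ V α) s X) (hρ : ∀ t ∈ Icc 0 s, 0 < fluidDensity V (X t)) :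
    ∀ t ∈ Icc 0 s, min (X 0).1 L - 4 / γ * ((X 0).2.2 - (X t).2.2) ≤ (X t).1 := by
  intro t ht
  have hd := fun τ (hτ : τ ∈ Ioo 0 s) => hasDerivAt_triple_iff.1 (hX.2 τ hτ)
  have h1 := nonneg_of_barrier (a := 0) (b := s)
    (f := fun t => (X t).1 - 4 / γ * (X t).2.2 - (min (X 0).1 L - 4 / γ * (X 0).2.2))
    (((by fun_prop : Continuous fun z : ℝ × ℝ × ℝ => z.1 - 4 / γ * z.2.2 -
      (min (X 0).1 L - 4 / γ * (X 0).2.2)).comp_continuousOn hX.1))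
    (fun τ hτ => ((hd τ hτ).1.sub ((hd τ hτ).2.2.const_mul (4 / γ))).sub_const _)
    (fun τ hτ hneg => ?_) (by linarith [min_le_left (X 0).1 L]) t ht
  · linarith
  · have hτI : τ ∈ Icc 0 s := ⟨hτ.1.le, hτ.2.le⟩
    have hant := hubble_antitone hγ₀ hX hρ 0 τ le_rfl hτI.1 hτI.2
    have hC : 0 < 4 / γ := by positivity
    have h2 := mul_le_mul_of_nonneg_left hant hC.le
    have h3 := hL (X τ).1 (by linarith [min_le_right (X 0).1 L])
    have h4 := fluidDensity_eq (V := V) (X τ)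
    have h5 := hρ τ hτI
    have h6 : 4 / γ * hubbleRate γ V (X τ) ≤ -(1 + (X τ).2.1 ^ 2 / 2) := by
      rw [div_mul_eq_mul_div, div_le_iff₀ hγ₀]
      have e1 : 1 ≤ (X τ).2.1 ^ 2 / 2 + fluidDensity V (X τ) := by
        rw [h4]
        linarith [sq_nonneg (X τ).2.2]
      have e2 := mul_le_mul_of_nonneg_left e1 hγ₀.le
      have e3 := mul_pos hγ₀ h5
      have e4 : 0 ≤ (2 - γ) * (X τ).2.1 ^ 2 := mul_nonneg (by linarith) (sq_nonneg _)
      simp only [hubbleRate]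
      linarith
    have h7 := sq_nonneg ((X τ).2.1 + 1)
    linarith

/-- As long as the Hubble function is bounded below, a trajectory stays in a box. -/
theorem exists_box_of_hubble_ge (hγ₀ : 0 < γ) (hγ₂ : γ ≤ 2) (hV : ContDiff ℝ 1 V)
    (hbot : Tendsto V atBot atBot) (φm h : ℝ) (p : ℝ × ℝ × ℝ) :
    ∃ lo hi : ℝ × ℝ × ℝ, hi.1 = φm ∧ ∀ s X, IsTraj (cosmoField γ V α) s X → X 0 = p →
      (∀ t ∈ Icc 0 s, 0 < fluidDensity V (X t) ∧ (X t).1 ≤ φm ∧ h ≤ (X t).2.2) →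
      ∀ t ∈ Icc 0 s, X t ∈ Icc lo hi := by
  obtain ⟨L, hL⟩ := eventually_atBot.1 (hbot.eventually (eventually_le_atBot (-1)))
  set φl := min p.1 L - 4 / γ * (p.2.2 - h) with hφl
  obtain ⟨B, hB⟩ := (isCompact_Icc (a := φl) (b := φm)).exists_bound_of_continuousOn
    hV.continuous.continuousOn
  set R := 6 * (h ^ 2 + p.2.2 ^ 2) + 2 * B + 1 with hR
  refine ⟨(φl, -R, h), (φm, R, p.2.2), rfl, ?_⟩
  rintro s X hX rfl hreg t ht
  have h0 := ht.1
  obtain ⟨g1, g2, g3⟩ := hreg t ht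
  have hρ := fun t ht => (hreg t ht).1
  have hH := hubble_antitone hγ₀ hX hρ 0 t le_rfl h0 ht.2
  have hφ : φl ≤ (X t).1 := by
    refine le_trans ?_ (field_ge hγ₀ hγ₂ hL hX hρ t ht)
    have hC : 0 < 4 / γ := by positivity
    have := mul_le_mul_of_nonneg_left g3 hC.le
    rw [hφl]
    linarith
  have hVb := (abs_le.1 (hB _ ⟨hφ, g2⟩)).1
  have hB0 : 0 ≤ B := (norm_nonneg _).trans (hB _ ⟨hφ, g2⟩)
  have hH2 : (X t).2.2 ^ 2 ≤ h ^ 2 + (X 0).2.2 ^ 2 := by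
    rcases le_total 0 (X t).2.2 with e | e
    · have := pow_le_pow_left₀ e hH 2
      linarith [sq_nonneg h]
    · have := mul_nonneg (sub_nonneg.2 g3) (by linarith : 0 ≤ -(X t).2.2 - h)
      linarith [sq_nonneg (X 0).2.2]
  have hy : (X t).2.1 ^ 2 ≤ R - 1 := by
    have := fluidDensity_eq (V := V) (X t)
    rw [hR]
    linarith
  have hy' : |(X t).2.1| ≤ R := by
    have e1 := sq_nonneg (|(X t).2.1| - 1)
    rw [← sq_abs] at hy
    have e2 := abs_nonneg (X t).2.1
    linarith [sq_nonneg |(X t).2.1|]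
  rw [abs_le] at hy'
  exact ⟨⟨hφ, hy'.1, g3⟩, ⟨g2, hy'.2, hH⟩⟩

/-- On a trajectory existing for all times the Hubble function cannot drop below `-Hs`, because
of the Riccati inequality `H' ≤ -(3γ/2) (H² - Hs²)`. -/
theorem hubble_ge_of_global (hγ₀ : 0 < γ) (hγ₂ : γ ≤ 2) (hHs : 0 < Hs)
    (hX : IsGlobalTraj (cosmoField γ V α) X) (hρ : ∀ t ≥ 0, 0 < fluidDensity V (X t))
    (hVle : ∀ t ≥ 0, V (X t).1 ≤ 3 * Hs ^ 2) : ∀ t ≥ 0, -Hs ≤ (X t).2.2 := by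
  intro t₁ h1
  by_contra hcon
  push Not at hcon
  have hant : ∀ t ≥ t₁, (X t).2.2 ≤ (X t₁).2.2 := fun t ht =>
    hubble_antitone hγ₀ (hX t) (fun τ hτ => hρ τ hτ.1) t₁ t h1 ht le_rfl
  set u₁ := -(X t₁).2.2 with hu₁
  have hu : Hs < u₁ := by linarith
  have hu0 : 0 < u₁ := hHs.trans hu
  set k := 3 * γ / 2 * (1 - Hs ^ 2 / u₁ ^ 2) with hk
  have hk0 : 0 < k := by
    have : Hs ^ 2 / u₁ ^ 2 < 1 := by
      rw [div_lt_one (by positivity)]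
      exact pow_lt_pow_left₀ hu hHs.le two_ne_zero
    have : 0 < 1 - Hs ^ 2 / u₁ ^ 2 := by linarith
    positivity
  set b := t₁ + 1 / (u₁ * k) with hb
  have hb1 : t₁ ≤ b := by
    have : 0 < 1 / (u₁ * k) := by positivity
    linarith
  have hc : ContinuousOn (fun t => (X t).2.2) (Icc t₁ b) :=
    (by fun_prop : Continuous fun z : ℝ × ℝ × ℝ => z.2.2).comp_continuousOn
      ((hX b).1.mono (Icc_subset_Icc_left h1))
  have hneg : ∀ t ≥ t₁, (X t).2.2 < 0 := fun t ht => by linarith [hant t ht]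
  have h2 := le_of_deriv_le (f := fun t => -((X t).2.2)⁻¹) (a := t₁) (b := b)
    (g := fun t => 1 / u₁ - k * (t - t₁)) (g' := fun _ => -k)
    (hc.inv₀ fun t ht => (hneg t ht.1).ne).neg (by fun_prop)
    (fun t ht => (((hasDerivAt_triple_iff.1 (hX.hasDerivAt (h1.trans_lt ht.1))).2.2).inv
      (hneg t ht.1.le).ne).neg)
    (fun t _ => by simpa using (((hasDerivAt_id t).sub_const t₁).const_mul k).const_sub (1 / u₁))
    (fun t ht => ?_) ?_ b ⟨hb1, le_rfl⟩
  · have h3 : 1 / u₁ - k * (b - t₁) = 0 := by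
      rw [hb]
      field_simp
      ring
    rw [h3] at h2
    have h4 := inv_neg''.2 (hneg b hb1)
    linarith
  · have ht0 : 0 ≤ t := h1.trans ht.1.le
    have e1 := hubbleRate_le (V := V) hγ₂ (X t)
    have e2 := hVle t ht0
    have e3 := hneg t ht.1.le
    have e4 : u₁ ^ 2 ≤ (X t).2.2 ^ 2 := by
      rw [← neg_sq (X t).2.2]
      exact pow_le_pow_left₀ hu0.le (by linarith [hant t ht.1.le]) 2
    have e5 : hubbleRate γ V (X t) ≤ -(k * (X t).2.2 ^ 2) := by
      have e6 : k * (X t).2.2 ^ 2 ≤ 3 * γ / 2 * ((X t).2.2 ^ 2 - Hs ^ 2) := by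
        have e7 : Hs ^ 2 ≤ Hs ^ 2 / u₁ ^ 2 * (X t).2.2 ^ 2 := by
          rw [div_mul_eq_mul_div, le_div_iff₀ (by positivity)]
          gcongr
        have e8 := mul_le_mul_of_nonneg_left e7 (by positivity : 0 ≤ 3 * γ / 2)
        rw [hk]
        linarith
      have e9 := mul_le_mul_of_nonneg_left e2 (by positivity : 0 ≤ γ / 2)
      linarith
    rw [neg_div, neg_neg, div_le_iff₀ ((pow_pos hu0 2).trans_le e4)]
    linarith
  · rw [sub_self, mul_zero, sub_zero, one_div, hu₁, inv_neg]

/-- Barbalat's lemma for a function `H` with a limit and with derivative `-q`, where `q ≥ 0` does not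
decrease faster than at a constant rate. -/
theorem tendsto_zero_of_rate {H q q' : ℝ → ℝ} {K l : ℝ} (hK : 0 < K)
    (hHc : ContinuousOn H (Ici 0)) (hqc : ContinuousOn q (Ici 0))
    (hH : ∀ t > 0, HasDerivAt H (-q t) t) (hq : ∀ t > 0, HasDerivAt q (q' t) t)
    (hq0 : ∀ t ≥ 0, 0 ≤ q t) (hq' : ∀ t > 0, -K ≤ q' t) (hl : Tendsto H atTop (𝓝 l)) :
    Tendsto q atTop (𝓝 0) := by
  refine tendsto_order.2 ⟨fun a ha => ?_, fun ε hε => ?_⟩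
  · filter_upwards [eventually_ge_atTop 0] with t ht using ha.trans_le (hq0 t ht)
  · set η := ε / (2 * K) with hη
    have hη0 : 0 < η := by positivity
    have h1 : Tendsto (fun t => H t - H (t + η)) atTop (𝓝 0) := by
      simpa using hl.sub (hl.comp (tendsto_atTop_add_const_right _ η tendsto_id))
    filter_upwards [h1.eventually (gt_mem_nhds (by positivity : 0 < ε / 2 * η)),
      eventually_ge_atTop 0] with t ht ht0
    by_contra hcon
    push Not at hcon
    have hsub : Icc t (t + η) ⊆ Ici 0 := fun τ hτ => ht0.trans hτ.1
    have h2 : ∀ τ ∈ Icc t (t + η), q t - K * (τ - t) ≤ q τ :=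
      le_of_deriv_le (f' := fun _ => -K) (by fun_prop) (hqc.mono hsub)
        (fun τ _ => by simpa using (((hasDerivAt_id τ).sub_const t).const_mul K).const_sub (q t))
        (fun τ hτ => hq τ (ht0.trans_lt hτ.1)) (fun τ hτ => hq' τ (ht0.trans_lt hτ.1)) (by simp)
    have h3 := le_of_deriv_le (f := H) (g := fun τ => H t - ε / 2 * (τ - t)) (a := t) (b := t + η)
      (g' := fun _ => -(ε / 2)) (hHc.mono hsub) (by fun_prop)
      (fun τ hτ => hH τ (ht0.trans_lt hτ.1))
      (fun τ _ => by simpa using (((hasDerivAt_id τ).sub_const t).const_mul (ε / 2)).const_sub (H t))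
      (fun τ hτ => ?_) (by simp) (t + η) ⟨by linarith, le_rfl⟩
    · rw [add_sub_cancel_left] at h3
      linarith
    · have e1 := h2 τ ⟨hτ.1.le, hτ.2.le⟩
      have e2 : K * (τ - t) ≤ K * η := by
        have := hτ.2
        gcongr
        linarith
      have e3 : K * η = ε / 2 := by
        rw [hη]
        field_simp
      linarith

/-- If a strictly increasing continuous function converges along a curve in a compact interval, then
so does the curve. -/
theorem exists_tendsto_of_strictMonoOn {V φ : ℝ → ℝ} {a b l : ℝ} (hVc : ContinuousOn V (Icc a b))
    (hV : StrictMonoOn V (Icc a b)) (hφ : ∀ᶠ t in atTop, φ t ∈ Icc a b)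
    (hl : Tendsto (fun t => V (φ t)) atTop (𝓝 l)) :
    ∃ c ∈ Icc a b, V c = l ∧ Tendsto φ atTop (𝓝 c) := by
  have hcl : IsClosed (V '' Icc a b) := (isCompact_Icc.image_of_continuousOn hVc).isClosed
  obtain ⟨c, hc, hcl⟩ := hcl.mem_of_tendsto hl (hφ.mono fun t ht => mem_image_of_mem V ht)
  refine ⟨c, hc, hcl, tendsto_order.2 ⟨fun d hd => ?_, fun d hd => ?_⟩⟩
  · rcases lt_or_ge d a with h | h
    · exact hφ.mono fun t ht => h.trans_le ht.1
    · have hdI : d ∈ Icc a b := ⟨h, hd.le.trans hc.2⟩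
      have h1 : V d < l := hcl ▸ hV hdI hc hd
      filter_upwards [hφ, hl.eventually (lt_mem_nhds h1)] with t ht h2
      exact (hV.lt_iff_lt hdI ht).1 h2
  · rcases lt_or_ge b d with h | h
    · exact hφ.mono fun t ht => ht.2.trans_lt h
    · have hdI : d ∈ Icc a b := ⟨hc.1.trans hd.le, h⟩
      have h1 : l < V d := hcl ▸ hV hc hdI hd
      filter_upwards [hφ, hl.eventually (gt_mem_nhds h1)] with t ht h2
      exact (hV.lt_iff_lt ht hdI).1 h2

/-- A trajectory which exists for all times to the left of the maximum converges to the saddle. -/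
theorem mem_saddleSet_of_global (hγ₀ : 0 < γ) (hγ₂ : γ ≤ 2) (hV : ContDiff ℝ 1 V)
    (hbot : Tendsto V atBot atBot) (hinc : ∀ x < φm, 0 < deriv V x) (hHs : 0 < Hs)
    (hsaddle : 3 * Hs ^ 2 = V φm) (hαc : Continuous α)
    (hX : IsGlobalTraj (cosmoField γ V α) X) (h0 : 0 < fluidDensity V (X 0))
    (hlt : ∀ t ≥ 0, (X t).1 < φm) : X 0 ∈ saddleSet γ V α φm Hs := by
  have hmono := strictMonoOn_potential hV hinc
  have hρ : ∀ t ≥ 0, 0 < fluidDensity V (X t) := fun t ht =>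
    fluidDensity_pos hV hαc (hX t) h0 t ⟨ht, le_rfl⟩
  have hVle : ∀ t ≥ 0, V (X t).1 ≤ 3 * Hs ^ 2 := fun t ht => by
    rw [hsaddle]
    exact hmono.monotoneOn (mem_Iic.2 (hlt t ht).le) (mem_Iic.2 le_rfl) (hlt t ht).le
  have hge := hubble_ge_of_global hγ₀ hγ₂ hHs hX hρ hVle
  obtain ⟨lo, hi, hhi, hbox⟩ := exists_box_of_hubble_ge (α := α) hγ₀ hγ₂ hV hbot φm (-Hs) (X 0)
  have hbox' : ∀ t ≥ 0, X t ∈ Icc lo hi := fun t ht => hbox t X (hX t) rfl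
    (fun τ hτ => ⟨hρ τ hτ.1, (hlt τ hτ.1).le, hge τ hτ.1⟩) t ⟨ht, le_rfl⟩
  have hd := fun t (ht : 0 < t) => hasDerivAt_triple_iff.1 (hX.hasDerivAt ht)
  have hant : ∀ a b, 0 ≤ a → a ≤ b → (X b).2.2 ≤ (X a).2.2 := fun a b ha hab =>
    hubble_antitone hγ₀ (hX b) (fun τ hτ => hρ τ hτ.1) a b ha hab le_rfl
  -- the Hubble function converges
  obtain ⟨h, hh⟩ : ∃ h, Tendsto (fun t => (X t).2.2) atTop (𝓝 h) := by
    have h1 : Antitone fun t => (X (max t 0)).2.2 := fun a b hab =>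
      hant _ _ (le_max_right _ _) (max_le_max_right 0 hab)
    have h2 := tendsto_atTop_ciInf h1 ⟨-Hs, by
      rintro _ ⟨t, rfl⟩
      exact hge _ (le_max_right _ _)⟩
    refine ⟨_, h2.congr' ?_⟩
    filter_upwards [eventually_ge_atTop 0] with t ht
    rw [max_eq_left ht]
  have hHge : ∀ t ≥ 0, h ≤ (X t).2.2 := fun t ht => le_of_tendsto hh
    ((eventually_ge_atTop t).mono fun b hb => hant t b ht hb)
  -- its derivative tends to zero
  set q' : ℝ × ℝ × ℝ → ℝ := fun z => z.2.1 * fieldAccel V α z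
    - γ / 2 * (fluidDensity V z * (3 * γ * z.2.2 + α z.1 * z.2.1)) with hq'
  have hFc := continuous_fieldAccel hV hαc
  have hρc := continuous_fluidDensity hV
  have hq'c : Continuous q' := by fun_prop
  obtain ⟨K, hK⟩ := (isCompact_Icc (a := lo) (b := hi)).exists_bound_of_continuousOn
    hq'c.continuousOn
  have hq0 : Tendsto (fun t => -hubbleRate γ V (X t)) atTop (𝓝 0) := by
    refine tendsto_zero_of_rate (H := fun t => (X t).2.2) (K := max K 1) (q' := fun t => q' (X t)) (by positivity)
      ((by fun_prop : Continuous fun z : ℝ × ℝ × ℝ => z.2.2).comp_continuousOn hX.continuousOn)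
      ((continuous_hubbleRate hV).comp_continuousOn hX.continuousOn).neg
      (fun t ht => by simpa using (hd t ht).2.2) (fun t ht => ?_) (fun t ht => ?_)
      (fun t ht => ?_) hh
    · have e1 := ((hd t ht).2.1.pow 2).div_const 2
      have e2 := (hasDerivAt_fluidDensity hV (hX.hasDerivAt ht)).const_mul (γ / 2)
      have e3 := e1.add e2
      have e4 : (fun t => -hubbleRate γ V (X t)) = (fun t => (X t).2.1 ^ 2 / 2)
          + fun t => γ / 2 * fluidDensity V (X t) := by
        ext t
        simp only [hubbleRate, Pi.add_apply]
        ring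
      rw [e4]
      refine e3.congr_deriv ?_
      simp only [hq']
      norm_num
      ring
    · have := mul_pos hγ₀ (hρ t ht)
      simp only [hubbleRate]
      linarith [sq_nonneg (X t).2.1]
    · have := (abs_le.1 (hK _ (hbox' t ht.le))).1
      linarith [le_max_left K 1]
  have hy0 : Tendsto (fun t => (X t).2.1) atTop (𝓝 0) := by
    have h1 : Tendsto (fun t => (X t).2.1 ^ 2) atTop (𝓝 0) := by
      have h2 := hq0.const_mul 2
      rw [mul_zero] at h2
      refine tendsto_of_tendsto_of_tendsto_of_le_of_le' tendsto_const_nhds h2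
        (Eventually.of_forall fun t => sq_nonneg _) ?_
      filter_upwards [eventually_ge_atTop 0] with t ht
      have := mul_pos hγ₀ (hρ t ht)
      simp only [hubbleRate]
      linarith
    have h3 := (Real.continuous_sqrt.tendsto 0).comp h1
    rw [Real.sqrt_zero] at h3
    refine (tendsto_zero_iff_abs_tendsto_zero _).2 (h3.congr fun t => ?_)
    simp [Real.sqrt_sq_eq_abs]
  have hρ0 : Tendsto (fun t => fluidDensity V (X t)) atTop (𝓝 0) := by
    have h2 := hq0.const_mul (2 / γ)
    rw [mul_zero] at h2
    refine tendsto_of_tendsto_of_tendsto_of_le_of_le' tendsto_const_nhds h2 ?_ ?_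
    · filter_upwards [eventually_ge_atTop 0] with t ht using (hρ t ht).le
    · refine Eventually.of_forall fun t => ?_
      rw [div_mul_eq_mul_div, le_div_iff₀ hγ₀]
      simp only [hubbleRate]
      linarith [sq_nonneg (X t).2.1]
  -- hence the field converges, and its limit is a critical point of the potential
  have hVl : Tendsto (fun t => V (X t).1) atTop (𝓝 (3 * h ^ 2)) := by
    have h1 := (((hh.pow 2).const_mul 3).sub ((hy0.pow 2).div_const 2)).sub hρ0
    norm_num at h1
    refine h1.congr fun t => ?_
    simp only [fluidDensity]
    ring
  have hsubI : Icc lo.1 φm ⊆ Iic φm := fun x hx => hx.2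
  obtain ⟨c, hc, hVc, hcl⟩ := exists_tendsto_of_strictMonoOn (a := lo.1) (b := φm)
    hV.continuous.continuousOn (hmono.mono hsubI) (by
      filter_upwards [eventually_ge_atTop 0] with t ht
      exact ⟨(hbox' t ht).1.1, (hlt t ht).le⟩) hVl
  have hcm : c = φm := by
    by_contra hne
    have hc' : 0 < deriv V c := hinc c (lt_of_le_of_ne hc.2 hne)
    have hVd : Tendsto (fun t => deriv V (X t).1) atTop (𝓝 (deriv V c)) :=
      ((hV.continuous_deriv le_rfl).tendsto c).comp hcl
    have hαl : Tendsto (fun t => α (X t).1 * fluidDensity V (X t)) atTop (𝓝 (α c * 0)) :=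
      ((hαc.tendsto c).comp hcl).mul hρ0
    have hFl := (((hh.const_mul (-3)).mul hy0).sub hVd).add hαl
    norm_num at hFl
    obtain ⟨T, hT⟩ := eventually_atTop.1 (hFl.eventually (gt_mem_nhds
      (by linarith : -deriv V c < -(deriv V c / 2))))
    have hdrop : ∀ᶠ t in atTop, (X (t + 1)).2.1 - (X t).2.1 ≤ -(deriv V c / 2) := by
      filter_upwards [eventually_ge_atTop (max T 0)] with t ht
      have ht0 : 0 ≤ t := (le_max_right _ _).trans ht
      have h1 := le_of_deriv_le (f := fun t => (X t).2.1) (a := t) (b := t + 1)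
        (g := fun τ => (X t).2.1 - deriv V c / 2 * (τ - t)) (g' := fun _ => -(deriv V c / 2))
        ((by fun_prop : Continuous fun z : ℝ × ℝ × ℝ => z.2.1).comp_continuousOn
          (hX.continuousOn.mono fun τ hτ => ht0.trans hτ.1)) (by fun_prop)
        (fun τ hτ => (hd τ (ht0.trans_lt hτ.1)).2.1)
        (fun τ _ => by
          simpa using (((hasDerivAt_id τ).sub_const t).const_mul (deriv V c / 2)).const_sub
            (X t).2.1)
        (fun τ hτ => by
          have := hT τ (((le_max_left _ _).trans ht).trans hτ.1.le)
          simp only [fieldAccel]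
          linarith) (by simp) (t + 1)
        ⟨by linarith, le_rfl⟩
      rw [add_sub_cancel_left] at h1
      linarith
    have hl := (hy0.comp (tendsto_atTop_add_const_right _ 1 tendsto_id)).sub hy0
    have := le_of_tendsto hl hdrop
    linarith
  subst hcm
  have hsq : h ^ 2 = Hs ^ 2 := by linarith
  have hhs : h = Hs := by
    rcases sq_eq_sq_iff_eq_or_eq_neg.1 hsq with e | e
    · exact e
    -- in a contracting universe the density would increase
    · exfalso
      have hαy : Tendsto (fun t => 3 * γ * (X t).2.2 + α (X t).1 * (X t).2.1) atTop
          (𝓝 (3 * γ * h + α c * 0)) :=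
        (hh.const_mul (3 * γ)).add (((hαc.tendsto c).comp hcl).mul hy0)
      have hneg : 3 * γ * h + α c * 0 < 0 := by
        rw [e]
        have := mul_pos hγ₀ hHs
        linarith
      obtain ⟨T, hT⟩ := eventually_atTop.1 (hαy.eventually (gt_mem_nhds hneg))
      set T₀ := max T 0 with hT₀
      have hT0 : 0 ≤ T₀ := le_max_right _ _
      have hmonoρ : ∀ t ≥ T₀, fluidDensity V (X T₀) ≤ fluidDensity V (X t) := by
        intro t ht
        refine le_of_deriv_le (f := fun _ => fluidDensity V (X T₀)) (f' := fun _ => 0)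
          (g := fun t => fluidDensity V (X t)) continuousOn_const
          (hρc.comp_continuousOn (hX.continuousOn.mono fun τ hτ => hT0.trans hτ.1))
          (fun _ _ => hasDerivAt_const _ _)
          (fun τ hτ => hasDerivAt_fluidDensity hV (hX.hasDerivAt (hT0.trans_lt hτ.1)))
          (fun τ hτ => ?_) le_rfl t ⟨ht, le_rfl⟩
        have e1 := hT τ ((le_max_left _ _).trans hτ.1.le)
        have e2 := hρ τ (hT0.trans hτ.1.le)
        have := mul_nonneg e2.le (neg_nonneg.2 e1.le)
        linarith
      have := ge_of_tendsto hρ0 ((eventually_ge_atTop T₀).mono hmonoρ)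
      linarith [hρ T₀ hT0]
  subst hhs
  exact ⟨X, hX, rfl, fun t ht => ⟨hlt t ht, hρ t ht, hHge t ht⟩,
    hcl.prodMk_nhds (hy0.prodMk_nhds hh)⟩

end Dynamics

/-! ### Continuation of trajectories -/

section Continuation

variable {E : Type*} [NormedAddCommGroup E] [NormedSpace ℝ E] {v : E → E} {X Y : ℝ → E}

theorem hasDerivWithinAt_sub_const {f : ℝ → E} {f' : E} {s : Set ℝ} {a t : ℝ}
    (h : HasDerivWithinAt f f' s (t - a)) :
    HasDerivWithinAt (fun τ => f (τ - a)) f' ((fun τ => τ - a) ⁻¹' s) t := by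
  have := HasDerivWithinAt.scomp t (h := fun τ => τ - a) h
    ((hasDerivWithinAt_id t ((fun τ => τ - a) ⁻¹' s)).sub_const a) (mapsTo_preimage _ _)
  rwa [one_smul] at this

/-- The differential equation also holds at the endpoints, with one-sided derivatives. -/
theorem IsTraj.hasDerivWithinAt (hv : Continuous v) {s : ℝ} (hs : 0 < s) (h : IsTraj v s X) :
    ∀ t ∈ Icc 0 s, HasDerivWithinAt X (v (X t)) (Icc 0 s) t := by
  have hdiff : DifferentiableOn ℝ X (Ioo 0 s) := fun t ht =>
    (h.2 t ht).differentiableAt.differentiableWithinAt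
  intro t ht
  have hcv : Tendsto (fun τ => v (X τ)) (𝓝[Ioo 0 s] t) (𝓝 (v (X t))) :=
    (hv.comp_continuousOn h.1 t ht).mono_left (nhdsWithin_mono _ Ioo_subset_Icc_self)
  have hderiv : Tendsto (fun τ => deriv X τ) (𝓝[Ioo 0 s] t) (𝓝 (v (X t))) := by
    refine hcv.congr' ?_
    filter_upwards [self_mem_nhdsWithin] with τ hτ using (h.2 τ hτ).deriv.symm
  have hcX : ContinuousWithinAt X (Ioo 0 s) t := (h.1 t ht).mono Ioo_subset_Icc_self
  rcases eq_or_lt_of_le ht.1 with h0 | h0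
  · subst h0
    refine (hasDerivWithinAt_Ici_of_tendsto_deriv hdiff hcX (Ioo_mem_nhdsGT hs) ?_).mono
      Icc_subset_Ici_self
    rwa [nhdsWithin_Ioo_eq_nhdsGT hs] at hderiv
  · rcases eq_or_lt_of_le ht.2 with h1 | h1
    · subst h1
      refine (hasDerivWithinAt_Iic_of_tendsto_deriv hdiff hcX (Ioo_mem_nhdsLT hs) ?_).mono
        Icc_subset_Iic_self
      rwa [nhdsWithin_Ioo_eq_nhdsLT hs] at hderiv
    · exact (h.2 t ⟨h0, h1⟩).hasDerivWithinAt

/-- Concatenation of trajectories. -/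
theorem IsTraj.append (hv : Continuous v) {a b : ℝ} (ha : 0 < a) (hb : 0 < b)
    (hX : IsTraj v a X) (hY : IsTraj v b Y) (hXY : Y 0 = X a) :
    IsTraj v (a + b) (fun t => if t ≤ a then X t else Y (t - a)) := by
  set Z : ℝ → E := fun t => if t ≤ a then X t else Y (t - a) with hZ
  have e1 : EqOn Z X (Icc 0 a) := fun t ht => if_pos ht.2
  have e2 : EqOn Z (fun t => Y (t - a)) (Icc a (a + b)) := by
    intro t ht
    rcases eq_or_lt_of_le ht.1 with h | h
    · simp [hZ, ← h, hXY]
    · exact if_neg (not_le.2 h)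
  have hpre : (fun τ => τ - a) ⁻¹' Icc 0 b = Icc a (a + b) := by
    ext τ
    simp only [mem_preimage, mem_Icc, sub_nonneg, sub_le_iff_le_add, add_comm]
  have d1 : ∀ t ∈ Icc 0 a, HasDerivWithinAt Z (v (Z t)) (Icc 0 a) t := fun t ht => by
    rw [e1 ht]
    exact (hX.hasDerivWithinAt hv ha t ht).congr e1 (e1 ht)
  have d2 : ∀ t ∈ Icc a (a + b), HasDerivWithinAt Z (v (Z t)) (Icc a (a + b)) t := fun t ht => by
    rw [e2 ht]
    have h1 := hasDerivWithinAt_sub_const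
      (hY.hasDerivWithinAt hv hb (t - a) ⟨by linarith [ht.1], by linarith [ht.2]⟩)
    rw [hpre] at h1
    exact h1.congr e2 (e2 ht)
  have hun : Icc 0 a ∪ Icc a (a + b) = Icc 0 (a + b) := Icc_union_Icc_eq_Icc ha.le (by linarith)
  have hder : ∀ t ∈ Icc 0 (a + b), HasDerivWithinAt Z (v (Z t)) (Icc 0 (a + b)) t := by
    intro t ht
    rcases lt_trichotomy t a with h | h | h
    · refine (d1 t ⟨ht.1, h.le⟩).mono_of_mem_nhdsWithin ?_
      rw [← hun]
      filter_upwards [self_mem_nhdsWithin, mem_nhdsWithin_of_mem_nhds (Iio_mem_nhds h)] with τ hτ hτ'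
      rw [hun] at hτ
      exact ⟨hτ.1, le_of_lt hτ'⟩
    · rw [← hun]
      exact (d1 t ⟨ht.1, h.le⟩).union (d2 t ⟨h.ge, ht.2⟩)
    · refine (d2 t ⟨h.le, ht.2⟩).mono_of_mem_nhdsWithin ?_
      filter_upwards [self_mem_nhdsWithin, mem_nhdsWithin_of_mem_nhds (Ioi_mem_nhds h)] with τ hτ hτ'
      exact ⟨le_of_lt hτ', hτ.2⟩
  exact ⟨fun t ht => (hder t ht).continuousWithinAt, fun t ht =>
    (hder t ⟨ht.1.le, ht.2.le⟩).hasDerivAt (Icc_mem_nhds ht.1 ht.2)⟩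

/-- A trajectory with bounded velocity on a half-open interval extends to the closed interval. -/
theorem exists_traj_of_bounded_velocity [FiniteDimensional ℝ E] (hv : Continuous v) {S M : ℝ}
    (hX : ∀ s < S, IsTraj v s X) (hM : ∀ t ∈ Ico 0 S, ‖v (X t)‖ ≤ M) :
    ∃ Z, IsTraj v S Z ∧ EqOn Z X (Ico 0 S) := by
  have hlip : LipschitzOnWith M.toNNReal X (Ico 0 S) := by
    refine (convex_Ico 0 S).lipschitzOnWith_of_nnnorm_hasDerivWithin_le (f' := fun t => v (X t))
      (fun t ht => ?_) fun t ht => ?_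
    · obtain ⟨s, hts, hsS⟩ := exists_between ht.2
      refine ((hX s hsS).hasDerivWithinAt hv (ht.1.trans_lt hts) t
        ⟨ht.1, hts.le⟩).mono_of_mem_nhdsWithin ?_
      filter_upwards [self_mem_nhdsWithin, mem_nhdsWithin_of_mem_nhds (Iio_mem_nhds hts)] with τ hτ hτ'
      exact ⟨hτ.1, le_of_lt hτ'⟩
    · rw [← NNReal.coe_le_coe, coe_nnnorm]
      exact (hM t ht).trans (Real.le_coe_toNNReal M)
  obtain ⟨Z, hZ, heq⟩ := hlip.extend_finite_dimension
  refine ⟨Z, ⟨hZ.continuous.continuousOn, fun t ht => ?_⟩, heq.symm⟩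
  obtain ⟨s, hts, hsS⟩ := exists_between ht.2
  have h1 := (hX s hsS).2 t ⟨ht.1, hts⟩
  rw [← heq ⟨ht.1.le, ht.2⟩]
  refine h1.congr_of_eventuallyEq ?_
  filter_upwards [Ioo_mem_nhds ht.1 ht.2] with τ hτ using (heq ⟨hτ.1.le, hτ.2⟩).symm

end Continuation

/-! ### Solutions of the original system -/

section Solutions

variable {γ φm Hs t₀ : ℝ} {V Q φ y ρ H : ℝ → ℝ} {T : EReal}

theorem timeInterval_coe (t₀ T : ℝ) : timeInterval t₀ (T : EReal) = Ico t₀ T := by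
  ext t
  simp [timeInterval]

theorem timeInterval_mem_nhds {t : ℝ} (h0 : t₀ < t) (hT : (t : EReal) < T) :
    timeInterval t₀ T ∈ 𝓝 t := by
  have h1 : {τ : ℝ | (τ : EReal) < T} ∈ 𝓝 t :=
    (isOpen_lt continuous_coe_real_ereal continuous_const).mem_nhds hT
  filter_upwards [Ioi_mem_nhds h0, h1] with τ g1 g2 using ⟨le_of_lt g1, g2⟩

/-- A solution of the original system, shifted to the initial time `0`, as a curve in the phase
space of the reduced system. -/
def phaseCurve (t₀ : ℝ) (φ y H : ℝ → ℝ) (t : ℝ) : ℝ × ℝ × ℝ := (φ (t₀ + t), y (t₀ + t), H (t₀ + t))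

theorem IsSolution.fluidDensity_phaseCurve (h : IsSolution γ V Q t₀ T φ y ρ H) {t : ℝ} (ht : 0 ≤ t)
    (htT : ((t₀ + t : ℝ) : EReal) < T) : fluidDensity V (phaseCurve t₀ φ y H t) = ρ (t₀ + t) := by
  have := h.friedmann (t₀ + t) ⟨by linarith, htT⟩
  simp only [fluidDensity, phaseCurve]
  linarith

theorem IsSolution.isTraj (h : IsSolution γ V Q t₀ T φ y ρ H) {s : ℝ}
    (hs : ((t₀ + s : ℝ) : EReal) < T) :
    IsTraj (cosmoField γ V (couplingCoeff γ Q)) s (phaseCurve t₀ φ y H) := by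
  have hT : ∀ t ≤ s, ((t₀ + t : ℝ) : EReal) < T := fun t ht =>
    lt_of_le_of_lt (EReal.coe_le_coe_iff.2 (by linarith)) hs
  have hmem : ∀ t ∈ Icc 0 s, t₀ + t ∈ timeInterval t₀ T := fun t ht =>
    ⟨by linarith [ht.1], hT t ht.2⟩
  constructor
  · have hmaps : MapsTo (fun t => t₀ + t) (Icc 0 s) (timeInterval t₀ T) := hmem
    have hadd : ContinuousOn (fun t : ℝ => t₀ + t) (Icc 0 s) := by fun_prop
    have c1 : ContinuousOn φ (timeInterval t₀ T) := fun t ht => (h.deriv_field t ht).continuousWithinAt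
    have c2 : ContinuousOn y (timeInterval t₀ T) := fun t ht =>
      (h.deriv_velocity t ht).continuousWithinAt
    have c3 : ContinuousOn H (timeInterval t₀ T) := fun t ht =>
      (h.deriv_hubble t ht).continuousWithinAt
    exact (c1.comp hadd hmaps).prodMk ((c2.comp hadd hmaps).prodMk (c3.comp hadd hmaps))
  · intro t ht
    have ht' := hmem t ⟨ht.1.le, ht.2.le⟩
    have hn : timeInterval t₀ T ∈ 𝓝 (t₀ + t) := timeInterval_mem_nhds (by linarith [ht.1]) ht'.2
    have hρ := h.fluidDensity_phaseCurve ht.1.le (hT t ht.2.le)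
    refine hasDerivAt_triple_iff.2 ⟨?_, ?_, ?_⟩
    · exact ((h.deriv_field _ ht').hasDerivAt hn).comp_const_add t₀ t
    · refine (((h.deriv_velocity _ ht').hasDerivAt hn).comp_const_add t₀ t).congr_deriv ?_
      simp only [fieldAccel, hρ]
      simp only [phaseCurve]
    · refine (((h.deriv_hubble _ ht').hasDerivAt hn).comp_const_add t₀ t).congr_deriv ?_
      simp only [hubbleRate, hρ]
      simp only [phaseCurve]
      ring

/-- Conversely, trajectories of the reduced system yield solutions of the original one. -/
theorem IsTraj.isSolution (hV : ContDiff ℝ 1 V) (hQ : Continuous (couplingCoeff γ Q)) {s : ℝ}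
    (hs : 0 < s) {Z : ℝ → ℝ × ℝ × ℝ} (hZ : IsTraj (cosmoField γ V (couplingCoeff γ Q)) s Z) (t₀ : ℝ) :
    IsSolution γ V Q t₀ ((t₀ + s : ℝ) : EReal) (fun t => (Z (t - t₀)).1) (fun t => (Z (t - t₀)).2.1)
      (fun t => fluidDensity V (Z (t - t₀))) (fun t => (Z (t - t₀)).2.2) := by
  have hd : ∀ t ∈ Ico t₀ (t₀ + s), HasDerivWithinAt (fun t => Z (t - t₀))
      (cosmoField γ V (couplingCoeff γ Q) (Z (t - t₀))) (Ico t₀ (t₀ + s)) t := by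
    intro t ht
    refine (hasDerivWithinAt_sub_const (hZ.hasDerivWithinAt (continuous_cosmoField hV hQ) hs (t - t₀)
      ⟨by linarith [ht.1], by linarith [ht.2]⟩)).mono fun τ hτ => ?_
    exact ⟨by linarith [hτ.1], by linarith [hτ.2]⟩
  have d1 : ∀ t ∈ Ico t₀ (t₀ + s), HasDerivWithinAt (fun t => (Z (t - t₀)).1)
      (Z (t - t₀)).2.1 (Ico t₀ (t₀ + s)) t := fun t ht =>
    (hasFDerivAt_fst (𝕜 := ℝ) (E := ℝ) (F := ℝ × ℝ)).comp_hasDerivWithinAt t (hd t ht)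
  have d23 : ∀ t ∈ Ico t₀ (t₀ + s), HasDerivWithinAt (fun t => (Z (t - t₀)).2)
      (fieldAccel V (couplingCoeff γ Q) (Z (t - t₀)), hubbleRate γ V (Z (t - t₀)))
      (Ico t₀ (t₀ + s)) t := fun t ht =>
    (hasFDerivAt_snd (𝕜 := ℝ) (E := ℝ) (F := ℝ × ℝ)).comp_hasDerivWithinAt t (hd t ht)
  have d2 : ∀ t ∈ Ico t₀ (t₀ + s), HasDerivWithinAt (fun t => (Z (t - t₀)).2.1)
      (fieldAccel V (couplingCoeff γ Q) (Z (t - t₀))) (Ico t₀ (t₀ + s)) t := fun t ht =>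
    (hasFDerivAt_fst (𝕜 := ℝ) (E := ℝ) (F := ℝ)).comp_hasDerivWithinAt t (d23 t ht)
  have d3 : ∀ t ∈ Ico t₀ (t₀ + s), HasDerivWithinAt (fun t => (Z (t - t₀)).2.2)
      (hubbleRate γ V (Z (t - t₀))) (Ico t₀ (t₀ + s)) t := fun t ht =>
    (hasFDerivAt_snd (𝕜 := ℝ) (E := ℝ) (F := ℝ)).comp_hasDerivWithinAt t (d23 t ht)
  constructor
  · exact EReal.coe_lt_coe_iff.2 (by linarith)
  all_goals
    rw [timeInterval_coe]
    intro t ht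
  · exact d1 t ht
  · exact (d2 t ht).congr_deriv (by simp only [fieldAccel])
  · have d4 := (hV.differentiable one_ne_zero (Z (t - t₀)).1).hasDerivAt.comp_hasDerivWithinAt t
      (d1 t ht)
    refine (((((d3 t ht).pow 2).const_mul 3).sub (((d2 t ht).pow 2).div_const 2)).sub
      d4).congr_deriv ?_
    simp only [fieldAccel, hubbleRate, fluidDensity]
    norm_num
    ring
  · exact (d3 t ht).congr_deriv (by simp only [hubbleRate]; ring)
  · simp only [fluidDensity]
    ring

/-- A maximal solution with bounded Hubble function which stays to the left of `φm` exists for all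
times. -/
theorem IsMaximalSolution.ne_coe (hγ₀ : 0 < γ) (hγ₂ : γ ≤ 2) (hV : ContDiff ℝ 1 V)
    (hbot : Tendsto V atBot atBot) (hQ : Continuous (couplingCoeff γ Q)) {T : ℝ}
    (h : IsMaximalSolution γ V Q t₀ (T : EReal) φ y ρ H) (hρ : 0 < ρ t₀)
    (hlt : ∀ t ∈ Ico t₀ T, φ t ≤ φm) {h₀ : ℝ} (hH : ∀ t ∈ Ico t₀ T, h₀ ≤ H t) : False := by
  have hsol := h.isSolution
  have hT : t₀ < T := EReal.coe_lt_coe_iff.1 hsol.lt_end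
  set α := couplingCoeff γ Q
  set X := phaseCurve t₀ φ y H with hX
  have hv := continuous_cosmoField (γ := γ) hV hQ
  have htraj : ∀ s < T - t₀, IsTraj (cosmoField γ V α) s X := fun s hs =>
    hsol.isTraj (EReal.coe_lt_coe_iff.2 (by linarith))
  have hX0 : 0 < fluidDensity V (X 0) := by
    rw [hX, hsol.fluidDensity_phaseCurve le_rfl (EReal.coe_lt_coe_iff.2 (by linarith)), add_zero]
    exact hρ
  obtain ⟨lo, hi, -, hbox⟩ := exists_box_of_hubble_ge (α := α) hγ₀ hγ₂ hV hbot φm h₀ (X 0)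
  obtain ⟨M, hM⟩ := (isCompact_Icc (a := lo) (b := hi)).exists_bound_of_continuousOn hv.continuousOn
  obtain ⟨Z, hZ, hZX⟩ := exists_traj_of_bounded_velocity hv htraj (M := M) fun t ht =>
    hM _ (hbox t X (htraj t ht.2) rfl (fun τ hτ =>
      ⟨fluidDensity_pos hV hQ (htraj t ht.2) hX0 τ hτ,
        hlt (t₀ + τ) ⟨by linarith [hτ.1], by linarith [hτ.2, ht.2]⟩,
        hH (t₀ + τ) ⟨by linarith [hτ.1], by linarith [hτ.2, ht.2]⟩⟩) t ⟨ht.1, le_rfl⟩)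
  obtain ⟨b, hb, Y, hY, hY0⟩ := exists_traj_cosmoField (γ := γ) hV hQ (Z (T - t₀))
  have hnew := (hZ.append hv (by linarith) hb hY hY0).isSolution hV hQ (by linarith) t₀
  have heq : ∀ t ∈ timeInterval t₀ (T : EReal),
      (if t - t₀ ≤ T - t₀ then Z (t - t₀) else Y (t - t₀ - (T - t₀))) = (φ t, y t, H t) := by
    intro t ht
    rw [timeInterval_coe] at ht
    rw [if_pos (by linarith [ht.2]), hZX ⟨by linarith [ht.1], by linarith [ht.2]⟩]
    simp only [hX, phaseCurve, add_sub_cancel]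
  have hle := h.maximal _ _ _ _ _ hnew (fun t ht => by simp only [heq t ht])
    (fun t ht => by simp only [heq t ht]) (fun t ht => by
      have := hsol.friedmann t ht
      simp only [heq t ht, fluidDensity]
      linarith) (fun t ht => by simp only [heq t ht])
  have := EReal.coe_le_coe_iff.1 hle
  linarith

/-- The initial data of a maximal solution which stays to the left of the maximum and does not
collapse belong to the set of data converging to the saddle. -/
theorem IsMaximalSolution.mem_saddleSet (hγ₀ : 0 < γ) (hγ₂ : γ ≤ 2) (hV : ContDiff ℝ 1 V)
    (hbot : Tendsto V atBot atBot) (hinc : ∀ x < φm, 0 < deriv V x) (hHs : 0 < Hs)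
    (hsaddle : 3 * Hs ^ 2 = V φm) (hQ : Continuous (couplingCoeff γ Q))
    (h : IsMaximalSolution γ V Q t₀ T φ y ρ H) (hρ : 0 < ρ t₀)
    (hlt : ∀ t ∈ timeInterval t₀ T, φ t < φm) (hnc : ¬ CollapsesInFiniteTime t₀ T H) :
    (φ t₀, y t₀, H t₀) ∈ saddleSet γ V (couplingCoeff γ Q) φm Hs := by
  have hsol := h.isSolution
  have hX0 : 0 < fluidDensity V (phaseCurve t₀ φ y H 0) := by
    rw [hsol.fluidDensity_phaseCurve le_rfl (by rw [add_zero]; exact hsol.lt_end), add_zero]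
    exact hρ
  induction T using EReal.rec with
  | bot => exact absurd hsol.lt_end not_lt_bot
  | coe T =>
    exfalso
    have hT : t₀ < T := EReal.coe_lt_coe_iff.1 hsol.lt_end
    rw [timeInterval_coe] at hlt
    refine hnc ⟨T, hT, rfl, tendsto_atBot.2 fun b => ?_⟩
    obtain ⟨t₁, h1, hb⟩ : ∃ t₁ ∈ Ico t₀ T, H t₁ < b := by
      by_contra hcon
      push Not at hcon
      exact h.ne_coe hγ₀ hγ₂ hV hbot hQ hρ (fun t ht => (hlt t ht).le) hcon
    filter_upwards [Ioo_mem_nhdsLT h1.2] with t ht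
    have htr := hsol.isTraj (s := t - t₀) (EReal.coe_lt_coe_iff.2 (by linarith [ht.2]))
    have hant := hubble_antitone hγ₀ htr (fluidDensity_pos hV hQ htr hX0) (t₁ - t₀) (t - t₀)
      (by linarith [h1.1]) (by linarith [ht.1]) le_rfl
    simp only [phaseCurve, add_sub_cancel] at hant
    linarith
  | top =>
    have hmem : ∀ t ≥ t₀, t ∈ timeInterval t₀ ⊤ := fun t ht => ⟨ht, EReal.coe_lt_top t⟩
    have hX : IsGlobalTraj (cosmoField γ V (couplingCoeff γ Q)) (phaseCurve t₀ φ y H) := fun s =>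
      hsol.isTraj (EReal.coe_lt_top _)
    have := mem_saddleSet_of_global hγ₀ hγ₂ hV hbot hinc hHs hsaddle hQ hX hX0
      fun t ht => hlt _ (hmem _ (by linarith))
    simpa only [phaseCurve, add_zero] using this

/-- The potential increases up to its critical point. -/
theorem IsCollapsePotential.deriv_pos (hV : IsCollapsePotential V φm) : ∀ x < φm, 0 < deriv V x := by
  intro x₀ hx₀
  by_contra hcon
  have hne : ∀ x < φm, deriv V x ≠ 0 := fun x hx h => hx.ne ((hV.critical_iff x).1 h)
  have hc := hV.contDiff.continuous_deriv le_rfl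
  have hneg : ∀ x < φm, deriv V x < 0 := by
    intro x hx
    by_contra hx'
    have h0 : (0 : ℝ) ∈ uIcc (deriv V x₀) (deriv V x) :=
      mem_uIcc.2 (Or.inl ⟨not_lt.1 hcon, not_lt.1 hx'⟩)
    obtain ⟨z, hz, hz0⟩ := intermediate_value_uIcc hc.continuousOn h0
    exact hne z (hz.2.trans_lt (max_lt hx₀ hx)) hz0
  have hanti : StrictAntiOn V (Iic φm) := by
    refine strictAntiOn_of_deriv_neg (convex_Iic _) hV.contDiff.continuous.continuousOn fun x hx => ?_
    rw [interior_Iic] at hx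
    exact hneg x hx
  obtain ⟨x, h1, h2⟩ := ((hV.tendsto_atBot.eventually (eventually_lt_atBot 0)).and
    (eventually_lt_atBot φm)).exists
  have := hanti (mem_Iic.2 h2.le) (mem_Iic.2 le_rfl) h2
  linarith [hV.pos_value]

/-- The set of data converging to the saddle is null. -/
theorem IsCollapsePotential.volume_saddleSet (hγ₀ : 0 < γ) (hγ₂ : γ ≤ 2)
    (hV : IsCollapsePotential V φm) (hQc : Continuous (couplingCoeff γ Q)) (hQ₀ : ∀ x, 0 ≤ Q x)
    {A : ℝ} (hA : ∀ x, |couplingCoeff γ Q x| ≤ A) (hHs : 0 < Hs) (hsaddle : 3 * Hs ^ 2 = V φm) :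
    volume (saddleSet γ V (couplingCoeff γ Q) φm Hs) = 0 := by
  rcases le_total 0 ((4 - 3 * γ) / 2) with h | h
  · obtain ⟨v, hv, hv'⟩ := hV.nondegenerate
    exact volume_saddleSet_of_nonneg hγ₀ hγ₂ hV.contDiff (fun x hx => (hV.deriv_pos x hx).ne')
      ((hV.critical_iff φm).2 rfl) hV.pos_value hv hv' hHs hsaddle hQc hA
      fun x => mul_nonneg h (hQ₀ x)
  · exact volume_saddleSet_of_nonpos hγ₀ hγ₂ hV.contDiff hV.deriv_pos hHs hsaddle hQc hA
      fun x => mul_nonpos_of_nonpos_of_nonneg h (hQ₀ x)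

end Solutions

/-- Initial data are coordinatized by `p = (φ(t₀), y(t₀), ρ(t₀))`; the constraint and `H(t₀) > 0`
determine `H(t₀)`. The first null set is that of the data below the critical velocity from which
some maximal solution does not collapse in finite time; the second one is that of the data from
which some maximal solution stays to the left of `φm` and does not collapse in finite time. -/
theorem theorem1 (γ : ℝ) (hγ₀ : 0 < γ) (hγ₂ : γ ≤ 2) (V Q : ℝ → ℝ) (φm : ℝ)
    (hV : IsCollapsePotential V φm)
    (hQc : Continuous Q) (hQ₀ : ∀ x, 0 ≤ Q x) (hQb : ∃ A, ∀ x, |couplingCoeff γ Q x| ≤ A)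
    (t₀ : ℝ) :
    volume {p : ℝ × ℝ × ℝ | ∃ (T : EReal) (φ y ρ H : ℝ → ℝ),
        IsMaximalSolution γ V Q t₀ T φ y ρ H ∧ φ t₀ = p.1 ∧ y t₀ = p.2.1 ∧ ρ t₀ = p.2.2 ∧
        φ t₀ < φm ∧ 0 < ρ t₀ ∧ 0 < H t₀ ∧
        (y t₀ : EReal) < criticalVelocity γ V Q φm t₀ (φ t₀) (ρ t₀) ∧
        ¬ CollapsesInFiniteTime t₀ T H} = 0 ∧
    volume {p : ℝ × ℝ × ℝ | ∃ (T : EReal) (φ y ρ H : ℝ → ℝ),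
        IsMaximalSolution γ V Q t₀ T φ y ρ H ∧ φ t₀ = p.1 ∧ y t₀ = p.2.1 ∧ ρ t₀ = p.2.2 ∧
        φ t₀ < φm ∧ 0 < ρ t₀ ∧ 0 < H t₀ ∧
        (∀ t ∈ timeInterval t₀ T, φ t < φm) ∧
        ¬ CollapsesInFiniteTime t₀ T H} = 0 := by
  have hα : Continuous (couplingCoeff γ Q) := continuous_const.mul hQc
  obtain ⟨A, hA⟩ := hQb
  obtain ⟨Hs, hHs, hsaddle⟩ : ∃ Hs > 0, 3 * Hs ^ 2 = V φm := by
    have h3 : 0 < V φm / 3 := by linarith [hV.pos_value]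
    refine ⟨Real.sqrt (V φm / 3), Real.sqrt_pos.2 h3, ?_⟩
    rw [Real.sq_sqrt h3.le]
    ring
  have h0 := hV.volume_saddleSet hγ₀ hγ₂ hα hQ₀ hA hHs hsaddle
  -- the constraint expresses the initial density by the phase space coordinates
  have hdiff : DifferentiableOn ℝ (fun q : ℝ × ℝ × ℝ => (q.1, q.2.1, fluidDensity V q))
      (saddleSet γ V (couplingCoeff γ Q) φm Hs) := by
    have := hV.contDiff.differentiable one_ne_zero
    refine Differentiable.differentiableOn ?_
    unfold fluidDensity
    fun_prop
  have := isAddHaarMeasure_volume_triple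
  have himage := addHaar_image_eq_zero_of_differentiableOn_of_addHaar_eq_zero volume hdiff h0
  have hsecond : volume {p : ℝ × ℝ × ℝ | ∃ (T : EReal) (φ y ρ H : ℝ → ℝ),
        IsMaximalSolution γ V Q t₀ T φ y ρ H ∧ φ t₀ = p.1 ∧ y t₀ = p.2.1 ∧ ρ t₀ = p.2.2 ∧
        φ t₀ < φm ∧ 0 < ρ t₀ ∧ 0 < H t₀ ∧
        (∀ t ∈ timeInterval t₀ T, φ t < φm) ∧
        ¬ CollapsesInFiniteTime t₀ T H} = 0 := by
    refine measure_mono_null ?_ himage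
    rintro p ⟨T, φ, y, ρ, H, h, e1, e2, e3, -, hρ, -, hlt, hnc⟩
    refine ⟨_, h.mem_saddleSet hγ₀ hγ₂ hV.contDiff hV.tendsto_atBot hV.deriv_pos hHs hsaddle hα hρ
      hlt hnc, ?_⟩
    have hf := h.isSolution.friedmann t₀ ⟨le_rfl, h.isSolution.lt_end⟩
    have e4 : fluidDensity V (φ t₀, y t₀, H t₀) = p.2.2 := by
      rw [← e3]
      simp only [fluidDensity]
      linarith
    simp only [e1, e2] at e4 ⊢
    rw [e4]
  refine ⟨measure_mono_null ?_ hsecond, hsecond⟩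
  rintro p ⟨T, φ, y, ρ, H, h, e1, e2, e3, hφ, hρ, hH, hcrit, hnc⟩
  refine ⟨T, φ, y, ρ, H, h, e1, e2, e3, hφ, hρ, hH, fun t ht => ?_, hnc⟩
  by_contra hge
  refine absurd hcrit (not_lt.2 (sInf_le ?_))
  exact ⟨y t₀, T, φ, y, ρ, H, rfl, h.isSolution, rfl, rfl, rfl, hH, t, ht, not_lt.1 hge⟩
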